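/- **Scheme.** A *comparison-based public quantum coin scheme with private verification* $\mathcal M$ consists, for each security parameter $\lambda$, of: a distribution of a classical secret key $sk$; a pure coin state $|¢_{sk}\rangle$ on $\ell(\lambda)\ge 1$ qubits, which every call of $\mathsf{mint}(sk)$ outputs; a private verification $\mathsf{verify}_{sk}$, i.e. an accept/reject quantum instrument on one coin register; and a keyless public verification algorithm, which always halts and verifies one alleged coin with the help of the verifier's wallet, leaving a new wallet. The wallet initially consists of one fresh coin $|¢_{sk}\rangle$. The public $\mathsf{Count}$ verifies the submitted alleged coins one by one with the same wallet and outputs the number accepted; the private count $\mathsf{Count}_{refund}$ runs $\mathsf{verify}_{sk}$ on each of the coins in a wallet and outputs the number accepted. Efficiency of an algorithm means: one program (for all $\lambda$) for a quantum computer with classical control over a fixed gate set $G$ containing Clifford+T, measurements and coin tosses, halting within polynomially many steps on every computation path; $G$ is arbitrary otherwise, and may contain families of gates with a numerical parameter. **Game.** With $sk$ drawn at random, an adversary $\mathcal A$ with input $\lambda$ (and $\ell(\lambda)$) and oracle access to $\mathsf{mint}(sk)$ and $\mathsf{verify}_{sk}$ (which returns the post-verified state) attacks $k$ verifiers one after the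 other. For $i=1,\dots,k(\lambda)$ it submits a state of $m_i$ alleged coins of its choice, possibly entangled with each other and with its own memory, to the $i$-th verifier, whose wallet is fresh; it learns $m_i'\gets\mathsf{Count}(\rho_i)$; then $refund_i'\gets\mathsf{Count}_{refund}(\omega_i')$ is computed on the resulting wallet $\omega_i'$ and not revealed. The loss of the $i$-th verifier is $L_i=m_i+1-refund_i'$ if $m_i'=m_i$ and $L_i=1-refund_i'$ otherwise, and $L(\mathcal A)=\sum_{i=1}^{k}L_i$. **Security.** For a class of adversaries, $\mathcal M$ is *nonadaptive rationally secure against private sabotage* if for every $\mathcal A$ of the class in the game with one verifier ($k=1$) there is a negligible function $\varepsilon$ with $\mathbb E[L(\mathcal A)]\le\varepsilon(\lambda)$ for all $\lambda$; it is *multiverifier nonadaptive rationally secure against private sabotage* if the same holds in the game with $k(\lambda)$ verifiers for every polynomially bounded function $k$ and every $\mathcal A$ of the class. The class is that of quantum polynomial-time adversaries (one program over $G$ for all $\lambda$, halting in polynomial time) for the plain notions. For the *unconditional* notions it is that of unbounded adversaries: for each $\lambda$ an arbitrary halting program over arbitrary quantum instruments, which makes polynomially many oracle queries. **Proposition.**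 Let $\mathcal M$ be a comparison-based public quantum coin scheme with private verification. 1. If the public verification of $\mathcal M$ is quantum polynomial time (the number $\ell(\lambda)$ of qubits of a coin being polynomially bounded, and the time being polynomial in $\lambda$ and the number of coins already received), and $\mathcal M$ is nonadaptive rationally secure against private sabotage, then $\mathcal M$ is multiverifier nonadaptive rationally secure against private sabotage. 2. If $\mathcal M$, efficient or not, is unconditionally nonadaptive rationally secure against private sabotage, then it is unconditionally multiverifier nonadaptive rationally secure against private sabotage. This holds both when the number of submitted coins is not restricted and when unbounded adversaries are required to submit only polynomially many coins. -/

import Mathlib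

open scoped Matrix

noncomputable section

namespace QCoin

/-! ### Quantum memory

Qubits carry names in `ℕ`.  A computational basis state is the finite set of the qubits that
are `1`; every other qubit is `0`.  A pure state, not necessarily normalised, is a finite linear
combination of basis states.  A program, a verifier or the bank can reach a qubit only if it
holds the name of that qubit, and names are moved around but never copied. -/

/-- Bit strings of length `n`. -/
abbrev Bits (n : ℕ) : Type := Fin n → Bool

/-- Pure states of the quantum memory; the squared norm is the probability of the branch. -/
abbrev Ket : Type := Finset ℕ →₀ ℂ

/-- Squared norm of a state. -/
def normSq (ψ : Ket) : ℝ := ψ.sum fun _ a => ‖a‖ ^ 2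

/-- The values of the `n` qubits named `hs` in the basis state `s`. -/
def readBits (n : ℕ) (hs : List ℕ) (s : Finset ℕ) : Bits n :=
  fun i => decide (hs.getD i 0 ∈ s)

/-- The basis state `s` with the values of the `n` qubits named `hs` replaced by `b`. -/
def writeBits {n : ℕ} (hs : List ℕ) (s : Finset ℕ) (b : Bits n) : Finset ℕ :=
  (s \ hs.toFinset) ∪
    Finset.image (fun i : Fin n => hs.getD i 0) (Finset.univ.filter fun i => b i = true)

/-- The operator `K` on `n` qubits, applied to the qubits named `hs`. -/
def applyOp {n : ℕ} (K : Matrix (Bits n) (Bits n) ℂ) (hs : List ℕ) (ψ : Ket) : Ket :=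
  ψ.sum fun s a => ∑ b : Bits n, Finsupp.single (writeBits hs s b) (K b (readBits n hs s) * a)

/-- Puts the qubits named `hs`, which are all `0`, into the state `v`. -/
def prepare {n : ℕ} (v : Bits n → ℂ) (hs : List ℕ) (ψ : Ket) : Ket :=
  ψ.sum fun s a => ∑ b : Bits n, Finsupp.single (writeBits hs s b) (v b * a)

/-! ### Quantum instruments -/

/-- A quantum instrument on `n` qubits with one classical output bit, given by Kraus operators:
outcome `β` has the operators `kraus i` with `result i = β`. -/
structure Instrument (n : ℕ) where
  branches : ℕ
  kraus : Fin branches → Matrix (Bits n) (Bits n) ℂ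
  result : Fin branches → Bool
  complete : ∑ i, (kraus i)ᴴ * kraus i = 1

/-- A unitary gate, as an instrument whose output bit is constantly `false`. -/
def Instrument.ofUnitary {n : ℕ} (U : Matrix (Bits n) (Bits n) ℂ) (hU : Uᴴ * U = 1) :
    Instrument n where
  branches := 1
  kraus := fun _ => U
  result := fun _ => false
  complete := by simpa using hU

/-- The Hadamard matrix. -/
def hadamardMatrix : Matrix (Bits 1) (Bits 1) ℂ :=
  Matrix.of fun a b => (if a 0 = true ∧ b 0 = true then -1 else 1) * ((√2 : ℝ) : ℂ)⁻¹

theorem hadamardMatrix_unitary : hadamardMatrixᴴ * hadamardMatrix = 1 := by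
  have h2 : ((√2 : ℝ) : ℂ)⁻¹ * ((√2 : ℝ) : ℂ)⁻¹ = 1 / 2 := by
    rw [← mul_inv, ← Complex.ofReal_mul, Real.mul_self_sqrt (by norm_num)]
    norm_num
  ext a b
  rw [Matrix.mul_apply, ← (Equiv.funUnique (Fin 1) Bool).symm.sum_comp, Fintype.sum_bool]
  have hab : a = b ↔ a 0 = b 0 :=
    ⟨fun h => h ▸ rfl, fun h => funext fun i => by rw [Subsingleton.elim i 0]; exact h⟩
  rw [Matrix.one_apply]
  simp only [hab]
  rcases ha : a 0 with _ | _ <;> rcases hb : b 0 with _ | _ <;>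
    simp [hadamardMatrix, Matrix.conjTranspose_apply, ha, hb, h2] <;> norm_num

/-- The `π/8` gate `diag(1, exp(iπ/4))`. -/
def tMatrix : Matrix (Bits 1) (Bits 1) ℂ :=
  Matrix.diagonal fun b => if b 0 = true then Complex.exp ((Real.pi / 4 : ℝ) * Complex.I) else 1

theorem tMatrix_unitary : tMatrixᴴ * tMatrix = 1 := by
  rw [tMatrix, Matrix.diagonal_conjTranspose, Matrix.diagonal_mul_diagonal,
    ← Matrix.diagonal_one]
  congr 1
  funext b
  by_cases hb : b 0 = true
  · simp only [hb, if_true, Pi.star_apply, RCLike.star_def]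
    rw [mul_comm, Complex.mul_conj, Complex.normSq_eq_norm_sq, Complex.norm_exp_ofReal_mul_I]
    norm_num
  · simp [hb]

/-- The action of CNOT on basis states: the first bit controls the second. -/
def cnotMap (b : Bits 2) : Bits 2 := ![b 0, xor (b 0) (b 1)]

/-- The controlled-not matrix. -/
def cnotMatrix : Matrix (Bits 2) (Bits 2) ℂ :=
  Matrix.of fun a b => if a = cnotMap b then 1 else 0

theorem cnotMatrix_unitary : cnotMatrixᴴ * cnotMatrix = 1 := by
  have hinj : ∀ a b : Bits 2, cnotMap a = cnotMap b ↔ a = b := by decide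
  ext a b
  rw [Matrix.mul_apply, Matrix.one_apply]
  simp only [cnotMatrix, Matrix.conjTranspose_apply, Matrix.of_apply]
  simp [← hinj a b, eq_comm]

/-- Measurement of one qubit in the computational basis. -/
def measurement : Instrument 1 where
  branches := 2
  kraus := fun i => Matrix.diagonal fun b => if b 0 = decide (i = 1) then 1 else 0
  result := fun i => decide (i = 1)
  complete := by
    simp only [Matrix.diagonal_conjTranspose, Matrix.diagonal_mul_diagonal, Fin.sum_univ_two,
      Matrix.diagonal_add]
    rw [← Matrix.diagonal_one]
    congr 1
    funext b
    rcases hb : b 0 with _ | _ <;> simp [hb]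

/-- A fair coin toss. -/
def coinToss : Instrument 0 where
  branches := 2
  kraus := fun _ => ((√2 : ℝ) : ℂ)⁻¹ • 1
  result := fun i => decide (i = 1)
  complete := by
    have h2 : ((√2 : ℝ) : ℂ)⁻¹ * ((√2 : ℝ) : ℂ)⁻¹ = 1 / 2 := by
      rw [← mul_inv, ← Complex.ofReal_mul, Real.mul_self_sqrt (by norm_num)]
      norm_num
    simp only [Matrix.conjTranspose_smul, Matrix.conjTranspose_one, Fin.sum_univ_two,
      Matrix.smul_mul, Matrix.one_mul, smul_smul]
    rw [← add_smul]
    have : star ((√2 : ℝ) : ℂ)⁻¹ = ((√2 : ℝ) : ℂ)⁻¹ := by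
      simp [star_inv₀]
    rw [this, h2]
    norm_num

/-- An elementary operation.  It may have a numerical parameter, as the rotations by `2π/2^j`. -/
abbrev Gate : Type := ℕ → Σ n : ℕ, Instrument n

/-- An elementary operation without a parameter. -/
def Gate.const {n : ℕ} (I : Instrument n) : Gate := fun _ => ⟨n, I⟩

/-- A set of elementary operations. -/
abbrev GateSet : Type := Set Gate

/-- The universal gate set Clifford + T with measurements and coin tosses. -/
def cliffordT : GateSet :=
  {Gate.const (Instrument.ofUnitary hadamardMatrix hadamardMatrix_unitary),
   Gate.const (Instrument.ofUnitary tMatrix tMatrix_unitary),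
   Gate.const (Instrument.ofUnitary cnotMatrix cnotMatrix_unitary),
   Gate.const measurement,
   Gate.const coinToss}

/-! ### Quantum programs with classical control

A program has classical stacks of bits, indexed by `C`, and stacks of qubits, indexed by `Q`
(each holds a list of qubit names, the head being the top), and it may call oracles indexed
by `O`.  Below the bottom of a stack of qubits there are fresh qubits in state `0`. -/

/-- The programming language. -/
inductive Cmd (O C Q : Type) : Type where
  /-- Do nothing. -/
  | skip : Cmd O C Q
  /-- Sequential composition. -/
  | seq (a b : Cmd O C Q) : Cmd O C Q
  /-- Push the bit `b` on the classical stack `x`. -/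
  | push (x : C) (b : Bool) : Cmd O C Q
  /-- Remove the top of the classical stack `x`. -/
  | pop (x : C) : Cmd O C Q
  /-- Empty the classical stack `x`. -/
  | clear (x : C) : Cmd O C Q
  /-- Continue with `a`, `b` or `e` if the top of `x` is `true`, `false` or missing. -/
  | branch (x : C) (a b e : Cmd O C Q) : Cmd O C Q
  /-- While the classical stack `x` is nonempty, do `a`. -/
  | loop (x : C) (a : Cmd O C Q) : Cmd O C Q
  /-- Move the top qubit of `q` to the top of `r`. -/
  | move (q r : Q) : Cmd O C Q
  /-- Throw away all qubits of `q`. -/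
  | discard (q : Q) : Cmd O C Q
  /-- Apply the operation `g`, with the length of the classical stack `y` as parameter, to the top
  qubits of `q`, and push the output bit on `x`. -/
  | gate (g : Gate) (y : C) (q : Q) (x : C) : Cmd O C Q
  /-- Call the oracle `o`, which acts on the stacks `q` and `x`. -/
  | call (o : O) (q : Q) (x : C) : Cmd O C Q

/-- All elementary operations in the program belong to the gate set `G`. -/
def Cmd.Over {O C Q : Type} (G : GateSet) : Cmd O C Q → Prop
  | .seq a b => a.Over G ∧ b.Over G
  | .branch _ a b e => a.Over G ∧ b.Over G ∧ e.Over G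
  | .loop _ a => a.Over G
  | .gate g _ _ _ => g ∈ G
  | _ => True

/-- What the game records: the queries of the adversary, and for each payment the number `m` of
submitted coins, the number `accepted` of coins accepted by the verifier, and the refund that the
wallet of the verifier yields afterwards. -/
inductive Event : Type where
  | mint : Event
  | privVerify : Event
  | payment (m accepted refund : ℕ) : Event

/-- The state shared by all parties: the first unused qubit name, the quantum memory, and the
events so far. -/
structure World where
  next : ℕ
  ket : Ket
  log : List Event

/-- The initial world, with all qubits in state `0`. -/
def World.init : World := ⟨0, Finsupp.single ∅ 1, []⟩

/-- Takes the top `n` qubits from a stack of qubits, which is first filled up with fresh qubits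
if it is too short: the qubits taken, the remaining stack, and the new world. -/
def takeQubits (n : ℕ) (l : List ℕ) (w : World) : List ℕ × List ℕ × World :=
  let l' := l ++ List.range' w.next (n - l.length)
  (l'.take n, l'.drop n, { w with next := w.next + (n - l.length) })

/-- The possible outcomes of an instrument on the qubits `hs`, with the resulting worlds. -/
def Instrument.run {n : ℕ} (I : Instrument n) (hs : List ℕ) (w : World) : List (Bool × World) :=
  (List.finRange I.branches).map fun i =>
    (I.result i, { w with ket := applyOp (I.kraus i) hs w.ket })

/-- A configuration of a running program: the commands still to be executed, the contents of the
stacks, and the world. -/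
structure Config (O C Q : Type) where
  cont : List (Cmd O C Q)
  cl : C → List Bool
  qu : Q → List ℕ
  world : World

/-- The answers of the oracles: from the contents of a stack of qubits, of a classical stack, and
the world, to the possible new contents and worlds. -/
abbrev Oracles (O : Type) : Type :=
  O → List ℕ → List Bool → World → List (List ℕ × List Bool × World)

/-- One step of computation; the list has one entry for each possible outcome. -/
def step {O C Q : Type} [DecidableEq C] [DecidableEq Q] (orc : Oracles O) (c : Config O C Q) :
    List (Config O C Q) :=
  match c.cont with
  | [] => [c]
  | .skip :: k => [{ c with cont := k }]
  | .seq a b :: k => [{ c with cont := a :: b :: k }]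
  | .push x b :: k => [{ c with cont := k, cl := Function.update c.cl x (b :: c.cl x) }]
  | .pop x :: k => [{ c with cont := k, cl := Function.update c.cl x (c.cl x).tail }]
  | .clear x :: k => [{ c with cont := k, cl := Function.update c.cl x [] }]
  | .branch x a b e :: k =>
      match c.cl x with
      | true :: _ => [{ c with cont := a :: k }]
      | false :: _ => [{ c with cont := b :: k }]
      | [] => [{ c with cont := e :: k }]
  | .loop x a :: k =>
      match c.cl x with
      | [] => [{ c with cont := k }]
      | _ :: _ => [{ c with cont := a :: .loop x a :: k }]
  | .move q r :: k =>
      let t := takeQubits 1 (c.qu q) c.world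
      let qu' := Function.update c.qu q t.2.1
      [{ c with cont := k, qu := Function.update qu' r (t.1 ++ qu' r), world := t.2.2 }]
  | .discard q :: k => [{ c with cont := k, qu := Function.update c.qu q [] }]
  | .gate g y q x :: k =>
      let I := g (c.cl y).length
      let t := takeQubits I.1 (c.qu q) c.world
      (I.2.run t.1 t.2.2).map fun r =>
        { cont := k
          cl := Function.update c.cl x (r.1 :: c.cl x)
          qu := Function.update c.qu q (t.1 ++ t.2.1)
          world := r.2 }
  | .call o q x :: k =>
      (orc o (c.qu q) (c.cl x) c.world).map fun r =>
        { cont := k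
          cl := Function.update c.cl x r.2.1
          qu := Function.update c.qu q r.1
          world := r.2.2 }

/-- The possible configurations after `t` steps; a program that has halted does not change. -/
def run {O C Q : Type} [DecidableEq C] [DecidableEq Q] (orc : Oracles O) :
    ℕ → Config O C Q → List (Config O C Q)
  | 0, c => [c]
  | t + 1, c => (step orc c).flatMap (run orc t)

/-- On every computation path the program halts within `t` steps. -/
def HaltsIn {O C Q : Type} [DecidableEq C] [DecidableEq Q] (orc : Oracles O) (t : ℕ)
    (c : Config O C Q) : Prop :=
  ∀ d ∈ run orc t c, d.cont = []

open Classical in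
/-- The possible final configurations of a program that halts on every computation path. -/
def exec {O C Q : Type} [DecidableEq C] [DecidableEq Q] (orc : Oracles O) (c : Config O C Q) :
    List (Config O C Q) :=
  if h : ∃ t, HaltsIn orc t c then run orc (Nat.find h) c else []

/-- A program, with the classical stacks for its two inputs. -/
structure Program (O : Type) where
  C : Type
  Q : Type
  [decC : DecidableEq C]
  [decQ : DecidableEq Q]
  /-- Initially holds the security parameter in unary. -/
  secParam : C
  /-- Initially holds the number of qubits of a coin in unary. -/
  coinSize : C
  code : Cmd O C Q

attribute [instance] Program.decC Program.decQ

/-- The initial contents of the classical stacks, for security parameter `lam` and coins of `l`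
qubits. -/
def Program.input {O : Type} (P : Program O) (lam l : ℕ) : P.C → List Bool :=
  Function.update (Function.update (fun _ => []) P.secParam (List.replicate lam true))
    P.coinSize (List.replicate l true)

/-- The initial configuration. -/
def Program.start {O : Type} (P : Program O) (lam l : ℕ) (w : World) : Config O P.C P.Q where
  cont := [P.code]
  cl := P.input lam l
  qu := fun _ => []
  world := w

/-! ### Comparison-based public verification -/

/-- A comparison-based verification algorithm: a program without oracles and without any key.
It finds an alleged coin on the stack `incoming` and the coins of the verifier on the stack
`wallet`, leaves the new wallet on `wallet`, and puts its verdict on top of `answer`. -/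
structure PublicVerifier extends Program Empty where
  wallet : Q
  incoming : Q
  answer : C

/-- A program without oracles. -/
def noOracles : Oracles Empty := fun o => o.elim

/-- The memory of a verifier between two verifications. -/
structure PublicVerifier.Memory (V : PublicVerifier) where
  cl : V.C → List Bool
  qu : V.Q → List ℕ

/-- A verifier whose wallet consists of the one coin with the qubits `hs`. -/
def PublicVerifier.fresh (V : PublicVerifier) (lam l : ℕ) (hs : List ℕ) : V.Memory where
  cl := V.input lam l
  qu := Function.update (fun _ => []) V.wallet hs

/-- The verification algorithm, started on the alleged coin with the qubits `hs`. -/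
def PublicVerifier.load (V : PublicVerifier) (s : V.Memory) (w : World) (hs : List ℕ) :
    Config Empty V.C V.Q where
  cont := [V.code]
  cl := s.cl
  qu := Function.update s.qu V.incoming (hs ++ s.qu V.incoming)
  world := w

/-- Verification of one alleged coin: the verdict (read off and removed from the top of
`answer`), and the memory of the verifier and the world afterwards. -/
def PublicVerifier.verify (V : PublicVerifier) (s : V.Memory) (w : World) (hs : List ℕ) :
    List (Bool × V.Memory × World) :=
  (exec noOracles (V.load s w hs)).map fun d =>
    (decide ((d.cl V.answer).head? = some true),
      ⟨Function.update d.cl V.answer (d.cl V.answer).tail, d.qu⟩, d.world)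

/-- The public count: the alleged coins are verified one by one with the same wallet; the result
is the number of accepted coins, with the memory of the verifier and the world afterwards. -/
def PublicVerifier.count (V : PublicVerifier) :
    List (List ℕ) → V.Memory → World → List (ℕ × V.Memory × World)
  | [], s, w => [(0, s, w)]
  | hs :: rest, s, w =>
      (V.verify s w hs).flatMap fun r =>
        (V.count rest r.2.1 r.2.2).map fun u => ((if r.1 then 1 else 0) + u.1, u.2)

/-- After `n` coins have been received into a wallet that started with one coin, the verification
of the next coin takes at most `T n` steps, on every computation path. -/
def PublicVerifier.RunsIn (V : PublicVerifier) (lam l : ℕ) (T : ℕ → ℕ) : Prop :=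
  ∀ (w : World) (first : List ℕ) (coins : List (List ℕ)) (hs : List ℕ),
    first.length = l → (∀ c ∈ coins, c.length = l) → hs.length = l →
      ∀ r ∈ V.count coins (V.fresh lam l first) w,
        HaltsIn noOracles (T coins.length) (V.load r.2.1 r.2.2 hs)

/-- A comparison-based public quantum coin scheme with private verification. -/
structure CoinScheme where
  /-- The secret keys for each security parameter. -/
  Key : ℕ → Type
  [mKey : ∀ lam, MeasurableSpace (Key lam)]
  /-- The distribution of the secret key. -/
  keyGen : ∀ lam, MeasureTheory.Measure (Key lam)
  [keyGen_prob : ∀ lam, MeasureTheory.IsProbabilityMeasure (keyGen lam)]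
  /-- The number of qubits of a coin. -/
  coinLen : ℕ → ℕ
  coinLen_pos : ∀ lam, 0 < coinLen lam
  /-- The pure state of a coin, which is the output of every call of the mint. -/
  coin : ∀ lam, Key lam → Bits (coinLen lam) → ℂ
  coin_norm : ∀ lam sk, ∑ b, ‖coin lam sk b‖ ^ 2 = 1
  coin_measurable : ∀ lam b, Measurable fun sk => coin lam sk b
  /-- The private verification, an instrument on one coin that depends on the secret key. -/
  privBranches : ℕ → ℕ
  privKraus : ∀ lam, Key lam → Fin (privBranches lam) →
    Matrix (Bits (coinLen lam)) (Bits (coinLen lam)) ℂ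
  privResult : ∀ lam, Fin (privBranches lam) → Bool
  priv_complete : ∀ lam sk, ∑ i, (privKraus lam sk i)ᴴ * privKraus lam sk i = 1
  priv_measurable : ∀ lam i a b, Measurable fun sk => privKraus lam sk i a b
  /-- The public verification. -/
  verifier : ℕ → PublicVerifier
  verifier_halts : ∀ lam, ∃ T : ℕ → ℕ, (verifier lam).RunsIn lam (coinLen lam) T

attribute [instance] CoinScheme.mKey CoinScheme.keyGen_prob

namespace CoinScheme

variable (M : CoinScheme)

/-- The private verification with the key `sk`. -/
def privVerify (lam : ℕ) (sk : M.Key lam) : Instrument (M.coinLen lam) where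
  branches := M.privBranches lam
  kraus := M.privKraus lam sk
  result := M.privResult lam
  complete := M.priv_complete lam sk

/-- The mint: the qubits of a new coin, and the new world. -/
def mint (lam : ℕ) (sk : M.Key lam) (w : World) : List ℕ × World :=
  let hs := List.range' w.next (M.coinLen lam)
  (hs, { w with
    next := w.next + M.coinLen lam
    ket := prepare (M.coin lam sk) hs w.ket })

/-- The private count: the number of coins that pass the private verification. -/
def privCount (lam : ℕ) (sk : M.Key lam) : List (List ℕ) → World → List (ℕ × World)
  | [], w => [(0, w)]
  | hs :: rest, w =>
      ((M.privVerify lam sk).run hs w).flatMap fun r =>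
        (privCount lam sk rest r.2).map fun u => ((if r.1 then 1 else 0) + u.1, u.2)

end CoinScheme

/-- The first `m` blocks of length `l` of a list. -/
def blocks (l m : ℕ) (hs : List ℕ) : List (List ℕ) :=
  (List.range m).map fun j => (hs.drop (j * l)).take l

/-! ### The game -/

/-- The oracles of the adversary. -/
inductive GameOracle : Type where
  /-- Puts a new coin on the stack of qubits. -/
  | mint : GameOracle
  /-- Private verification of the coin on the stack of qubits, which keeps the post-verified
  state; the verdict is pushed on the classical stack. -/
  | privVerify : GameOracle
  /-- Pays the next verifier: the length `m` of the classical stack is the number of coins, which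
  are the top `m` coins of the stack of qubits; afterwards the classical stack holds the number
  of accepted coins in unary. -/
  | pay : GameOracle

/-- A payment to a verifier who starts with one fresh coin in the wallet: public count of the
submitted coins, followed by the private count of the coins in the resulting wallet.  The result
is the number of accepted coins and the world afterwards; the refund is only recorded. -/
def CoinScheme.receive (M : CoinScheme) (lam : ℕ) (sk : M.Key lam) (coins : List (List ℕ))
    (w : World) : List (ℕ × World) :=
  let V := M.verifier lam
  let l := M.coinLen lam
  let fresh := M.mint lam sk w
  (V.count coins (V.fresh lam l fresh.1) fresh.2).flatMap fun r =>
    let wallet := r.2.1.qu V.wallet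
    (M.privCount lam sk (blocks l (wallet.length / l) wallet) r.2.2).map fun u =>
      (r.1, { u.2 with log := u.2.log ++ [Event.payment coins.length r.1 u.1] })

/-- The answers of the oracles in the game. -/
def CoinScheme.oracles (M : CoinScheme) (lam : ℕ) (sk : M.Key lam) : Oracles GameOracle
  | .mint, q, x, w =>
      let c := M.mint lam sk w
      [(c.1 ++ q, x, { c.2 with log := c.2.log ++ [Event.mint] })]
  | .privVerify, q, x, w =>
      let t := takeQubits (M.coinLen lam) q w
      ((M.privVerify lam sk).run t.1 t.2.2).map fun r =>
        (t.1 ++ t.2.1, r.1 :: x, { r.2 with log := r.2.log ++ [Event.privVerify] })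
  | .pay, q, x, w =>
      let t := takeQubits (x.length * M.coinLen lam) q w
      (M.receive lam sk (blocks (M.coinLen lam) x.length t.1) t.2.2).map fun r =>
        (t.2.1, List.replicate r.1 true, r.2)

/-- An adversary: a program for each security parameter. -/
abbrev Adversary : Type 1 := ℕ → Program GameOracle

/-- The beginning of the game. -/
def CoinScheme.gameStart (M : CoinScheme) (A : Adversary) (lam : ℕ) :
    Config GameOracle (A lam).C (A lam).Q :=
  (A lam).start lam (M.coinLen lam) World.init

/-- The possible final configurations of the game. -/
def CoinScheme.outcomes (M : CoinScheme) (A : Adversary) (lam : ℕ) (sk : M.Key lam) :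
    List (Config GameOracle (A lam).C (A lam).Q) :=
  exec (M.oracles lam sk) (M.gameStart A lam)

/-- The all-or-nothing loss of a verifier with `m` submitted and `accepted` accepted coins. -/
def verifierLoss (m accepted refund : ℕ) : ℝ :=
  if m = accepted then (m : ℝ) + 1 - refund else 1 - refund

/-- The loss in an event of the game. -/
def Event.loss : Event → ℝ
  | .payment m accepted refund => verifierLoss m accepted refund
  | _ => 0

/-- The combined loss of all verifiers. -/
def totalLoss (log : List Event) : ℝ := (log.map Event.loss).sum

/-- The number of verifiers that were paid. -/
def numPayments (log : List Event) : ℕ :=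
  log.countP fun e => match e with
    | .payment _ _ _ => true
    | _ => false

/-- The number of coins submitted in an event of the game. -/
def Event.coins : Event → ℕ
  | .payment m _ _ => m
  | _ => 0

/-- The number of coins submitted to all verifiers. -/
def numCoins (log : List Event) : ℕ := (log.map Event.coins).sum

/-- The expected combined loss of the verifiers. -/
def CoinScheme.expectedLoss (M : CoinScheme) (A : Adversary) (lam : ℕ) : ℝ :=
  ∫ sk, ((M.outcomes A lam sk).map fun d => normSq d.world.ket * totalLoss d.world.log).sum
    ∂(M.keyGen lam)

/-! ### Security -/

/-- Polynomially bounded functions. -/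
def PolyBounded (f : ℕ → ℕ) : Prop := ∃ p : Polynomial ℕ, ∀ n, f n ≤ p.eval n

/-- Negligible functions. -/
def Negligible (ε : ℕ → ℝ) : Prop :=
  Asymptotics.SuperpolynomialDecay Filter.atTop (fun n : ℕ => (n : ℝ)) ε

/-- A class of adversaries against a scheme that attack `k` verifiers. -/
abbrev AdversaryClass : Type 1 := CoinScheme → (ℕ → ℕ) → Adversary → Prop

/-- In every run of the game exactly `k lam` verifiers are paid, one after the other. -/
def Attacks (M : CoinScheme) (k : ℕ → ℕ) (A : Adversary) : Prop :=
  ∀ lam sk, ∀ d ∈ M.outcomes A lam sk, numPayments d.world.log = k lam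

/-- Quantum polynomial-time adversaries over the gate set `G`: one program for all security
parameters that halts within polynomially many steps. -/
def qpa (G : GateSet) : AdversaryClass := fun M k A =>
  Attacks M k A ∧
  (∃ P : Program GameOracle, P.code.Over G ∧ ∀ lam, A lam = P) ∧
  ∃ p : Polynomial ℕ, ∀ lam sk,
    HaltsIn (M.oracles lam sk) (p.eval lam) (M.gameStart A lam)

/-- Unbounded adversaries: an arbitrary program for each security parameter, over all quantum
instruments, that halts and makes polynomially many oracle queries. -/
def unbounded : AdversaryClass := fun M k A =>
  Attacks M k A ∧
  (∀ lam, ∃ t, ∀ sk, HaltsIn (M.oracles lam sk) t (M.gameStart A lam)) ∧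
  ∃ p : Polynomial ℕ, ∀ lam sk, ∀ d ∈ M.outcomes A lam sk, d.world.log.length ≤ p.eval lam

/-- Unbounded adversaries that moreover submit polynomially many coins. -/
def unboundedPolyCoins : AdversaryClass := fun M k A =>
  unbounded M k A ∧
  ∃ p : Polynomial ℕ, ∀ lam sk, ∀ d ∈ M.outcomes A lam sk, numCoins d.world.log ≤ p.eval lam

/-- The expected loss caused by every adversary of the class that attacks `k` verifiers is
bounded by a negligible function. -/
def LossNegligible (M : CoinScheme) (cls : AdversaryClass) (k : ℕ → ℕ) : Prop :=
  ∀ A, cls M k A → ∃ ε, Negligible ε ∧ ∀ lam, M.expectedLoss A lam ≤ ε lam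

/-- Nonadaptive rational security against private sabotage: there is one verifier, who receives
one payment. -/
def RationallySecure (M : CoinScheme) (cls : AdversaryClass) : Prop :=
  LossNegligible M cls fun _ => 1

/-- Multiverifier nonadaptive rational security against private sabotage: there are polynomially
many verifiers. -/
def MultiverifierRationallySecure (M : CoinScheme) (cls : AdversaryClass) : Prop :=
  ∀ k, PolyBounded k → LossNegligible M cls k

/-- The public verification is quantum polynomial time over the gate set `G`: coins have
polynomially many qubits, and one program verifies for all security parameters, in time
polynomial in the security parameter and the number of coins already received. -/
def PublicVerificationQPT (M : CoinScheme) (G : GateSet) : Prop :=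
  PolyBounded M.coinLen ∧
  (∃ V : PublicVerifier, V.code.Over G ∧ ∀ lam, M.verifier lam = V) ∧
  ∃ p : Polynomial ℕ, ∀ lam,
    (M.verifier lam).RunsIn lam (M.coinLen lam) fun n => p.eval (lam + n)

end QCoin

end

noncomputable section

namespace QCoin

/-! ### Runs of programs -/

section Runs

variable {O C Q : Type} [DecidableEq C] [DecidableEq Q] {orc : Oracles O}

/-! The adversary against one verifier guesses which payment to pass on. It draws `j` uniformly from
the numbers below `2 ^ m`, where `2 ^ m` is at least the number of verifiers, and runs the given
adversary inside. Payment `j` goes to the real verifier. In every other payment the reduction plays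
the verifier itself: public verification has no key, so a coin from the mint is all it needs. If
payment `j` never comes, the reduction finally pays zero coins; the wallet is then still one coin,
so this loss is `1 - refund ≥ 0`.

The reduction omits the private count of the simulated wallets. This changes nothing, because the
refund is not revealed and the wallet is never touched again. Operators on disjoint sets of qubits
commute (`applyOp_comm`), so the count can be deferred to the end of the run (`run_map`). There it
is an instrument that preserves the total squared norm (`sum_normSq_applyOp`), and its result does
not enter the loss of payment `j`. This is `discard_privCount`. Replacing one step at a time,
`run_hybrid` passes to a hybrid game in which only payment `j` is privately counted. Disjointness
holds because names of qubits are moved but never copied (`Sep`, `RespectsNames`).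

Losses may be negative, so the comparison has to be exact: on runs where payment `j` takes place the
two losses agree, and on the others the original one is zero while the new one is nonnegative
(`unfolds_settle`). The losses for the single `j` add up to the total loss (`sum_selectedLoss`), so
the expected total loss is at most `2 ^ m` times the expected loss of the reduction
(`run_reduction`, `expectedLoss_le`). Since `2 ^ m` is polynomially bounded, negligibility is
inherited.

The range is a power of two so that coin tosses sample it exactly in bounded time. Its exponent is
computed from the security parameter alone, so the number of verifiers need not be computable.
Comparing expectations over the key requires integrability: the tree of outcomes is the same for all
keys, and only amplitudes depend on the key, in a bounded measurable way (`integrable_run`). -/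

theorem step_of_halted {c : Config O C Q} (h : c.cont = []) : step orc c = [c] := by
  simp [step, h]

theorem run_of_halted {c : Config O C Q} (h : c.cont = []) : ∀ t, run orc t c = [c]
  | 0 => rfl
  | t + 1 => by simp [run, step_of_halted h, run_of_halted h t]

theorem run_add (s t : ℕ) (c : Config O C Q) :
    run orc (s + t) c = (run orc s c).flatMap (run orc t) := by
  induction s generalizing c with
  | zero => simp [run]
  | succ s ih =>
    rw [Nat.succ_add]
    simp only [run, List.flatMap_assoc]
    exact List.flatMap_congr fun d _ => ih d

theorem haltsIn_succ {t : ℕ} {c : Config O C Q} :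
    HaltsIn orc (t + 1) c ↔ ∀ d ∈ step orc c, HaltsIn orc t d := by
  simp only [HaltsIn, run, List.mem_flatMap]
  exact ⟨fun h d hd e he => h e ⟨d, hd, he⟩, fun h e ⟨d, hd, he⟩ => h d hd e he⟩

theorem HaltsIn.run_add {t : ℕ} {c : Config O C Q} (h : HaltsIn orc t c) (s : ℕ) :
    run orc (t + s) c = run orc t c := by
  rw [QCoin.run_add]
  conv_rhs => rw [← List.flatMap_singleton' (run orc t c)]
  exact List.flatMap_congr fun d hd => run_of_halted (h d hd) s

theorem HaltsIn.run_eq {t s : ℕ} {c : Config O C Q} (h : HaltsIn orc t c) (hs : t ≤ s) :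
    run orc s c = run orc t c := by
  obtain ⟨r, rfl⟩ := Nat.exists_eq_add_of_le hs
  exact h.run_add r

theorem HaltsIn.mono {t s : ℕ} {c : Config O C Q} (h : HaltsIn orc t c) (hs : t ≤ s) :
    HaltsIn orc s c := by
  intro d hd
  rw [h.run_eq hs] at hd
  exact h d hd

/-- Halted configurations are fixed by `step`, so any time bound can replace the least one chosen in
`exec`. -/
theorem HaltsIn.exec_eq {t : ℕ} {c : Config O C Q} (h : HaltsIn orc t c) :
    exec orc c = run orc t c := by
  classical
  have h' : ∃ t, HaltsIn orc t c := ⟨t, h⟩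
  rw [exec, dif_pos h']
  exact ((Nat.find_spec h').run_eq (Nat.find_min' h' h)).symm

/-- Within at most `n` steps, on every computation path, `c` reaches the configurations `L`. -/
def Unfolds (orc : Oracles O) (n : ℕ) (c : Config O C Q) (L : List (Config O C Q)) : Prop :=
  ∀ t, (∀ d ∈ L, HaltsIn orc t d) →
    HaltsIn orc (n + t) c ∧ run orc (n + t) c = L.flatMap (run orc t)

/-- Any `n` will do, as it is only an upper bound: once everything has halted, surplus steps have no
effect. -/
theorem Unfolds.refl (n : ℕ) (c : Config O C Q) : Unfolds orc n c [c] := by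
  intro t h
  have h := h c (by simp)
  exact ⟨h.mono (by omega), by simp [h.run_eq (Nat.le_add_left t n)]⟩

theorem Unfolds.mono {n m : ℕ} {c : Config O C Q} {L : List (Config O C Q)}
    (h : Unfolds orc n c L) (hm : n ≤ m) : Unfolds orc m c L := by
  intro t ht
  obtain ⟨h1, h2⟩ := h t ht
  exact ⟨h1.mono (by omega), by rw [h1.run_eq (by omega), h2]⟩

/-- Branches may need different numbers of steps. As runs are compared only after all of them have
halted, one common bound `m` suffices and no synchronisation is needed. -/
theorem Unfolds.trans {ι : Type*} {n m : ℕ} {c : Config O C Q} {I : List ι}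
    {φ : ι → Config O C Q} {L : ι → List (Config O C Q)} (h : Unfolds orc n c (I.map φ))
    (h' : ∀ i ∈ I, Unfolds orc m (φ i) (L i)) : Unfolds orc (n + m) c (I.flatMap L) := by
  intro t ht
  have key : ∀ i ∈ I, HaltsIn orc (m + t) (φ i) ∧
      run orc (m + t) (φ i) = (L i).flatMap (run orc t) :=
    fun i hi => h' i hi t fun e he => ht e (List.mem_flatMap.2 ⟨i, hi, he⟩)
  obtain ⟨h1, h2⟩ := h (m + t) (List.forall_mem_map.2 fun i hi => (key i hi).1)
  rw [Nat.add_assoc]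
  refine ⟨h1, h2.trans ?_⟩
  rw [List.flatMap_assoc, List.flatMap_map]
  exact List.flatMap_congr fun d hd => (key d hd).2

theorem Unfolds.step (c : Config O C Q) : Unfolds orc 1 c (step orc c) := by
  intro t ht
  rw [Nat.add_comm]
  exact ⟨haltsIn_succ.2 ht, rfl⟩

theorem Unfolds.head {ι : Type*} {n : ℕ} {c : Config O C Q} {I : List ι}
    {φ : ι → Config O C Q} {L : ι → List (Config O C Q)} (hs : QCoin.step orc c = I.map φ)
    (h : ∀ i ∈ I, Unfolds orc n (φ i) (L i)) : Unfolds orc (n + 1) c (I.flatMap L) := by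
  rw [Nat.add_comm]
  exact (hs ▸ Unfolds.step c : Unfolds orc 1 c (I.map φ)).trans h

end Runs

/-! ### Big-step semantics -/

/-- The contents of the stacks together with the world. -/
structure Store (C Q : Type) where
  cl : C → List Bool
  qu : Q → List ℕ
  world : World

/-- The configuration with store `s` and commands `k` still to be executed. -/
def Store.config {O C Q : Type} (s : Store C Q) (k : List (Cmd O C Q)) : Config O C Q :=
  ⟨k, s.cl, s.qu, s.world⟩

section BigStep

variable {O C Q : Type} [DecidableEq C] [DecidableEq Q] {orc : Oracles O}

/-- The command `a`, started on `s`, terminates within `n` steps with the possible results `L`. -/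
def Big (orc : Oracles O) (n : ℕ) (a : Cmd O C Q) (s : Store C Q) (L : List (Store C Q)) : Prop :=
  ∀ k, Unfolds orc n (s.config (a :: k)) (L.map fun r => r.config k)

theorem Big.mono {n m : ℕ} {a : Cmd O C Q} {s : Store C Q} {L : List (Store C Q)}
    (h : Big orc n a s L) (hm : n ≤ m) : Big orc m a s L := fun k => (h k).mono hm

theorem Big.cast {n m : ℕ} {a : Cmd O C Q} {s : Store C Q} {L L' : List (Store C Q)}
    (h : Big orc n a s L) (hm : n ≤ m) (hL : L = L') : Big orc m a s L' := hL ▸ h.mono hm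

/-- A command with a single next step. -/
theorem Big.of_step {n : ℕ} {a : Cmd O C Q} {s : Store C Q} {L : List (Store C Q)}
    (h : ∀ k, ∃ d, step orc (s.config (a :: k)) = [d] ∧
      Unfolds orc n d (L.map fun r => r.config k)) : Big orc (n + 1) a s L := by
  intro k
  obtain ⟨d, hd, h⟩ := h k
  simpa using Unfolds.head (I := [d]) (φ := id) (L := fun _ => L.map fun r => r.config k)
    (by simpa using hd) (by simpa using h)

/-- The branches after `a` are indexed by `I`, so that the results of `b` can be given as a function
of the index instead of the store. -/
theorem Big.seq {ι : Type*} {n m : ℕ} {a b : Cmd O C Q} {s : Store C Q} {I : List ι}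
    {φ : ι → Store C Q} {L : ι → List (Store C Q)} (ha : Big orc n a s (I.map φ))
    (hb : ∀ i ∈ I, Big orc m b (φ i) (L i)) : Big orc (n + m + 1) (.seq a b) s (I.flatMap L) := by
  refine Big.of_step fun k => ⟨s.config (a :: b :: k), rfl, ?_⟩
  have h := ha (b :: k)
  rw [List.map_map] at h
  rw [List.map_flatMap]
  exact h.trans fun i hi => hb i hi k

/-- Sequential composition after a deterministic command. -/
theorem Big.seq_single {n m : ℕ} {a b : Cmd O C Q} {s r : Store C Q} {L : List (Store C Q)}
    (ha : Big orc n a s [r]) (hb : Big orc m b r L) : Big orc (n + m + 1) (.seq a b) s L := by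
  simpa using Big.seq (I := [r]) (φ := id) (L := fun _ => L) ha (by simpa using hb)

theorem Big.of_step_eq {a : Cmd O C Q} {s : Store C Q} {L : List (Store C Q)}
    (h : ∀ k, step orc (s.config (a :: k)) = L.map fun r => r.config k) : Big orc 1 a s L := by
  intro k
  rw [← h k]
  exact Unfolds.step _

theorem Big.skip (s : Store C Q) : Big orc 1 .skip s [s] := .of_step_eq fun _ => rfl

theorem Big.push (x : C) (b : Bool) (s : Store C Q) :
    Big orc 1 (.push x b) s [⟨Function.update s.cl x (b :: s.cl x), s.qu, s.world⟩] :=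
  .of_step_eq fun _ => rfl

theorem Big.pop (x : C) (s : Store C Q) :
    Big orc 1 (.pop x) s [⟨Function.update s.cl x (s.cl x).tail, s.qu, s.world⟩] :=
  .of_step_eq fun _ => rfl

theorem Big.clear (x : C) (s : Store C Q) :
    Big orc 1 (.clear x) s [⟨Function.update s.cl x [], s.qu, s.world⟩] :=
  .of_step_eq fun _ => rfl

theorem Big.discard (q : Q) (s : Store C Q) :
    Big orc 1 (.discard q) s [⟨s.cl, Function.update s.qu q [], s.world⟩] :=
  .of_step_eq fun _ => rfl

theorem Big.branch_true {n : ℕ} {x : C} {a b e : Cmd O C Q} {s : Store C Q} {L : List (Store C Q)}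
    {l : List Bool} (hx : s.cl x = true :: l) (h : Big orc n a s L) :
    Big orc (n + 1) (.branch x a b e) s L :=
  .of_step fun k => ⟨s.config (a :: k), by simp [QCoin.step, Store.config, hx], h k⟩

theorem Big.branch_false {n : ℕ} {x : C} {a b e : Cmd O C Q} {s : Store C Q}
    {L : List (Store C Q)} {l : List Bool} (hx : s.cl x = false :: l) (h : Big orc n b s L) :
    Big orc (n + 1) (.branch x a b e) s L :=
  .of_step fun k => ⟨s.config (b :: k), by simp [QCoin.step, Store.config, hx], h k⟩

theorem Big.branch_nil {n : ℕ} {x : C} {a b e : Cmd O C Q} {s : Store C Q}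
    {L : List (Store C Q)} (hx : s.cl x = []) (h : Big orc n e s L) :
    Big orc (n + 1) (.branch x a b e) s L :=
  .of_step fun k => ⟨s.config (e :: k), by simp [QCoin.step, Store.config, hx], h k⟩

theorem Big.loop_nil {x : C} {a : Cmd O C Q} {s : Store C Q} (hx : s.cl x = []) :
    Big orc 1 (.loop x a) s [s] :=
  .of_step_eq fun k => by simp [QCoin.step, Store.config, hx]

theorem Big.loop_cons {ι : Type*} {n m : ℕ} {x : C} {a : Cmd O C Q} {s : Store C Q}
    {I : List ι} {φ : ι → Store C Q} {L : ι → List (Store C Q)} (hx : s.cl x ≠ [])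
    (ha : Big orc n a s (I.map φ)) (hb : ∀ i ∈ I, Big orc m (.loop x a) (φ i) (L i)) :
    Big orc (n + m + 1) (.loop x a) s (I.flatMap L) := by
  refine Big.of_step fun k => ⟨s.config (a :: .loop x a :: k), ?_, ?_⟩
  · obtain ⟨b, l, hl⟩ := List.exists_cons_of_ne_nil hx
    simp [QCoin.step, Store.config, hl]
  · have h := ha (.loop x a :: k)
    rw [List.map_map] at h
    rw [List.map_flatMap]
    exact h.trans fun i hi => hb i hi k

theorem Big.loop_cons_single {n m : ℕ} {x : C} {a : Cmd O C Q} {s r : Store C Q}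
    {L : List (Store C Q)} (hx : s.cl x ≠ []) (ha : Big orc n a s [r])
    (hb : Big orc m (.loop x a) r L) : Big orc (n + m + 1) (.loop x a) s L := by
  simpa using Big.loop_cons (I := [r]) (φ := id) (L := fun _ => L) hx ha (by simpa using hb)

end BigStep

/-! ### Embedding a program into a larger one -/

/-- Renames the stacks of a program and replaces its oracle calls. -/
def Cmd.embed {O C Q O' C' Q' : Type} (onC : C → C') (onQ : Q → Q')
    (onCall : O → Q → C → Cmd O' C' Q') : Cmd O C Q → Cmd O' C' Q'
  | .skip => .skip
  | .seq a b => .seq (a.embed onC onQ onCall) (b.embed onC onQ onCall)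
  | .push x b => .push (onC x) b
  | .pop x => .pop (onC x)
  | .clear x => .clear (onC x)
  | .branch x a b e =>
      .branch (onC x) (a.embed onC onQ onCall) (b.embed onC onQ onCall) (e.embed onC onQ onCall)
  | .loop x a => .loop (onC x) (a.embed onC onQ onCall)
  | .move q r => .move (onQ q) (onQ r)
  | .discard q => .discard (onQ q)
  | .gate g y q x => .gate g (onC y) (onQ q) (onC x)
  | .call o q x => onCall o q x

theorem Cmd.over_embed {O C Q O' C' Q' : Type} {onC : C → C'} {onQ : Q → Q'}
    {onCall : O → Q → C → Cmd O' C' Q'} {G : GateSet} (h : ∀ o q x, (onCall o q x).Over G) :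
    ∀ a : Cmd O C Q, a.Over G → (a.embed onC onQ onCall).Over G
  | .skip, _ | .push _ _, _ | .pop _, _ | .clear _, _ | .move _ _, _ | .discard _, _ => trivial
  | .seq a b, ha => ⟨over_embed h a ha.1, over_embed h b ha.2⟩
  | .branch _ a b e, ha => ⟨over_embed h a ha.1, over_embed h b ha.2.1, over_embed h e ha.2.2⟩
  | .loop _ a, ha => over_embed h a ha
  | .gate _ _ _ _, ha => ha
  | .call o q x, _ => h o q x

/-- An embedding of the stacks of a program into those of a larger program.  The contents of the
other stacks may depend on the log, and the larger program may see a different log. -/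
structure Embedding (O C Q O' C' Q' : Type) [DecidableEq C] [DecidableEq Q] [DecidableEq C']
    [DecidableEq Q'] where
  onC : C → C'
  onQ : Q → Q'
  onCall : O → Q → C → Cmd O' C' Q'
  cl : List Event → (C → List Bool) → C' → List Bool
  qu : (Q → List ℕ) → Q' → List ℕ
  log : List Event → List Event
  cl_apply : ∀ L f x, cl L f (onC x) = f x
  cl_update : ∀ L f x v, Function.update (cl L f) (onC x) v = cl L (Function.update f x v)
  qu_apply : ∀ f x, qu f (onQ x) = f x
  qu_update : ∀ f x v, Function.update (qu f) (onQ x) v = qu (Function.update f x v)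

namespace Embedding

variable {O C Q O' C' Q' : Type} [DecidableEq C] [DecidableEq Q] [DecidableEq C'] [DecidableEq Q']
  (E : Embedding O C Q O' C' Q')

/-- The translation of commands. -/
def cmd : Cmd O C Q → Cmd O' C' Q' := Cmd.embed E.onC E.onQ E.onCall

/-- The world seen by the larger program. -/
def world (w : World) : World := ⟨w.next, w.ket, E.log w.log⟩

/-- The configuration of the larger program, with `k` to be executed at the end. -/
def config (k : List (Cmd O' C' Q')) (c : Config O C Q) : Config O' C' Q' :=
  ⟨c.cont.map E.cmd ++ k, E.cl c.world.log c.cl, E.qu c.qu, E.world c.world⟩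

/-- Oracle calls are excluded because their translation may be a subroutine of many steps. All other
commands are translated into one command with the same effect. -/
theorem step_config {orc : Oracles O} {orc' : Oracles O'} {c : Config O C Q}
    (k : List (Cmd O' C' Q')) (hne : c.cont ≠ [])
    (hc : ∀ o q x k', c.cont ≠ .call o q x :: k') :
    step orc' (E.config k c) = (step orc c).map (E.config k) := by
  obtain ⟨cont, cl, qu, w⟩ := c
  cases cont with
  | nil => exact absurd rfl hne
  | cons a k' =>
    cases a with
    | call o q x => exact absurd rfl (hc o q x k')
    | skip => simp [step, config, cmd, Cmd.embed]
    | seq a b => simp [step, config, cmd, Cmd.embed]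
    | push x b => simp [step, config, cmd, Cmd.embed, cl_update, cl_apply]
    | pop x => simp [step, config, cmd, Cmd.embed, cl_update, cl_apply]
    | clear x => simp [step, config, cmd, Cmd.embed, cl_update]
    | branch x a b e =>
      rcases h : cl x with _ | ⟨_ | _, _⟩ <;> simp [step, config, cmd, Cmd.embed, cl_apply, h]
    | loop x a => rcases h : cl x with _ | ⟨_, _⟩ <;> simp [step, config, cmd, Cmd.embed, cl_apply,
        h]
    | move q r =>
      simp [step, config, cmd, Cmd.embed, qu_update, qu_apply, takeQubits, world]
    | discard q => simp [step, config, cmd, Cmd.embed, qu_update]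
    | gate g y q x =>
      simp only [step, config, cmd, Cmd.embed, List.map_cons, List.cons_append]
      -- The parameter determines the instrument and hence its arity, so it is identified first.
      rw [E.cl_apply _ _ y]
      simp [config, cmd, qu_update, qu_apply, cl_update, cl_apply, takeQubits, world,
        Instrument.run, Function.comp_def]

/-- A program without oracles runs in the same way as part of a larger program. -/
theorem unfolds_run [IsEmpty O] {orc : Oracles O} {orc' : Oracles O'} (k : List (Cmd O' C' Q'))
    (t : ℕ) (c : Config O C Q) :
    Unfolds orc' t (E.config k c) ((run orc t c).map (E.config k)) := by
  induction t generalizing c with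
  | zero => simpa [run] using Unfolds.refl 0 (E.config k c)
  | succ t ih =>
    by_cases hc : c.cont = []
    · rw [run_of_halted hc]
      exact Unfolds.refl _ _
    · rw [run, List.map_flatMap]
      exact Unfolds.head (E.step_config k hc fun o => isEmptyElim o) fun d _ => ih d

end Embedding

/-! ### Operators on qubits -/

theorem mem_writeBits {n : ℕ} {hs : List ℕ} {s : Finset ℕ} {b : Bits n} {u : ℕ} :
    u ∈ writeBits hs s b ↔ (u ∈ s ∧ u ∉ hs) ∨ ∃ i, b i = true ∧ hs.getD i 0 = u := by
  simp [writeBits]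

/-- The default `0` of `getD` would be the name of an actual qubit; the length hypothesis rules out
that it is ever used. -/
theorem getD_mem_of_length {n : ℕ} {hs : List ℕ} (h : hs.length = n) (i : Fin n) :
    hs.getD i 0 ∈ hs := by
  rw [List.getD_eq_getElem _ _ (by omega)]
  exact List.getElem_mem _

theorem applyOp_single {n : ℕ} (K : Matrix (Bits n) (Bits n) ℂ) (hs : List ℕ) (s : Finset ℕ)
    (a : ℂ) : applyOp K hs (Finsupp.single s a) =
      ∑ b : Bits n, Finsupp.single (writeBits hs s b) (K b (readBits n hs s) * a) := by
  rw [applyOp, Finsupp.sum_single_index]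
  simp

theorem applyOp_add {n : ℕ} (K : Matrix (Bits n) (Bits n) ℂ) (hs : List ℕ) (φ ψ : Ket) :
    applyOp K hs (φ + ψ) = applyOp K hs φ + applyOp K hs ψ := by
  refine Finsupp.sum_add_index' (fun s => by simp) fun s a b => ?_
  simp only [mul_add, Finsupp.single_add, Finset.sum_add_distrib]

theorem applyOp_smul {n : ℕ} (K : Matrix (Bits n) (Bits n) ℂ) (hs : List ℕ) (c : ℂ) (ψ : Ket) :
    applyOp K hs (c • ψ) = c • applyOp K hs ψ := by
  rw [applyOp, applyOp, Finsupp.sum_smul_index (fun s => by simp), Finsupp.smul_sum]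
  refine Finsupp.sum_congr fun s _ => ?_
  rw [Finset.smul_sum]
  refine Finset.sum_congr rfl fun b _ => ?_
  rw [Finsupp.smul_single, smul_eq_mul]
  congr 1
  ring

/-- `applyOp` as a linear map. -/
def applyOpLin {n : ℕ} (K : Matrix (Bits n) (Bits n) ℂ) (hs : List ℕ) : Ket →ₗ[ℂ] Ket where
  toFun := applyOp K hs
  map_add' := applyOp_add K hs
  map_smul' := applyOp_smul K hs

@[simp] theorem applyOpLin_apply {n : ℕ} (K : Matrix (Bits n) (Bits n) ℂ) (hs : List ℕ) (ψ : Ket) :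
    applyOpLin K hs ψ = applyOp K hs ψ := rfl

theorem prepare_eq_applyOp {n : ℕ} (v : Bits n → ℂ) (hs : List ℕ) (ψ : Ket) :
    prepare v hs ψ = applyOp (Matrix.of fun b _ => v b) hs ψ := rfl

/-- For the coin toss: its Kraus operators act on no qubits, so an outcome merely rescales the
state. -/
theorem applyOp_scalar (c : ℂ) (ψ : Ket) :
    applyOp (c • (1 : Matrix (Bits 0) (Bits 0) ℂ)) [] ψ = c • ψ := by
  suffices h : applyOpLin (c • (1 : Matrix (Bits 0) (Bits 0) ℂ)) [] = c • LinearMap.id from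
    LinearMap.congr_fun h ψ
  refine Finsupp.lhom_ext fun s a => ?_
  have h1 : ∀ b b' : Bits 0, (c • (1 : Matrix (Bits 0) (Bits 0) ℂ)) b b' = c := fun b b' => by
    rw [Subsingleton.elim b b', Matrix.smul_apply, Matrix.one_apply_eq, smul_eq_mul, mul_one]
  rw [applyOpLin_apply, applyOp_single]
  simp only [h1]
  rw [Fintype.sum_unique]
  simp [writeBits]

theorem readBits_writeBits_of_disjoint {n m : ℕ} {hs hs' : List ℕ} (hl : hs.length = n)
    (hl' : hs'.length = m) (h : hs.Disjoint hs') (s : Finset ℕ) (b : Bits m) :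
    readBits n hs (writeBits hs' s b) = readBits n hs s := by
  funext i
  have hi := getD_mem_of_length hl i
  simp only [readBits, mem_writeBits, decide_eq_decide]
  constructor
  · rintro (h1 | ⟨j, -, hj⟩)
    · exact h1.1
    · exact absurd (hj ▸ getD_mem_of_length hl' j) (h hi)
  · exact fun h1 => Or.inl ⟨h1, h hi⟩

theorem writeBits_comm {n m : ℕ} {hs hs' : List ℕ} (hl : hs.length = n)
    (hl' : hs'.length = m) (h : hs.Disjoint hs') (s : Finset ℕ) (b : Bits n) (b' : Bits m) :
    writeBits hs (writeBits hs' s b') b = writeBits hs' (writeBits hs s b) b' := by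
  ext u
  simp only [mem_writeBits]
  constructor
  · rintro (⟨⟨h1, h2⟩ | ⟨j, hj, rfl⟩, h3⟩ | ⟨i, hi, rfl⟩)
    · exact Or.inl ⟨Or.inl ⟨h1, h3⟩, h2⟩
    · exact Or.inr ⟨j, hj, rfl⟩
    · exact Or.inl ⟨Or.inr ⟨i, hi, rfl⟩, h (getD_mem_of_length hl i)⟩
  · rintro (⟨⟨h1, h2⟩ | ⟨j, hj, rfl⟩, h3⟩ | ⟨i, hi, rfl⟩)
    · exact Or.inl ⟨Or.inl ⟨h1, h3⟩, h2⟩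
    · exact Or.inr ⟨j, hj, rfl⟩
    · exact Or.inl ⟨Or.inr ⟨i, hi, rfl⟩, fun h4 => h h4 (getD_mem_of_length hl' i)⟩

/-- Operators on different qubits commute. -/
theorem applyOp_comm {n m : ℕ} (K : Matrix (Bits n) (Bits n) ℂ) (K' : Matrix (Bits m) (Bits m) ℂ)
    {hs hs' : List ℕ} (hl : hs.length = n) (hl' : hs'.length = m) (h : hs.Disjoint hs')
    (ψ : Ket) : applyOp K hs (applyOp K' hs' ψ) = applyOp K' hs' (applyOp K hs ψ) := by
  suffices hlin : applyOpLin K hs ∘ₗ applyOpLin K' hs' = applyOpLin K' hs' ∘ₗ applyOpLin K hs from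
    LinearMap.congr_fun hlin ψ
  refine Finsupp.lhom_ext fun s a => ?_
  simp only [LinearMap.comp_apply, applyOpLin_apply, applyOp_single]
  simp only [← applyOpLin_apply, map_sum]
  simp only [applyOpLin_apply, applyOp_single]
  rw [Finset.sum_comm]
  refine Finset.sum_congr rfl fun b _ => Finset.sum_congr rfl fun b' _ => ?_
  rw [writeBits_comm hl hl' h, readBits_writeBits_of_disjoint hl hl' h,
    readBits_writeBits_of_disjoint hl' hl h.symm]
  congr 1
  ring

/-- `f` commutes with all operators on qubits outside `S`. -/
def CommutesOff (S : Set ℕ) (f : Ket →ₗ[ℂ] Ket) : Prop :=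
  ∀ (n : ℕ) (K : Matrix (Bits n) (Bits n) ℂ) (hs : List ℕ), hs.length = n → (∀ h ∈ hs, h ∉ S) →
    ∀ ψ, f (applyOp K hs ψ) = applyOp K hs (f ψ)

theorem CommutesOff.smul_id (S : Set ℕ) (c : ℂ) : CommutesOff S (c • LinearMap.id) :=
  fun _ K hs _ _ ψ => (applyOp_smul K hs c ψ).symm

theorem CommutesOff.id (S : Set ℕ) : CommutesOff S LinearMap.id := fun _ _ _ _ _ _ => rfl

theorem CommutesOff.comp {S : Set ℕ} {f g : Ket →ₗ[ℂ] Ket} (hf : CommutesOff S f)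
    (hg : CommutesOff S g) : CommutesOff S (f ∘ₗ g) := by
  intro n K hs hl h ψ
  rw [LinearMap.comp_apply, hg n K hs hl h, hf n K hs hl h, LinearMap.comp_apply]

theorem CommutesOff.applyOp {S : Set ℕ} {n : ℕ} (K : Matrix (Bits n) (Bits n) ℂ) {hs : List ℕ}
    (hl : hs.length = n) (h : ∀ u ∈ hs, u ∈ S) : CommutesOff S (applyOpLin K hs) :=
  fun _ K' _ hl' h' ψ => applyOp_comm K K' hl hl' (fun u hu hu' => h' u hu' (h u hu)) ψ

/-! ### Norms -/

/-- The inner product of two states. -/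
def braket (φ ψ : Ket) : ℂ := φ.sum fun s a => star a * ψ s

theorem normSq_eq_braket (ψ : Ket) : ((normSq ψ : ℝ) : ℂ) = braket ψ ψ := by
  rw [normSq, braket, Finsupp.sum, Finsupp.sum, Complex.ofReal_sum]
  refine Finset.sum_congr rfl fun s _ => ?_
  rw [RCLike.star_def, Complex.conj_mul']
  simp

theorem normSq_nonneg (ψ : Ket) : 0 ≤ normSq ψ :=
  Finset.sum_nonneg fun _ _ => by positivity

theorem normSq_smul (c : ℂ) (ψ : Ket) : normSq (c • ψ) = ‖c‖ ^ 2 * normSq ψ := by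
  rw [normSq, Finsupp.sum_smul_index (fun s => by simp), normSq, Finsupp.mul_sum]
  exact Finsupp.sum_congr fun s _ => by rw [norm_mul, mul_pow]

theorem normSq_eq_sum {ψ : Ket} {B : Finset (Finset ℕ)} (h : ψ.support ⊆ B) :
    normSq ψ = ∑ s ∈ B, ‖ψ s‖ ^ 2 :=
  Finsupp.sum_of_support_subset _ h _ (by simp)

theorem braket_add_left (φ φ' ψ : Ket) : braket (φ + φ') ψ = braket φ ψ + braket φ' ψ :=
  Finsupp.sum_add_index' (fun s => by simp) fun s a b => by rw [star_add, add_mul]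

theorem braket_add_right (φ ψ ψ' : Ket) : braket φ (ψ + ψ') = braket φ ψ + braket φ ψ' := by
  simp only [braket, Finsupp.add_apply, mul_add, Finsupp.sum_add]

theorem braket_single_single (s t : Finset ℕ) (a b : ℂ) :
    braket (Finsupp.single s a) (Finsupp.single t b) = if s = t then star a * b else 0 := by
  rw [braket, Finsupp.sum_single_index (by simp), Finsupp.single_apply]
  simp [eq_comm]

theorem braket_zero_left (ψ : Ket) : braket 0 ψ = 0 := by simp [braket]

theorem braket_zero_right (ψ : Ket) : braket ψ 0 = 0 := by simp [braket]

theorem braket_sum_left {ι : Type*} (B : Finset ι) (φ : ι → Ket) (ψ : Ket) :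
    braket (∑ i ∈ B, φ i) ψ = ∑ i ∈ B, braket (φ i) ψ := by
  classical
  induction B using Finset.induction_on with
  | empty => simp [braket_zero_left]
  | insert i B hi ih => rw [Finset.sum_insert hi, Finset.sum_insert hi, braket_add_left, ih]

theorem braket_sum_right {ι : Type*} (B : Finset ι) (φ : Ket) (ψ : ι → Ket) :
    braket φ (∑ i ∈ B, ψ i) = ∑ i ∈ B, braket φ (ψ i) := by
  classical
  induction B using Finset.induction_on with
  | empty => simp [braket_zero_right]
  | insert i B hi ih => rw [Finset.sum_insert hi, Finset.sum_insert hi, braket_add_right, ih]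

/-- The names must be distinct, since a repeated name would receive the disjunction of its bits. -/
theorem readBits_writeBits_self {n : ℕ} {hs : List ℕ} (hl : hs.length = n) (hn : hs.Nodup)
    (s : Finset ℕ) (b : Bits n) : readBits n hs (writeBits hs s b) = b := by
  funext i
  have hi := getD_mem_of_length hl i
  have : hs.getD i 0 ∈ writeBits hs s b ↔ b i = true := by
    rw [mem_writeBits]
    constructor
    · rintro (h | ⟨j, hj, h⟩)
      · exact absurd hi h.2
      · rw [List.getD_eq_getElem _ _ (by omega), List.getD_eq_getElem _ _ (by omega)] at h
        rw [← hj, Fin.ext ((hn.getElem_inj_iff).1 h)]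
    · exact fun h => Or.inr ⟨i, h, rfl⟩
  rw [readBits, decide_eq_decide.2 this, Bool.decide_coe]

theorem writeBits_sdiff {n : ℕ} {hs : List ℕ} (hl : hs.length = n) (s : Finset ℕ) (b : Bits n) :
    writeBits hs s b \ hs.toFinset = s \ hs.toFinset := by
  ext u
  simp only [Finset.mem_sdiff, mem_writeBits, List.mem_toFinset]
  constructor
  · rintro ⟨h | ⟨j, -, rfl⟩, h2⟩
    · exact h
    · exact absurd (getD_mem_of_length hl j) h2
  · exact fun h => ⟨Or.inl h, h.2⟩

theorem writeBits_readBits {n : ℕ} {hs : List ℕ} (hl : hs.length = n) (s : Finset ℕ) :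
    writeBits hs s (readBits n hs s) = s := by
  ext u
  simp only [mem_writeBits, readBits, decide_eq_true_eq]
  constructor
  · rintro (h | ⟨j, h, rfl⟩)
    · exact h.1
    · exact h
  · intro h
    by_cases hu : u ∈ hs
    · obtain ⟨i, hi, rfl⟩ := List.getElem_of_mem hu
      have he : hs.getD i 0 = hs[i] := List.getD_eq_getElem _ _ hi
      exact Or.inr ⟨⟨i, by omega⟩, by rwa [he], he⟩
    · exact Or.inl ⟨h, hu⟩

theorem writeBits_inj {n : ℕ} {hs : List ℕ} (hl : hs.length = n) (hn : hs.Nodup)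
    {s t : Finset ℕ} {b b' : Bits n} :
    writeBits hs s b = writeBits hs t b' ↔ s \ hs.toFinset = t \ hs.toFinset ∧ b = b' := by
  constructor
  · intro h
    refine ⟨?_, ?_⟩
    · rw [← writeBits_sdiff hl s b, h, writeBits_sdiff hl]
    · rw [← readBits_writeBits_self hl hn s b, h, readBits_writeBits_self hl hn]
  · rintro ⟨h, rfl⟩
    simp only [writeBits, h]

/-- The memory is the product of the qubits `hs` and the rest; orthogonality of basis states is
thereby split into a condition on each factor. -/
theorem sdiff_readBits_eq_iff {n : ℕ} {hs : List ℕ} (hl : hs.length = n) {s t : Finset ℕ} :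
    (s \ hs.toFinset = t \ hs.toFinset ∧ readBits n hs s = readBits n hs t) ↔ s = t := by
  constructor
  · rintro ⟨h, h'⟩
    rw [← writeBits_readBits hl s, ← writeBits_readBits hl t, h']
    simp only [writeBits, h]
  · rintro rfl
    exact ⟨rfl, rfl⟩

/-- Basis states that differ outside `hs` stay orthogonal. If they agree there, summing over the
bits written to `hs` produces the matrix product. -/
theorem braket_applyOp_single {n : ℕ} (K : Matrix (Bits n) (Bits n) ℂ) {hs : List ℕ}
    (hl : hs.length = n) (hn : hs.Nodup) (s t : Finset ℕ) (a c : ℂ) :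
    braket (applyOp K hs (Finsupp.single s a)) (applyOp K hs (Finsupp.single t c)) =
      if s \ hs.toFinset = t \ hs.toFinset then
        star a * c * (Kᴴ * K) (readBits n hs s) (readBits n hs t) else 0 := by
  simp only [applyOp_single, braket_sum_left, braket_sum_right, braket_single_single,
    writeBits_inj hl hn]
  split_ifs with h
  · simp only [h, true_and, Finset.sum_ite_eq', Finset.mem_univ, if_true]
    rw [Matrix.mul_apply, Finset.mul_sum]
    refine Finset.sum_congr rfl fun b _ => ?_
    rw [Matrix.conjTranspose_apply, star_mul]
    ring
  · simp [h]

/-- An instrument preserves the norm. -/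
theorem sum_normSq_applyOp {n m : ℕ} (K : Fin m → Matrix (Bits n) (Bits n) ℂ)
    (hK : ∑ i, (K i)ᴴ * K i = 1) {hs : List ℕ} (hl : hs.length = n) (hn : hs.Nodup) (ψ : Ket) :
    ∑ i, normSq (applyOp (K i) hs ψ) = normSq ψ := by
  -- The claim is polarised: the inner product is additive in both arguments, which reduces it to
  -- basis states, whereas the squared norm is not.
  have key : ∀ φ ψ : Ket, ∑ i, braket (applyOp (K i) hs φ) (applyOp (K i) hs ψ) = braket φ ψ := by
    intro φ ψ
    induction φ using Finsupp.induction_linear with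
    | zero => simp [applyOp, braket]
    | add φ φ' h h' => simp only [applyOp_add, braket_add_left, Finset.sum_add_distrib, h, h']
    | single s a =>
      induction ψ using Finsupp.induction_linear with
      | zero => simp [applyOp, braket]
      | add φ φ' h h' => simp only [applyOp_add, braket_add_right, Finset.sum_add_distrib, h, h']
      | single t c =>
        simp only [braket_applyOp_single _ hl hn, braket_single_single,
          ← sdiff_readBits_eq_iff hl (s := s) (t := t)]
        by_cases h : s \ hs.toFinset = t \ hs.toFinset
        · simp only [h, if_true, ← Finset.mul_sum, true_and]
          rw [← Matrix.sum_apply, hK, Matrix.one_apply, mul_ite, mul_one, mul_zero]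
        · simp [h]
  have h := key ψ ψ
  simp only [← normSq_eq_braket] at h
  exact_mod_cast h

/-! ### Names of qubits -/

/-- The qubits on the stacks are distinct, have been used, and lie outside `S`. -/
structure Sep {Q : Type} (S : Set ℕ) (next : ℕ) (qu : Q → List ℕ) : Prop where
  nodup : ∀ q, (qu q).Nodup
  lt : ∀ q, ∀ h ∈ qu q, h < next
  avoid : ∀ q, ∀ h ∈ qu q, h ∉ S
  disj : ∀ q r, q ≠ r → (qu q).Disjoint (qu r)
  bound : ∀ s ∈ S, s < next

theorem Sep.subset {Q : Type} {S : Set ℕ} {next : ℕ} {qu : Q → List ℕ}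
    (h : Sep S next qu) {S' : Set ℕ} (hS : S' ⊆ S) : Sep S' next qu where
  nodup := h.nodup
  lt := h.lt
  avoid q u hu hs := h.avoid q u hu (hS hs)
  disj := h.disj
  bound s hs := h.bound s (hS hs)

theorem Sep.empty {Q : Type} {S : Set ℕ} {next : ℕ} (hS : ∀ s ∈ S, s < next) : Sep S next (fun _ :
    Q => []) :=
  ⟨by simp, by simp, by simp, fun _ _ _ => List.disjoint_nil_left _, hS⟩

section Sep

variable {Q : Type} [DecidableEq Q] {S : Set ℕ} {next : ℕ} {qu : Q → List ℕ}

/-- A stack may receive its own names and unused ones. Both kinds avoid the other stacks and `S`;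
for unused names this is the purpose of `lt` and `bound`. -/
theorem Sep.update (h : Sep S next qu) {next' : ℕ} (hn : next ≤ next') (q : Q) {l : List ℕ}
    (hl : l.Nodup) (hl' : ∀ u ∈ l, u < next' ∧ (u ∈ qu q ∨ next ≤ u)) :
    Sep S next' (Function.update qu q l) where
  nodup r := by
    rcases eq_or_ne r q with rfl | hr
    · simpa using hl
    · simpa [hr] using h.nodup r
  lt r u hu := by
    rcases eq_or_ne r q with rfl | hr
    · exact (hl' u (by simpa using hu)).1
    · exact (h.lt r u (by simpa [hr] using hu)).trans_le hn
  avoid r u hu := by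
    rcases eq_or_ne r q with rfl | hr
    · rcases (hl' u (by simpa using hu)).2 with h1 | h1
      · exact h.avoid r u h1
      · exact fun h2 => absurd (h.bound u h2) (by omega)
    · exact h.avoid r u (by simpa [hr] using hu)
  disj r r' hrr := by
    have key : ∀ r', r' ≠ q → l.Disjoint (qu r') := by
      intro r' hr' u hu hu'
      rcases (hl' u hu).2 with h1 | h1
      · exact h.disj q r' hr'.symm h1 hu'
      · exact absurd (h.lt r' u hu') (by omega)
    rcases eq_or_ne r q with rfl | hr
    · simpa [hrr.symm] using key r' hrr.symm
    · rcases eq_or_ne r' q with rfl | hr'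
      · simpa [hr] using (key r hr).symm
      · simpa [hr, hr'] using h.disj r r' hrr
  bound s hs := (h.bound s hs).trans_le hn

/-- Qubits in transit are put into the protected set, which records that no stack holds them.
`Sep.insert` takes them out again. -/
theorem Sep.remove (h : Sep S next qu) {q : Q} {a b : List ℕ} (hq : qu q = a ++ b) :
    Sep (S ∪ {u | u ∈ a}) next (Function.update qu q b) where
  nodup r := by
    rcases eq_or_ne r q with rfl | hr
    · simpa using (List.nodup_append.1 (hq ▸ h.nodup r)).2.1
    · simpa [hr] using h.nodup r
  lt r u hu := by
    rcases eq_or_ne r q with rfl | hr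
    · exact h.lt r u (by simp only [Function.update_self] at hu; simp [hq, hu])
    · exact h.lt r u (by simpa [hr] using hu)
  avoid r u hu hs := by
    rcases eq_or_ne r q with rfl | hr
    · simp only [Function.update_self] at hu
      rcases hs with hs | hs
      · exact h.avoid r u (by simp [hq, hu]) hs
      · exact (List.nodup_append.1 (hq ▸ h.nodup r)).2.2 u hs u hu rfl
    · simp only [ne_eq, hr, not_false_eq_true, Function.update_of_ne] at hu
      rcases hs with hs | hs
      · exact h.avoid r u hu hs
      · exact h.disj r q hr hu (by rw [hq]; exact List.mem_append_left _ hs)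
  disj r r' hrr := by
    have hsub : ∀ r, Function.update qu q b r ⊆ qu r := by
      intro r
      rcases eq_or_ne r q with rfl | hr
      · simp [hq]
      · simp [hr]
    exact fun u hu hu' => h.disj r r' hrr (hsub r hu) (hsub r' hu')
  bound s hs := by
    rcases hs with hs | hs
    · exact h.bound s hs
    · exact h.lt q s (by rw [hq]; exact List.mem_append_left _ hs)

theorem Sep.insert {a : List ℕ} (h : Sep (S ∪ {u | u ∈ a}) next qu) (ha : a.Nodup)
    (haS : ∀ u ∈ a, u ∉ S) (q : Q) : Sep S next (Function.update qu q (a ++ qu q)) where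
  nodup r := by
    rcases eq_or_ne r q with rfl | hr
    · simp only [Function.update_self]
      exact List.nodup_append.2 ⟨ha, h.nodup r, fun u hu v hv huv =>
        h.avoid r v hv (Or.inr (huv ▸ hu))⟩
    · simpa [hr] using h.nodup r
  lt r u hu := by
    rcases eq_or_ne r q with rfl | hr
    · simp only [Function.update_self, List.mem_append] at hu
      rcases hu with hu | hu
      · exact h.bound u (Or.inr hu)
      · exact h.lt r u hu
    · exact h.lt r u (by simpa [hr] using hu)
  avoid r u hu hs := by
    rcases eq_or_ne r q with rfl | hr
    · simp only [Function.update_self, List.mem_append] at hu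
      rcases hu with hu | hu
      · exact haS u hu hs
      · exact h.avoid r u hu (Or.inl hs)
    · exact h.avoid r u (by simpa [hr] using hu) (Or.inl hs)
  disj r r' hrr := by
    have key : ∀ r', r' ≠ q → (a ++ qu q).Disjoint (qu r') := by
      intro r' hr' u hu hu'
      rcases List.mem_append.1 hu with hu | hu
      · exact h.avoid r' u hu' (Or.inr hu)
      · exact h.disj q r' hr'.symm hu hu'
    rcases eq_or_ne r q with rfl | hr
    · simpa [hrr.symm] using key r' hrr.symm
    · rcases eq_or_ne r' q with rfl | hr'
      · simpa [hr] using (key r hr).symm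
      · simpa [hr, hr'] using h.disj r r' hrr
  bound s hs := h.bound s (Or.inl hs)

end Sep

theorem takeQubits_append (n : ℕ) (l : List ℕ) (w : World) :
    (takeQubits n l w).1 ++ (takeQubits n l w).2.1 = l ++ List.range' w.next (n - l.length) :=
  List.take_append_drop _ _

theorem takeQubits_length (n : ℕ) (l : List ℕ) (w : World) : (takeQubits n l w).1.length = n := by
  simp [takeQubits]
  omega

theorem takeQubits_next_le (n : ℕ) (l : List ℕ) (w : World) :
    w.next ≤ (takeQubits n l w).2.2.next := Nat.le_add_right _ _

/-- After taking qubits, all qubits of the stack are distinct and old or fresh. -/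
theorem takeQubits_names (n : ℕ) {l : List ℕ} {w : World} (hl : l.Nodup)
    (hl' : ∀ u ∈ l, u < w.next) :
    ((takeQubits n l w).1 ++ (takeQubits n l w).2.1).Nodup ∧
      ∀ u ∈ (takeQubits n l w).1 ++ (takeQubits n l w).2.1,
        u < (takeQubits n l w).2.2.next ∧ (u ∈ l ∨ w.next ≤ u) := by
  rw [takeQubits_append]
  constructor
  · refine List.nodup_append.2 ⟨hl, List.nodup_range', fun u hu v hv huv => ?_⟩
    have := hl' u hu
    rw [List.mem_range'_1] at hv
    omega
  · intro u hu
    rcases List.mem_append.1 hu with hu | hu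
    · exact ⟨(hl' u hu).trans_le (takeQubits_next_le _ _ _), Or.inl hu⟩
    · rw [List.mem_range'_1] at hu
      exact ⟨hu.2, Or.inr hu.1⟩

theorem Sep.take {Q : Type} [DecidableEq Q] {S : Set ℕ} {qu : Q → List ℕ} {w : World}
    (h : Sep S w.next qu) (n : ℕ) (q : Q) :
    Sep S (takeQubits n (qu q) w).2.2.next (Function.update qu q
      ((takeQubits n (qu q) w).1 ++ (takeQubits n (qu q) w).2.1)) :=
  have := takeQubits_names n (h.nodup q) (h.lt q)
  h.update (takeQubits_next_le _ _ _) q this.1 this.2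

theorem flatten_blocks (l m : ℕ) (hs : List ℕ) : (blocks l m hs).flatten = hs.take (m * l) := by
  induction m with
  | zero => simp [blocks]
  | succ m ih =>
    rw [blocks, List.range_succ, List.map_append, List.flatten_append]
    rw [blocks] at ih
    rw [ih, Nat.succ_mul, List.take_add]
    simp

theorem length_blocks (l m : ℕ) (hs : List ℕ) : (blocks l m hs).length = m := by simp [blocks]

theorem length_of_mem_blocks {l m : ℕ} {hs : List ℕ} (h : m * l ≤ hs.length) {b : List ℕ}
    (hb : b ∈ blocks l m hs) : b.length = l := by
  obtain ⟨j, hj, rfl⟩ := List.mem_map.1 hb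
  have hj : j < m := List.mem_range.1 hj
  have : (j + 1) * l ≤ m * l := Nat.mul_le_mul_right l hj
  rw [Nat.succ_mul] at this
  simp
  omega

theorem sublist_of_mem_blocks {l m : ℕ} {hs : List ℕ} {b : List ℕ} (hb : b ∈ blocks l m hs) :
    b.Sublist hs := by
  obtain ⟨j, -, rfl⟩ := List.mem_map.1 hb
  exact (List.take_sublist _ _).trans (List.drop_sublist _ _)

/-- Oracles that do not copy qubits, and invent only fresh ones. -/
def RespectsNames {O : Type} (orc : Oracles O) : Prop :=
  ∀ o q x (w : World), q.Nodup → (∀ u ∈ q, u < w.next) → ∀ r ∈ orc o q x w,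
    w.next ≤ r.2.2.next ∧ r.1.Nodup ∧ ∀ u ∈ r.1, u < r.2.2.next ∧ (u ∈ q ∨ w.next ≤ u)

section Names

variable {O C Q : Type} [DecidableEq C] [DecidableEq Q] {orc : Oracles O} {S : Set ℕ}

/-- A program can move names, drop them, or draw new ones from `next`, which never decreases; no
command copies a name. -/
theorem step_sep (ho : RespectsNames orc) {c : Config O C Q} (hc : Sep S c.world.next c.qu)
    {d : Config O C Q} (hd : d ∈ step orc c) :
    Sep S d.world.next d.qu ∧ c.world.next ≤ d.world.next := by
  obtain ⟨cont, cl, qu, w⟩ := c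
  rcases cont with _ | ⟨a, k⟩
  · simp only [step, List.mem_singleton] at hd
    subst hd
    exact ⟨hc, le_rfl⟩
  cases a with
  | skip | seq | push | pop | clear =>
    simp only [step, List.mem_singleton] at hd
    exact hd ▸ ⟨hc, le_rfl⟩
  | branch x a b e =>
    rcases h : cl x with _ | ⟨_ | _, _⟩ <;> simp only [step, h, List.mem_singleton] at hd <;>
      exact hd ▸ ⟨hc, le_rfl⟩
  | loop x a =>
    rcases h : cl x with _ | ⟨_, _⟩ <;> simp only [step, h, List.mem_singleton] at hd <;>
      exact hd ▸ ⟨hc, le_rfl⟩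
  | move q r =>
    simp only [step, List.mem_singleton] at hd
    subst hd
    refine ⟨?_, takeQubits_next_le _ _ _⟩
    have h1 := hc.take 1 q
    -- Removing the qubit and inserting it again also covers the case `q = r`.
    have h2 := h1.remove (q := q) (Function.update_self _ _ _)
    rw [Function.update_idem] at h2
    have hn : (takeQubits 1 (qu q) w).1.Nodup :=
      (List.nodup_append.1 (takeQubits_names 1 (hc.nodup q) (hc.lt q)).1).1
    refine h2.insert hn (fun u hu => ?_) r
    exact h1.avoid q u (by simp [hu])
  | discard q =>
    simp only [step, List.mem_singleton] at hd
    subst hd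
    exact ⟨hc.update le_rfl q (by simp) (by simp), le_rfl⟩
  | gate g y q x =>
    simp only [step, Instrument.run, List.map_map, List.mem_map] at hd
    obtain ⟨i, -, rfl⟩ := hd
    exact ⟨hc.take _ q, takeQubits_next_le _ _ _⟩
  | call o q x =>
    simp only [step, List.mem_map] at hd
    obtain ⟨r, hr, rfl⟩ := hd
    obtain ⟨h1, h2, h3⟩ := ho o (qu q) (cl x) w (hc.nodup q) (hc.lt q) r hr
    exact ⟨hc.update h1 q h2 h3, h1⟩

theorem run_sep (ho : RespectsNames orc) (t : ℕ) {c : Config O C Q}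
    (hc : Sep S c.world.next c.qu) {d : Config O C Q} (hd : d ∈ run orc t c) :
    Sep S d.world.next d.qu ∧ c.world.next ≤ d.world.next := by
  induction t generalizing c with
  | zero =>
    rw [run, List.mem_singleton] at hd
    subst hd
    exact ⟨hc, le_rfl⟩
  | succ t ih =>
    obtain ⟨e, he, hd⟩ := List.mem_flatMap.1 hd
    obtain ⟨h1, h2⟩ := step_sep ho hc he
    obtain ⟨h3, h4⟩ := ih h1 hd
    exact ⟨h3, h2.trans h4⟩

end Names

theorem exists_mem_run_of_mem_exec {O C Q : Type} [DecidableEq C] [DecidableEq Q]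
    {orc : Oracles O} {c d : Config O C Q} (h : d ∈ exec orc c) :
    ∃ t, HaltsIn orc t c ∧ d ∈ run orc t c := by
  classical
  by_cases h' : ∃ t, HaltsIn orc t c
  · obtain ⟨t, ht⟩ := h'
    exact ⟨t, ht, ht.exec_eq ▸ h⟩
  · rw [exec, dif_neg h'] at h
    simp at h

/-! ### Transformations of the memory that a program does not notice -/

/-- Applies `f` to the memory and `g` to the log. -/
def World.map (f : Ket →ₗ[ℂ] Ket) (g : List Event → List Event) (w : World) : World :=
  ⟨w.next, f w.ket, g w.log⟩

/-- Applies `f` to the memory and `g` to the log. -/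
def Config.map {O C Q : Type} (f : Ket →ₗ[ℂ] Ket) (g : List Event → List Event)
    (c : Config O C Q) : Config O C Q :=
  ⟨c.cont, c.cl, c.qu, c.world.map f g⟩

/-- Oracles that do not notice the transformation by `f` and `g` when called on qubits
outside `S`. -/
def Equivariant {O : Type} (S : Set ℕ) (f : Ket →ₗ[ℂ] Ket) (g : List Event → List Event)
    (orc : Oracles O) : Prop :=
  ∀ o q x (w : World), (∀ s ∈ S, s < w.next) → q.Nodup → (∀ u ∈ q, u < w.next) →
    (∀ u ∈ q, u ∉ S) →
      orc o q x (w.map f g) = (orc o q x w).map fun r => (r.1, r.2.1, r.2.2.map f g)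

theorem Instrument.run_map {S : Set ℕ} {f : Ket →ₗ[ℂ] Ket} (hf : CommutesOff S f)
    (g : List Event → List Event) {n : ℕ} (I : Instrument n) {hs : List ℕ} (hl : hs.length = n)
    (hS : ∀ u ∈ hs, u ∉ S) (w : World) :
    I.run hs (w.map f g) = (I.run hs w).map fun r => (r.1, r.2.map f g) := by
  simp only [Instrument.run, List.map_map]
  refine List.map_congr_left fun i _ => ?_
  simp [World.map, hf n _ hs hl hS]

theorem takeQubits_map (n : ℕ) (l : List ℕ) (w : World) (f : Ket →ₗ[ℂ] Ket)
    (g : List Event → List Event) : takeQubits n l (w.map f g) =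
      ((takeQubits n l w).1, (takeQubits n l w).2.1, (takeQubits n l w).2.2.map f g) := rfl

section Map

variable {O C Q : Type} [DecidableEq C] [DecidableEq Q] {orc : Oracles O} {S : Set ℕ}
  {f : Ket →ₗ[ℂ] Ket} {g : List Event → List Event}

/-- Control depends on the classical stacks only, and every operator is applied outside `S`, where
it commutes with `f`. So both computations have the same branches with the same classical data. -/
theorem step_map (hf : CommutesOff S f) (ho : Equivariant S f g orc) {c : Config O C Q}
    (hc : Sep S c.world.next c.qu) :
    step orc (c.map f g) = (step orc c).map (Config.map f g) := by
  obtain ⟨cont, cl, qu, w⟩ := c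
  rcases cont with _ | ⟨a, k⟩
  · simp [step, Config.map]
  cases a with
  | skip | seq | push | pop | clear | discard | move =>
    simp [step, Config.map, takeQubits_map]
  | branch x a b e => rcases h : cl x with _ | ⟨_ | _, _⟩ <;> simp [step, Config.map, h]
  | loop x a => rcases h : cl x with _ | ⟨_, _⟩ <;> simp [step, Config.map, h]
  | gate G y q x =>
    have h1 := hc.take (G (cl y).length).1 q
    have h2 := (G (cl y).length).2.run_map hf g (takeQubits_length _ (qu q) w)
      (fun u hu => h1.avoid q u (by simp [hu])) (takeQubits (G (cl y).length).1 (qu q) w).2.2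
    simp only [step, Config.map, takeQubits_map, h2, List.map_map]
    rfl
  | call o q x =>
    have h2 := ho o (qu q) (cl x) w hc.bound (hc.nodup q) (hc.lt q) (hc.avoid q)
    simp only [step, Config.map, h2, List.map_map]
    rfl

theorem run_map (hf : CommutesOff S f) (ho : Equivariant S f g orc) (hr : RespectsNames orc)
    (t : ℕ) {c : Config O C Q} (hc : Sep S c.world.next c.qu) :
    run orc t (c.map f g) = (run orc t c).map (Config.map f g) := by
  induction t generalizing c with
  | zero => simp [run]
  | succ t ih =>
    rw [run, step_map hf ho hc, List.flatMap_map, run, List.map_flatMap]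
    exact List.flatMap_congr fun d hd => ih (step_sep hr hc hd).1

theorem haltsIn_map (hf : CommutesOff S f) (ho : Equivariant S f g orc) (hr : RespectsNames orc)
    {t : ℕ} {c : Config O C Q} (hc : Sep S c.world.next c.qu) :
    HaltsIn orc t (c.map f g) ↔ HaltsIn orc t c := by
  rw [HaltsIn, run_map hf ho hr t hc, List.forall_mem_map]
  rfl

theorem exec_map (hf : CommutesOff S f) (ho : Equivariant S f g orc) (hr : RespectsNames orc)
    {c : Config O C Q} (hc : Sep S c.world.next c.qu) :
    exec orc (c.map f g) = (exec orc c).map (Config.map f g) := by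
  classical
  by_cases h : ∃ t, HaltsIn orc t c
  · obtain ⟨t, ht⟩ := h
    rw [ht.exec_eq, ((haltsIn_map hf ho hr hc).2 ht).exec_eq, run_map hf ho hr t hc]
  · have h' : ¬ ∃ t, HaltsIn orc t (c.map f g) := fun ⟨t, ht⟩ =>
      h ⟨t, (haltsIn_map hf ho hr hc).1 ht⟩
    rw [exec, exec, dif_neg h, dif_neg h', List.map_nil]

end Map

theorem respectsNames_noOracles : RespectsNames noOracles := fun o => o.elim

theorem equivariant_noOracles (S : Set ℕ) (f : Ket →ₗ[ℂ] Ket) (g : List Event → List Event) :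
    Equivariant S f g noOracles := fun o => o.elim

/-! ### Names and transformations in the public verification -/

namespace PublicVerifier

variable (V : PublicVerifier) {S : Set ℕ}

theorem load_sep {s : V.Memory} {w : World} {hs : List ℕ}
    (h : Sep (S ∪ {u | u ∈ hs}) w.next s.qu) (hn : hs.Nodup) (hS : ∀ u ∈ hs, u ∉ S) :
    Sep S (V.load s w hs).world.next (V.load s w hs).qu :=
  h.insert hn hS V.incoming

theorem verify_sep {s : V.Memory} {w : World} {hs : List ℕ}
    (h : Sep (S ∪ {u | u ∈ hs}) w.next s.qu) (hn : hs.Nodup) (hS : ∀ u ∈ hs, u ∉ S)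
    {r : Bool × V.Memory × World} (hr : r ∈ V.verify s w hs) :
    Sep S r.2.2.next r.2.1.qu ∧ w.next ≤ r.2.2.next := by
  obtain ⟨d, hd, rfl⟩ := List.mem_map.1 hr
  obtain ⟨t, -, hd⟩ := exists_mem_run_of_mem_exec hd
  exact run_sep respectsNames_noOracles t (V.load_sep h hn hS) hd

theorem verify_map {f : Ket →ₗ[ℂ] Ket} (hf : CommutesOff S f) (g : List Event → List Event)
    {s : V.Memory} {w : World} {hs : List ℕ}
    (h : Sep (S ∪ {u | u ∈ hs}) w.next s.qu) (hn : hs.Nodup) (hS : ∀ u ∈ hs, u ∉ S) :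
    V.verify s (w.map f g) hs = (V.verify s w hs).map fun r => (r.1, r.2.1, r.2.2.map f g) := by
  have := exec_map hf (equivariant_noOracles S f g) respectsNames_noOracles (V.load_sep h hn hS)
  rw [verify, verify]
  change List.map _ (exec noOracles ((V.load s w hs).map f g)) = _
  rw [this, List.map_map, List.map_map]
  rfl

/-- Coins waiting to be verified belong to the protected set and leave it one at a time, so the
verifier cannot reach a coin before its turn. -/
theorem count_sep {coins : List (List ℕ)} {s : V.Memory} {w : World}
    (h : Sep (S ∪ {u | u ∈ coins.flatten}) w.next s.qu) (hn : coins.flatten.Nodup)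
    (hS : ∀ u ∈ coins.flatten, u ∉ S) {r : ℕ × V.Memory × World} (hr : r ∈ V.count coins s w) :
    Sep S r.2.2.next r.2.1.qu ∧ w.next ≤ r.2.2.next := by
  induction coins generalizing s w r with
  | nil =>
    simp only [count, List.mem_singleton] at hr
    subst hr
    exact ⟨h.subset Set.subset_union_left, le_rfl⟩
  | cons hs rest ih =>
    simp only [count, List.mem_flatMap, List.mem_map] at hr
    obtain ⟨r1, hr1, u, hu, rfl⟩ := hr
    rw [List.flatten_cons, List.nodup_append] at hn
    simp only [List.flatten_cons, List.mem_append] at hS h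
    obtain ⟨h1, h2⟩ := V.verify_sep (S := S ∪ {u | u ∈ rest.flatten}) (h.subset (by
      intro x hx; simp only [Set.mem_union, Set.mem_ofPred_eq] at hx ⊢; tauto)) hn.1
      (fun u hu hu' => hu'.elim (hS u (Or.inl hu)) fun h3 => hn.2.2 u hu u h3 rfl) hr1
    obtain ⟨h3, h4⟩ := ih h1 hn.2.1 (fun u hu => hS u (Or.inr hu)) hu
    exact ⟨h3, h2.trans h4⟩

theorem count_map {f : Ket →ₗ[ℂ] Ket} (hf : CommutesOff S f) (g : List Event → List Event)
    {coins : List (List ℕ)} {s : V.Memory} {w : World}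
    (h : Sep (S ∪ {u | u ∈ coins.flatten}) w.next s.qu) (hn : coins.flatten.Nodup)
    (hS : ∀ u ∈ coins.flatten, u ∉ S) :
    V.count coins s (w.map f g) =
      (V.count coins s w).map fun r => (r.1, r.2.1, r.2.2.map f g) := by
  induction coins generalizing s w with
  | nil => simp [count]
  | cons hs rest ih =>
    rw [List.flatten_cons, List.nodup_append] at hn
    simp only [List.flatten_cons, List.mem_append] at hS h
    have h' : Sep ((S ∪ {u | u ∈ rest.flatten}) ∪ {u | u ∈ hs}) w.next s.qu := h.subset (by
      intro x hx; simp only [Set.mem_union, Set.mem_ofPred_eq] at hx ⊢; tauto)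
    have hS' : ∀ u ∈ hs, u ∉ S ∪ {u | u ∈ rest.flatten} :=
      fun u hu hu' => hu'.elim (hS u (Or.inl hu)) fun h3 => hn.2.2 u hu u h3 rfl
    simp only [count]
    rw [V.verify_map hf g (h'.subset (Set.union_subset_union_left _ Set.subset_union_left)) hn.1
      (fun u hu => hS u (Or.inl hu)), List.flatMap_map, List.map_flatMap]
    refine List.flatMap_congr fun r hr => ?_
    rw [ih (V.verify_sep h' hn.1 hS' hr).1 hn.2.1 (fun u hu => hS u (Or.inr hu)), List.map_map,
      List.map_map]
    rfl

end PublicVerifier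

/-! ### Names and transformations in the game -/

namespace CoinScheme

variable (M : CoinScheme) (lam : ℕ) (sk : M.Key lam) {S : Set ℕ}

theorem mint_length (w : World) : (M.mint lam sk w).1.length = M.coinLen lam := by simp [mint]

theorem mint_map {f : Ket →ₗ[ℂ] Ket} (hf : CommutesOff S f) (g : List Event → List Event)
    {w : World} (hS : ∀ s ∈ S, s < w.next) :
    M.mint lam sk (w.map f g) = ((M.mint lam sk w).1, (M.mint lam sk w).2.map f g) := by
  simp only [mint, World.map, prepare_eq_applyOp]
  rw [hf _ _ _ (by simp) fun u hu hs => ?_]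
  rw [List.mem_range'_1] at hu
  have := hS u hs
  omega

theorem fresh_sep (V : PublicVerifier) {w : World} (hS : ∀ s ∈ S, s < w.next) (l : ℕ) :
    Sep S (M.mint lam sk w).2.next (V.fresh lam l (M.mint lam sk w).1).qu := by
  refine Sep.update (Sep.empty hS) (Nat.le_add_right _ _) _ List.nodup_range' fun u hu => ?_
  simp only [mint, List.mem_range'_1] at hu
  exact ⟨hu.2, Or.inr hu.1⟩

theorem privCount_world {coins : List (List ℕ)} {w : World} {r : ℕ × World}
    (hr : r ∈ M.privCount lam sk coins w) :
    r.2.next = w.next ∧ r.2.log = w.log ∧ r.1 ≤ coins.length := by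
  induction coins generalizing w r with
  | nil =>
    simp only [privCount, List.mem_singleton] at hr
    subst hr
    exact ⟨rfl, rfl, le_rfl⟩
  | cons hs rest ih =>
    simp only [privCount, Instrument.run, List.mem_flatMap, List.mem_map] at hr
    obtain ⟨r1, ⟨i, -, rfl⟩, u, hu, rfl⟩ := hr
    obtain ⟨h1, h2, h3⟩ := ih hu
    refine ⟨h1, h2, ?_⟩
    simp only [List.length_cons]
    split <;> omega

theorem privCount_map {f : Ket →ₗ[ℂ] Ket} (hf : CommutesOff S f) (g : List Event → List Event)
    {coins : List (List ℕ)} (hl : ∀ c ∈ coins, c.length = M.coinLen lam)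
    (hS : ∀ c ∈ coins, ∀ u ∈ c, u ∉ S) (w : World) :
    M.privCount lam sk coins (w.map f g) =
      (M.privCount lam sk coins w).map fun r => (r.1, r.2.map f g) := by
  induction coins generalizing w with
  | nil => simp [privCount]
  | cons hs rest ih =>
    simp only [List.mem_cons, forall_eq_or_imp] at hl hS
    simp only [privCount]
    rw [Instrument.run_map hf g _ hl.1 hS.1, List.flatMap_map, List.map_flatMap]
    refine List.flatMap_congr fun r _ => ?_
    rw [ih hl.2 hS.2, List.map_map, List.map_map]
    rfl

/-- The private count applies a quantum instrument to the coins. -/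
theorem exists_privCount_ops {coins : List (List ℕ)}
    (hl : ∀ c ∈ coins, c.length = M.coinLen lam) (hn : ∀ c ∈ coins, c.Nodup)
    (hS : ∀ c ∈ coins, ∀ u ∈ c, u ∈ S) :
    ∃ ops : List (ℕ × (Ket →ₗ[ℂ] Ket)),
      (∀ w, M.privCount lam sk coins w = ops.map fun p => (p.1, ⟨w.next, p.2 w.ket, w.log⟩)) ∧
      (∀ p ∈ ops, CommutesOff S p.2) ∧
      ∀ ψ, (ops.map fun p => normSq (p.2 ψ)).sum = normSq ψ := by
  induction coins with
  | nil =>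
    exact ⟨[(0, LinearMap.id)], fun w => rfl, by simpa using CommutesOff.id S, by simp⟩
  | cons hs rest ih =>
    simp only [List.mem_cons, forall_eq_or_imp] at hl hn hS
    obtain ⟨ops, h1, h2, h3⟩ := ih hl.2 hn.2 hS.2
    refine ⟨(List.finRange (M.privBranches lam)).flatMap fun i => ops.map fun p =>
      ((if M.privResult lam i then 1 else 0) + p.1, p.2 ∘ₗ applyOpLin (M.privKraus lam sk i) hs),
      fun w => ?_, fun p hp => ?_, fun ψ => ?_⟩
    · simp only [privCount, Instrument.run, h1, List.flatMap_map, List.map_flatMap, List.map_map]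
      rfl
    · simp only [List.mem_flatMap, List.mem_map] at hp
      obtain ⟨i, -, p, hp, rfl⟩ := hp
      exact (h2 p hp).comp (CommutesOff.applyOp _ hl.1 hS.1)
    -- By `h3` the operators of the later coins contribute factor one, and the completeness relation
    -- of the first coin remains.
    · rw [List.map_flatMap, List.flatMap, List.sum_flatten, List.map_map]
      simp only [List.map_map, Function.comp_def, LinearMap.comp_apply, h3, applyOpLin_apply]
      rw [← sum_normSq_applyOp (M.privKraus lam sk) (M.priv_complete lam sk) hl.1 hn.1 ψ,
        ← List.sum_ofFn, List.ofFn_eq_map]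

/-- The coins of a wallet, as blocks of qubits. -/
theorem wallet_blocks (wallet : List ℕ) {c : List ℕ}
    (hc : c ∈ blocks (M.coinLen lam) (wallet.length / M.coinLen lam) wallet) :
    c.length = M.coinLen lam ∧ c.Sublist wallet :=
  ⟨length_of_mem_blocks (Nat.div_mul_le_self _ _) hc, sublist_of_mem_blocks hc⟩

theorem receive_next_le {coins : List (List ℕ)} {w : World} (hn : coins.flatten.Nodup)
    (hlt : ∀ u ∈ coins.flatten, u < w.next) {r : ℕ × World}
    (hr : r ∈ M.receive lam sk coins w) : w.next ≤ r.2.next := by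
  simp only [receive, List.mem_flatMap, List.mem_map] at hr
  obtain ⟨r1, hr1, u, hu, rfl⟩ := hr
  have h1 := M.fresh_sep lam sk (S := ∅ ∪ {u | u ∈ coins.flatten}) (M.verifier lam)
    (w := w) (by simpa using hlt) (M.coinLen lam)
  have h2 := (PublicVerifier.count_sep _ h1 hn (by simp) hr1).2
  have h3 := (M.privCount_world lam sk hu).1
  have h4 : w.next ≤ (M.mint lam sk w).2.next := Nat.le_add_right _ _
  change w.next ≤ u.2.next
  omega

/-- The condition on `g` suits operations that only append to the log; prefixing a fixed list
satisfies it. -/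
theorem receive_map {f : Ket →ₗ[ℂ] Ket} (hf : CommutesOff S f) {g : List Event → List Event}
    (hg : ∀ l e, g (l ++ [e]) = g l ++ [e]) {coins : List (List ℕ)} {w : World}
    (hn : coins.flatten.Nodup) (hlt : ∀ u ∈ coins.flatten, u < w.next)
    (hcS : ∀ u ∈ coins.flatten, u ∉ S) (hS : ∀ s ∈ S, s < w.next) :
    M.receive lam sk coins (w.map f g) =
      (M.receive lam sk coins w).map fun r => (r.1, r.2.map f g) := by
  have h1 := M.fresh_sep lam sk (S := S ∪ {u | u ∈ coins.flatten}) (M.verifier lam)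
    (w := w) (fun s hs => hs.elim (hS s) (hlt s)) (M.coinLen lam)
  simp only [receive]
  rw [M.mint_map lam sk hf g hS, PublicVerifier.count_map _ hf g h1 hn hcS, List.flatMap_map,
    List.map_flatMap]
  refine List.flatMap_congr fun r hr => ?_
  -- Whatever the verifier has put into its wallet avoids `S`, so the private count commutes with
  -- `f` as well.
  have h2 := (PublicVerifier.count_sep _ h1 hn hcS hr).1
  rw [M.privCount_map lam sk hf g (fun c hc => (M.wallet_blocks lam _ hc).1) (fun c hc u hu =>
    h2.avoid _ u ((M.wallet_blocks lam _ hc).2.subset hu)), List.map_map, List.map_map]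
  refine List.map_congr_left fun u _ => ?_
  simp [World.map, hg]

/-- The coins submitted in a payment. -/
theorem pay_coins {m : ℕ} {q : List ℕ} {w : World} (hq : q.Nodup) (hlt : ∀ u ∈ q, u < w.next) :
    let t := takeQubits (m * M.coinLen lam) q w
    (blocks (M.coinLen lam) m t.1).flatten = t.1 ∧ (blocks (M.coinLen lam) m t.1).flatten.Nodup ∧
      t.2.1.Nodup ∧ (∀ u ∈ t.1, u < t.2.2.next ∧ (u ∈ q ∨ w.next ≤ u)) ∧
      ∀ u ∈ t.2.1, u < t.2.2.next ∧ (u ∈ q ∨ w.next ≤ u) := by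
  intro t
  obtain ⟨h1, h2⟩ := takeQubits_names (m * M.coinLen lam) hq hlt
  obtain ⟨h3, h4, h5⟩ := List.nodup_append.1 h1
  have hb : (blocks (M.coinLen lam) m t.1).flatten = t.1 := by
    rw [flatten_blocks, List.take_of_length_le]
    rw [takeQubits_length]
  exact ⟨hb, hb.symm ▸ h3, h4, fun u hu => h2 u (List.mem_append_left _ hu),
    fun u hu => h2 u (List.mem_append_right _ hu)⟩

theorem mint_names (w : World) : (M.mint lam sk w).1.Nodup ∧
    ∀ u ∈ (M.mint lam sk w).1, u < (M.mint lam sk w).2.next ∧ w.next ≤ u :=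
  ⟨List.nodup_range', fun u hu => by
    simp only [mint, List.mem_range'_1] at hu ⊢
    exact ⟨hu.2, hu.1⟩⟩

theorem respectsNames_oracles : RespectsNames (M.oracles lam sk) := by
  intro o q x w hq hlt r hr
  cases o with
  | mint =>
    simp only [oracles, List.mem_singleton] at hr
    subst hr
    obtain ⟨h1, h2⟩ := M.mint_names lam sk w
    have h3 : w.next ≤ (M.mint lam sk w).2.next := Nat.le_add_right _ _
    refine ⟨h3, List.nodup_append.2 ⟨h1, hq, fun u hu v hv huv => ?_⟩, fun u hu => ?_⟩
    · have := h2 u hu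
      have := hlt v hv
      omega
    · rcases List.mem_append.1 hu with hu | hu
      · exact ⟨(h2 u hu).1, Or.inr (h2 u hu).2⟩
      · exact ⟨(hlt u hu).trans_le h3, Or.inl hu⟩
  | privVerify =>
    simp only [oracles, Instrument.run, List.map_map, List.mem_map] at hr
    obtain ⟨i, -, rfl⟩ := hr
    obtain ⟨h1, h2⟩ := takeQubits_names (M.coinLen lam) hq hlt
    exact ⟨takeQubits_next_le _ _ _, h1, h2⟩
  | pay =>
    simp only [oracles, List.mem_map] at hr
    obtain ⟨u, hu, rfl⟩ := hr
    obtain ⟨h1, h2, h3, h4, h5⟩ := M.pay_coins lam (m := x.length) hq hlt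
    have h6 := M.receive_next_le lam sk h2 (fun u hu => (h4 u (h1 ▸ hu)).1) hu
    exact ⟨(takeQubits_next_le _ _ _).trans h6, h3, fun u hu =>
      ⟨(h5 u hu).1.trans_le h6, (h5 u hu).2⟩⟩

theorem equivariant_oracles {f : Ket →ₗ[ℂ] Ket} (hf : CommutesOff S f)
    {g : List Event → List Event} (hg : ∀ l e, g (l ++ [e]) = g l ++ [e]) :
    Equivariant S f g (M.oracles lam sk) := by
  intro o q x w hS hq hlt hqS
  cases o with
  | mint =>
    simp only [oracles]
    rw [M.mint_map lam sk hf g hS]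
    simp [World.map, hg]
  | privVerify =>
    simp only [oracles, takeQubits_map]
    rw [Instrument.run_map hf g _ (takeQubits_length _ _ _) (fun u hu hs => ?_), List.map_map,
      List.map_map]
    · simp [World.map, hg, Function.comp_def]
    · have := (takeQubits_names (M.coinLen lam) hq hlt).2 u (by simp [hu])
      rcases this.2 with h | h
      · exact hqS u h hs
      · exact absurd (hS u hs) (by omega)
  | pay =>
    obtain ⟨h1, h2, h3, h4, h5⟩ := M.pay_coins lam (m := x.length) hq hlt
    simp only [oracles, takeQubits_map]
    rw [M.receive_map lam sk hf hg h2 (fun u hu => (h4 u (h1 ▸ hu)).1)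
      (fun u hu hs => ?_) (fun s hs => (hS s hs).trans_le (takeQubits_next_le _ _ _)),
      List.map_map, List.map_map]
    · rfl
    · rcases (h4 u (h1 ▸ hu)).2 with h | h
      · exact hqS u h hs
      · exact absurd (hS u hs) (by omega)

end CoinScheme

/-- The public count does not change the log. -/
theorem PublicVerifier.count_log (V : PublicVerifier) {coins : List (List ℕ)} {s : V.Memory}
    {w : World} (h : Sep (∅ ∪ {u | u ∈ coins.flatten}) w.next s.qu) (hn : coins.flatten.Nodup)
    {r : ℕ × V.Memory × World} (hr : r ∈ V.count coins s w) : r.2.2.log = w.log := by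
  -- With this constant `g` the transformed world is `w` itself, while every resulting log is
  -- `w.log`.
  have h1 := V.count_map (CommutesOff.id ∅) (fun _ => w.log) h hn (by simp)
  change V.count coins s w = _ at h1
  rw [h1] at hr
  obtain ⟨r', -, rfl⟩ := List.mem_map.1 hr
  rfl

/-! ### The hybrid game -/

/-- Counts down the payments; `some n` means that `n` payments precede the selected one, and
`none` that it is over. -/
def advance : Option ℕ → Event → Option ℕ
  | some (n + 1), .payment _ _ _ => some n
  | some 0, .payment _ _ _ => none
  | o, _ => o

/-- Replaces payments other than the selected one by queries to the mint. -/
def relabel : Option ℕ → Event → Event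
  | some 0, e => e
  | _, .payment _ _ _ => .mint
  | _, e => e

/-- Keeps only the selected payment. -/
def select : Option ℕ → List Event → List Event
  | _, [] => []
  | o, e :: l => relabel o e :: select (advance o e) l

/-- The position relative to the selected payment after the events `l`. -/
def position (o : Option ℕ) (l : List Event) : Option ℕ := l.foldl advance o

theorem select_append (o : Option ℕ) (l l' : List Event) :
    select o (l ++ l') = select o l ++ select (position o l) l' := by
  induction l generalizing o with
  | nil => rfl
  | cons e l ih => simp [select, position, ih]

theorem position_append (o : Option ℕ) (l l' : List Event) :
    position o (l ++ l') = position (position o l) l' := List.foldl_append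

/-- Forgets the refund. -/
def Event.eraseRefund : Event → Event
  | .payment m a _ => .payment m a 0
  | e => e

/-- The loss in the selected payment. -/
def selectedLoss (j : ℕ) (l : List Event) : ℝ := totalLoss (select (some j) l)

/-- The refund of a payment that is not selected does not matter. -/
theorem selectedLoss_refund {j : ℕ} {l : List Event} (h : position (some j) l ≠ some 0)
    (m a u : ℕ) (l' : List Event) :
    selectedLoss j (l ++ [.payment m a u] ++ l') = selectedLoss j (l ++ [.payment m a 0] ++ l') :=
        by
  simp only [selectedLoss, List.append_assoc, select_append]
  congr 2
  rcases hp : position (some j) l with _ | _ | n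
  · rfl
  · exact absurd hp h
  · rfl

namespace CoinScheme

variable (M : CoinScheme) (lam : ℕ) (sk : M.Key lam) (j : ℕ)

/-- The answers of the oracles in the hybrid game, in which only payment `j` is followed by a
private count. -/
def hybrid : Oracles GameOracle
  | .pay, q, x, w =>
      if position (some j) w.log = some 0 then M.oracles lam sk .pay q x w
      else
        let t := takeQubits (x.length * M.coinLen lam) q w
        let fresh := M.mint lam sk t.2.2
        ((M.verifier lam).count (blocks (M.coinLen lam) x.length t.1)
            ((M.verifier lam).fresh lam (M.coinLen lam) fresh.1) fresh.2).map fun r =>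
          (t.2.1, List.replicate r.1 true,
            ⟨r.2.2.next, r.2.2.ket, r.2.2.log ++ [Event.payment x.length r.1 0]⟩)
  | o, q, x, w => M.oracles lam sk o q x w

theorem respectsNames_hybrid : RespectsNames (M.hybrid lam sk j) := by
  intro o q x w hq hlt r hr
  cases o with
  | mint => exact M.respectsNames_oracles lam sk .mint q x w hq hlt r hr
  | privVerify => exact M.respectsNames_oracles lam sk .privVerify q x w hq hlt r hr
  | pay =>
    simp only [hybrid] at hr
    split_ifs at hr with h
    · exact M.respectsNames_oracles lam sk .pay q x w hq hlt r hr
    · obtain ⟨r1, hr1, rfl⟩ := List.mem_map.1 hr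
      obtain ⟨h1, h2, h3, h4, h5⟩ := M.pay_coins lam (m := x.length) hq hlt
      have h6 := M.fresh_sep lam sk (S := ∅ ∪ {u | u ∈ (blocks (M.coinLen lam) x.length
        (takeQubits (x.length * M.coinLen lam) q w).1).flatten}) (M.verifier lam)
        (w := (takeQubits (x.length * M.coinLen lam) q w).2.2)
        (fun u hu => by
          rw [h1] at hu
          exact (h4 u (by simpa using hu)).1) (M.coinLen lam)
      have h7 := (PublicVerifier.count_sep _ h6 h2 (by simp) hr1).2
      have h8 : (takeQubits (x.length * M.coinLen lam) q w).2.2.next ≤ r1.2.2.next :=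
        le_trans (Nat.le_add_right _ _) h7
      exact ⟨(takeQubits_next_le _ _ _).trans h8, h3, fun u hu =>
        ⟨(h5 u hu).1.trans_le h8, (h5 u hu).2⟩⟩

/-- The expected loss in the selected payment, `t` steps after the configuration `c`. -/
def partialLoss {C Q : Type} [DecidableEq C] [DecidableEq Q] (orc : Oracles GameOracle)
    (t : ℕ) (c : Config GameOracle C Q) : ℝ :=
  ((run orc t c).map fun d => normSq d.world.ket * selectedLoss j d.world.log).sum

theorem sum_map_flatMap {α β : Type*} (L : List α) (f : α → List β) (g : β → ℝ) :
    ((L.flatMap f).map g).sum = (L.map fun a => ((f a).map g).sum).sum := by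
  rw [List.map_flatMap, List.flatMap, List.sum_flatten, List.map_map]
  rfl

theorem partialLoss_succ {C Q : Type} [DecidableEq C] [DecidableEq Q] (orc : Oracles GameOracle)
    (t : ℕ) (c : Config GameOracle C Q) :
    partialLoss j orc (t + 1) c = ((step orc c).map fun d => partialLoss j orc t d).sum :=
  sum_map_flatMap _ _ _

theorem sum_sum_comm {α β : Type*} (L : List α) (L' : List β) (f : α → β → ℝ) :
    (L.map fun a => (L'.map fun b => f a b).sum).sum =
      (L'.map fun b => (L.map fun a => f a b).sum).sum := by
  induction L with
  | nil => simp
  | cons a L ih => simp [ih, List.sum_map_add]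

section Discard

variable {C Q : Type} [DecidableEq C] [DecidableEq Q]

/-- The private count of a wallet that is thrown away does not affect the rest of the game. -/
theorem discard_privCount {W : Set ℕ} (k : List (Cmd GameOracle C Q)) (cl : C → List Bool)
    (qu : Q → List ℕ) (w : World) (hc : Sep W w.next qu) {coins : List (List ℕ)}
    (hl : ∀ c ∈ coins, c.length = M.coinLen lam) (hn : ∀ c ∈ coins, c.Nodup)
    (hW : ∀ c ∈ coins, ∀ u ∈ c, u ∈ W) (hp : position (some j) w.log ≠ some 0) (m a : ℕ) :
    (∀ t, ((M.privCount lam sk coins w).map fun u => partialLoss j (M.oracles lam sk) t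
        ⟨k, cl, qu, ⟨u.2.next, u.2.ket, u.2.log ++ [.payment m a u.1]⟩⟩).sum =
      partialLoss j (M.oracles lam sk) t
        ⟨k, cl, qu, ⟨w.next, w.ket, w.log ++ [.payment m a 0]⟩⟩) ∧
    ∃ u ∈ M.privCount lam sk coins w, ∀ t,
      (HaltsIn (M.oracles lam sk) t
          ⟨k, cl, qu, ⟨u.2.next, u.2.ket, u.2.log ++ [.payment m a u.1]⟩⟩ →
        HaltsIn (M.oracles lam sk) t
          ⟨k, cl, qu, ⟨w.next, w.ket, w.log ++ [.payment m a 0]⟩⟩) ∧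
      ∀ e ∈ run (M.oracles lam sk) t ⟨k, cl, qu, ⟨w.next, w.ket, w.log ++ [.payment m a 0]⟩⟩,
        ∃ e' ∈ run (M.oracles lam sk) t
          ⟨k, cl, qu, ⟨u.2.next, u.2.ket, u.2.log ++ [.payment m a u.1]⟩⟩,
          e.world.log.map Event.eraseRefund = e'.world.log.map Event.eraseRefund := by
  obtain ⟨ops, h1, h2, h3⟩ := M.exists_privCount_ops lam sk hl hn hW
  -- All runs to be compared are images of the run from `c0`, which has an empty log: an operator of
  -- the private count acts on the memory, and a prefix is put before the log.
  obtain ⟨c0, hc0⟩ : ∃ c0 : Config GameOracle C Q, c0 = ⟨k, cl, qu, ⟨w.next, w.ket, []⟩⟩ := ⟨_, rfl⟩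
  let L : ℕ → List Event := fun u => w.log ++ [.payment m a u]
  have happ : ∀ u (l : List Event) (e : Event), L u ++ (l ++ [e]) = (L u ++ l) ++ [e] :=
    fun u l e => (List.append_assoc _ _ _).symm
  have hrun : ∀ (p : ℕ × (Ket →ₗ[ℂ] Ket)) t, CommutesOff W p.2 →
      run (M.oracles lam sk) t ⟨k, cl, qu, ⟨w.next, p.2 w.ket, w.log ++ [.payment m a p.1]⟩⟩ =
        (run (M.oracles lam sk) t c0).map (Config.map p.2 (L p.1 ++ ·)) := by
    intro p t hp
    rw [← run_map (c := c0) hp (M.equivariant_oracles lam sk hp (happ p.1))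
      (M.respectsNames_oracles lam sk) t (by rw [hc0]; exact hc)]
    simp [Config.map, World.map, hc0, L]
  have hrun0 := fun t => hrun (0, LinearMap.id) t (CommutesOff.id W)
  simp only [LinearMap.id_apply] at hrun0
  refine ⟨fun t => ?_, ?_⟩
  · rw [h1, List.map_map]
    -- The refund `p.1` in the prefix may be replaced by `0`, as this payment is not selected. The
    -- loss then no longer depends on the branch `p`.
    have h4 : ∀ p ∈ ops, partialLoss j (M.oracles lam sk) t
        ⟨k, cl, qu, ⟨w.next, p.2 w.ket, w.log ++ [.payment m a p.1]⟩⟩ =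
        ((run (M.oracles lam sk) t c0).map fun d =>
          normSq (p.2 d.world.ket) * selectedLoss j (L 0 ++ d.world.log)).sum := by
      intro p hp'
      rw [partialLoss, hrun p t (h2 p hp'), List.map_map]
      congr 1
      refine List.map_congr_left fun d _ => ?_
      simp only [Function.comp_apply, Config.map, World.map, L]
      rw [selectedLoss_refund hp]
    simp only [Function.comp_def]
    refine (congrArg List.sum (List.map_congr_left h4)).trans ?_
    -- For each run from `c0`, the sum over the branches of the private count is now innermost and
    -- gives back the original squared norm by `h3`.
    rw [sum_sum_comm, partialLoss, hrun0, List.map_map]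
    congr 1
    refine List.map_congr_left fun d _ => ?_
    rw [List.sum_map_mul_right, h3]
    rfl
  -- There is at least one outcome, since the squared norm of a unit vector would otherwise be `0`.
  -- Halting and events can be read off from any one branch.
  · have hne : ops ≠ [] := by
      rintro rfl
      have := h3 (Finsupp.single ∅ 1)
      rw [normSq, Finsupp.sum_single_index (by simp)] at this
      simp at this
    obtain ⟨p, ops', rfl⟩ := List.exists_cons_of_ne_nil hne
    refine ⟨(p.1, ⟨w.next, p.2 w.ket, w.log⟩), by rw [h1]; simp, fun t => ⟨fun h => ?_, ?_⟩⟩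
    · rw [HaltsIn, hrun p t (h2 p (by simp)), List.forall_mem_map] at h
      rw [HaltsIn, hrun0, List.forall_mem_map]
      exact h
    · rw [hrun p t (h2 p (by simp)), hrun0, List.forall_mem_map]
      exact fun d hd => ⟨_, List.mem_map_of_mem hd, by simp [Config.map, World.map, L,
        Event.eraseRefund]⟩

/-- One step of the game compared with one step of the hybrid game. -/
theorem step_hybrid {c : Config GameOracle C Q} (hc : Sep ∅ c.world.next c.qu) :
    (∀ t, ((step (M.oracles lam sk) c).map fun d => partialLoss j (M.oracles lam sk) t d).sum =
      ((step (M.hybrid lam sk j) c).map fun d => partialLoss j (M.oracles lam sk) t d).sum) ∧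
    ∀ d ∈ step (M.hybrid lam sk j) c, ∃ d' ∈ step (M.oracles lam sk) c, ∀ t,
      (HaltsIn (M.oracles lam sk) t d' → HaltsIn (M.oracles lam sk) t d) ∧
      ∀ e ∈ run (M.oracles lam sk) t d, ∃ e' ∈ run (M.oracles lam sk) t d',
        e.world.log.map Event.eraseRefund = e'.world.log.map Event.eraseRefund := by
  -- The two games differ only in payments that are not selected.
  have key : step (M.oracles lam sk) c = step (M.hybrid lam sk j) c ∨
      ∃ q x k, c.cont = .call .pay q x :: k ∧ position (some j) c.world.log ≠ some 0 := by
    obtain ⟨cont, cl, qu, w⟩ := c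
    rcases cont with _ | ⟨a, k⟩
    · exact Or.inl rfl
    cases a with
    | call o q x =>
      cases o with
      | mint => exact Or.inl rfl
      | privVerify => exact Or.inl rfl
      | pay =>
        by_cases hp : position (some j) w.log = some 0
        · exact Or.inl (by simp [step, hybrid, hp])
        · exact Or.inr ⟨q, x, k, rfl, hp⟩
    | _ => exact Or.inl rfl
  rcases key with key | ⟨q, x, k, hk, hp⟩
  · rw [key]
    exact ⟨fun _ => rfl, fun d hd => ⟨d, hd, fun t => ⟨_root_.id, fun e he => ⟨e, he, rfl⟩⟩⟩⟩
  obtain ⟨cont, cl, qu, w⟩ := c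
  subst hk
  simp only at hp hc
  obtain ⟨h1, h2, h3, h4, h5⟩ := M.pay_coins lam (m := (cl x).length) (hc.nodup q) (hc.lt q)
  simp only [step, hybrid, if_neg hp, oracles, receive, List.map_flatMap, List.map_map]
  set T := takeQubits ((cl x).length * M.coinLen lam) (qu q) w with hT
  have hqu : Sep {u | u ∈ T.1} T.2.2.next (Function.update qu q T.2.1) := by
    have h := (hc.take ((cl x).length * M.coinLen lam) q).remove (q := q)
      (Function.update_self _ _ _)
    rw [Function.update_idem] at h
    exact h.subset Set.subset_union_right
  -- The names that the adversary keeps. The verifier never obtains them, so its final wallet is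
  -- disjoint from everything that is used later.
  let A : Set ℕ := {u | ∃ r, u ∈ Function.update qu q T.2.1 r}
  have hA := M.fresh_sep lam sk (S := A ∪ {u | u ∈ (blocks (M.coinLen lam) (cl x).length
    T.1).flatten}) (M.verifier lam) (w := T.2.2) (by
      rw [h1]
      rintro u (⟨r, hr⟩ | hu)
      · exact hqu.lt r u hr
      · exact (h4 u hu).1) (M.coinLen lam)
  have hcA : ∀ u ∈ (blocks (M.coinLen lam) (cl x).length T.1).flatten, u ∉ A := by
    rw [h1]
    exact fun u hu ⟨r, hr⟩ => hqu.avoid r u hr hu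
  have main : ∀ r ∈ (M.verifier lam).count (blocks (M.coinLen lam) (cl x).length T.1)
      ((M.verifier lam).fresh lam (M.coinLen lam) (M.mint lam sk T.2.2).1)
      (M.mint lam sk T.2.2).2,
      Sep {u | u ∈ r.2.1.qu (M.verifier lam).wallet} r.2.2.next (Function.update qu q T.2.1) ∧
      (r.2.1.qu (M.verifier lam).wallet).Nodup ∧ position (some j) r.2.2.log ≠ some 0 := by
    intro r hr
    obtain ⟨h6, h7⟩ := PublicVerifier.count_sep _ hA h2 hcA hr
    refine ⟨⟨hqu.nodup, fun q' u hu => (hqu.lt q' u hu).trans_le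
      ((Nat.le_add_right _ _).trans h7), fun q' u hu hu' => h6.avoid _ u hu' ⟨q', hu⟩, hqu.disj,
      h6.lt _⟩, h6.nodup _, ?_⟩
    rwa [PublicVerifier.count_log _ (hA.subset (Set.union_subset_union_left _
      (Set.empty_subset _))) h2 hr]
  constructor
  · intro t
    rw [List.flatMap, List.sum_flatten, List.map_map]
    congr 1
    refine List.map_congr_left fun r hr => ?_
    obtain ⟨h6, h7, h8⟩ := main r hr
    simp only [Function.comp_def, length_blocks]
    exact (M.discard_privCount lam sk j k _ _ r.2.2 h6 (fun c hc => (M.wallet_blocks lam _ hc).1)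
      (fun c hc => (M.wallet_blocks lam _ hc).2.nodup h7)
      (fun c hc u hu => (M.wallet_blocks lam _ hc).2.subset hu) h8 _ _).1 t
  · intro d hd
    obtain ⟨r, hr, rfl⟩ := List.mem_map.1 hd
    obtain ⟨h6, h7, h8⟩ := main r hr
    obtain ⟨u, hu, h⟩ := (M.discard_privCount lam sk j k
      (Function.update cl x (List.replicate r.1 true)) _ r.2.2 h6
      (fun c hc => (M.wallet_blocks lam _ hc).1)
      (fun c hc => (M.wallet_blocks lam _ hc).2.nodup h7)
      (fun c hc u hu => (M.wallet_blocks lam _ hc).2.subset hu) h8 (cl x).length r.1).2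
    refine ⟨_, List.mem_flatMap.2 ⟨r, hr, List.mem_map.2 ⟨u, hu, rfl⟩⟩, ?_⟩
    simpa only [Function.comp_def, length_blocks] using h

/-- The hybrid game halts if the game does, with the same expected loss in the selected payment
and the same events up to refunds. -/
theorem run_hybrid (t : ℕ) {c : Config GameOracle C Q} (hc : Sep ∅ c.world.next c.qu)
    (h : HaltsIn (M.oracles lam sk) t c) :
    HaltsIn (M.hybrid lam sk j) t c ∧
      partialLoss j (M.hybrid lam sk j) t c = partialLoss j (M.oracles lam sk) t c ∧
      ∀ d ∈ run (M.hybrid lam sk j) t c, ∃ d' ∈ run (M.oracles lam sk) t c,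
        d.world.log.map Event.eraseRefund = d'.world.log.map Event.eraseRefund := by
  induction t generalizing c with
  | zero => exact ⟨h, rfl, fun d hd => ⟨d, hd, rfl⟩⟩
  | succ t ih =>
    obtain ⟨h1, h2⟩ := M.step_hybrid lam sk j hc
    rw [haltsIn_succ] at h
    have ih' : ∀ d ∈ step (M.hybrid lam sk j) c, _ := fun d hd =>
      ih (step_sep (M.respectsNames_hybrid lam sk j) hc hd).1 (by
        obtain ⟨d', hd', h'⟩ := h2 d hd
        exact (h' t).1 (h d' hd'))
    refine ⟨haltsIn_succ.2 fun d hd => (ih' d hd).1, ?_, fun e he => ?_⟩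
    -- `h1` exchanges the oracles for the first step alone, with the real game afterwards; the
    -- induction hypothesis exchanges them in the remaining steps.
    · rw [partialLoss_succ, partialLoss_succ, h1 t]
      congr 1
      exact List.map_congr_left fun d hd => (ih' d hd).2.1
    · obtain ⟨d, hd, he⟩ := List.mem_flatMap.1 he
      obtain ⟨e', he', h3⟩ := (ih' d hd).2.2 e he
      obtain ⟨d', hd', h'⟩ := h2 d hd
      obtain ⟨e'', he'', h4⟩ := (h' t).2 e' he'
      exact ⟨e'', List.mem_flatMap.2 ⟨d', hd', he''⟩, h3.trans h4⟩

end Discard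

end CoinScheme

/-! ### Halting of the public verification -/

/-- Starting from the memory `s`, the verification of each further coin halts within the time
bound `T`, which depends on the number of coins received meanwhile. -/
def PublicVerifier.KeepsHalting (V : PublicVerifier) (l : ℕ) (T : ℕ → ℕ) (s : V.Memory)
    (w : World) : Prop :=
  ∀ (coins : List (List ℕ)) (hs : List ℕ), (∀ c ∈ coins, c.length = l) → hs.length = l →
    ∀ r ∈ V.count coins s w, HaltsIn noOracles (T coins.length) (V.load r.2.1 r.2.2 hs)

theorem PublicVerifier.RunsIn.keepsHalting {V : PublicVerifier} {lam l : ℕ} {T : ℕ → ℕ}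
    (h : V.RunsIn lam l T) {first : List ℕ} (hf : first.length = l) (w : World) :
    V.KeepsHalting l T (V.fresh lam l first) w :=
  fun coins hs hc hl => h w first coins hs hf hc hl

theorem PublicVerifier.KeepsHalting.halts {V : PublicVerifier} {l : ℕ} {T : ℕ → ℕ}
    {s : V.Memory} {w : World} (h : V.KeepsHalting l T s w) {hs : List ℕ} (hl : hs.length = l) :
    HaltsIn noOracles (T 0) (V.load s w hs) :=
  h [] hs (by simp) hl (0, s, w) (by simp [PublicVerifier.count])

/-- The bound is shifted since one more coin has been received; in this form it can be used in
inductions over the remaining coins. -/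
theorem PublicVerifier.KeepsHalting.next {V : PublicVerifier} {l : ℕ} {T : ℕ → ℕ}
    {s : V.Memory} {w : World} (h : V.KeepsHalting l T s w) {hs : List ℕ} (hl : hs.length = l)
    {r : Bool × V.Memory × World} (hr : r ∈ V.verify s w hs) :
    V.KeepsHalting l (fun n => T (n + 1)) r.2.1 r.2.2 := by
  intro coins hs' hc hl' u hu
  refine h (hs :: coins) hs' (by simpa using ⟨hl, hc⟩) hl' ((if r.1 then 1 else 0) + u.1, u.2) ?_
  simp only [PublicVerifier.count, List.mem_flatMap, List.mem_map]
  exact ⟨r, hr, u, hu, rfl⟩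

/-! ### Dependence on the key -/

section Families

variable {K : Type} [MeasurableSpace K]

/-- Bounded measurable functions of the key. -/
def BoundedMeasurable (a : K → ℂ) : Prop := Measurable a ∧ ∃ C : ℝ, ∀ k, ‖a k‖ ≤ C

theorem BoundedMeasurable.const (c : ℂ) : BoundedMeasurable fun _ : K => c :=
  ⟨measurable_const, ‖c‖, fun _ => le_rfl⟩

theorem BoundedMeasurable.add {a b : K → ℂ} (ha : BoundedMeasurable a)
    (hb : BoundedMeasurable b) : BoundedMeasurable fun k => a k + b k := by
  obtain ⟨ha, C, hC⟩ := ha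
  obtain ⟨hb, D, hD⟩ := hb
  exact ⟨ha.add hb, C + D, fun k => (norm_add_le _ _).trans (add_le_add (hC k) (hD k))⟩

theorem BoundedMeasurable.mul {a b : K → ℂ} (ha : BoundedMeasurable a)
    (hb : BoundedMeasurable b) : BoundedMeasurable fun k => a k * b k := by
  obtain ⟨ha, C, hC⟩ := ha
  obtain ⟨hb, D, hD⟩ := hb
  exact ⟨ha.mul hb, C * D, fun k => (norm_mul_le _ _).trans
    (mul_le_mul (hC k) (hD k) (norm_nonneg _) ((norm_nonneg _).trans (hC k)))⟩

/-- States that depend on the key in a bounded measurable way. -/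
def KetFamily (κ : K → Ket) : Prop :=
  ∃ B : Finset (Finset ℕ), (∀ k, (κ k).support ⊆ B) ∧ ∀ s, BoundedMeasurable fun k => κ k s

theorem KetFamily.const (ψ : Ket) : KetFamily fun _ : K => ψ :=
  ⟨ψ.support, fun _ => subset_rfl, fun _ => .const _⟩

theorem KetFamily.single (s : Finset ℕ) {a : K → ℂ} (ha : BoundedMeasurable a) :
    KetFamily fun k => Finsupp.single s (a k) := by
  refine ⟨{s}, fun k => Finsupp.support_single_subset, fun t => ?_⟩
  by_cases h : s = t
  · simpa [h] using ha
  · simpa [Finsupp.single_apply, h] using BoundedMeasurable.const 0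

theorem KetFamily.add {κ κ' : K → Ket} (h : KetFamily κ) (h' : KetFamily κ') :
    KetFamily fun k => κ k + κ' k := by
  classical
  obtain ⟨B, h1, h2⟩ := h
  obtain ⟨B', h1', h2'⟩ := h'
  exact ⟨B ∪ B', fun k => Finsupp.support_add.trans (Finset.union_subset_union (h1 k) (h1' k)),
    fun s => (h2 s).add (h2' s)⟩

theorem KetFamily.sum {ι : Type*} (I : Finset ι) {κ : ι → K → Ket}
    (h : ∀ i ∈ I, KetFamily (κ i)) : KetFamily fun k => ∑ i ∈ I, κ i k := by
  classical
  induction I using Finset.induction_on with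
  | empty => simpa using KetFamily.const 0
  | insert i I hi ih =>
    simp only [Finset.sum_insert hi]
    exact (h i (Finset.mem_insert_self _ _)).add
      (ih fun j hj => h j (Finset.mem_insert_of_mem hj))

theorem KetFamily.applyOp {n : ℕ} {A : K → Matrix (Bits n) (Bits n) ℂ} {κ : K → Ket}
    (hA : ∀ a b, BoundedMeasurable fun k => A k a b) (hs : List ℕ) (h : KetFamily κ) :
    KetFamily fun k => applyOp (A k) hs (κ k) := by
  obtain ⟨B, h1, h2⟩ := h
  have : (fun k => QCoin.applyOp (A k) hs (κ k)) = fun k => ∑ s ∈ B, ∑ b : Bits n,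
      Finsupp.single (writeBits hs s b) (A k b (readBits n hs s) * κ k s) := by
    funext k
    exact Finsupp.sum_of_support_subset _ (h1 k) _ (by simp)
  rw [this]
  exact KetFamily.sum _ fun s _ => KetFamily.sum _ fun b _ =>
    KetFamily.single _ ((hA _ _).mul (h2 s))

theorem KetFamily.integrable_normSq {κ : K → Ket} (h : KetFamily κ)
    (μ : MeasureTheory.Measure K) [MeasureTheory.IsFiniteMeasure μ] :
    MeasureTheory.Integrable (fun k => normSq (κ k)) μ := by
  obtain ⟨B, h1, h2⟩ := h
  simp only [normSq_eq_sum (h1 _)]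
  refine MeasureTheory.integrable_finsetSum _ fun s _ => ?_
  obtain ⟨hm, C, hC⟩ := h2 s
  refine MeasureTheory.Integrable.of_bound (hm.norm.pow_const 2).aestronglyMeasurable (C ^ 2)
    (Filter.Eventually.of_forall fun k => ?_)
  rw [Real.norm_of_nonneg (by positivity)]
  exact pow_le_pow_left₀ (norm_nonneg _) (hC k) 2

/-- A list that depends on the key only through its entries, which belong to `P`. -/
def ListFamily {K α : Type*} (P : (K → α) → Prop) (F : K → List α) : Prop :=
  ∃ L : List (K → α), (∀ c ∈ L, P c) ∧ ∀ k, F k = L.map fun c => c k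

theorem ListFamily.map_list {K α ι : Type*} {P : (K → α) → Prop} (I : List ι) {f : K → ι → α}
    (h : ∀ i ∈ I, P fun k => f k i) : ListFamily P fun k => I.map (f k) := by
  refine ⟨I.map fun i k => f k i, fun c hc => ?_, fun k => by simp [Function.comp_def]⟩
  obtain ⟨i, hi, rfl⟩ := List.mem_map.1 hc
  exact h i hi

theorem ListFamily.singleton {K α : Type*} {P : (K → α) → Prop} {c : K → α} (h : P c) :
    ListFamily P fun k => [c k] := ⟨[c], by simpa using h, fun _ => rfl⟩

theorem ListFamily.map {K α β : Type*} {P : (K → α) → Prop} {P' : (K → β) → Prop}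
    {F : K → List α} {g : K → α → β} (hF : ListFamily P F)
    (h : ∀ c, P c → P' fun k => g k (c k)) : ListFamily P' fun k => (F k).map (g k) := by
  obtain ⟨L, h1, h2⟩ := hF
  refine ⟨L.map fun c k => g k (c k), fun c hc => ?_, fun k => by simp [h2, Function.comp_def]⟩
  obtain ⟨c, hcL, rfl⟩ := List.mem_map.1 hc
  exact h c (h1 c hcL)

/-- That `c k` occurs in `F k` is handed to the continuation, which may need to know that the branch
is reached, for instance in order to halt. -/
theorem ListFamily.flatMap {K α β : Type*} {P : (K → α) → Prop} {P' : (K → β) → Prop}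
    {F : K → List α} {g : K → α → List β} (hF : ListFamily P F)
    (h : ∀ c, P c → (∀ k, c k ∈ F k) → ListFamily P' fun k => g k (c k)) :
    ListFamily P' fun k => (F k).flatMap (g k) := by
  obtain ⟨L, h1, h2⟩ := hF
  -- A list is provided for every `c`, so that it can be chosen as a function; outside `L` it plays
  -- no role.
  have h' : ∀ c : K → α, ∃ Lc : List (K → β), c ∈ L →
      (∀ d ∈ Lc, P' d) ∧ ∀ k, g k (c k) = Lc.map fun d => d k := by
    intro c
    by_cases hc : c ∈ L
    · obtain ⟨Lc, h3⟩ := h c (h1 c hc) fun k => h2 k ▸ List.mem_map_of_mem hc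
      exact ⟨Lc, fun _ => h3⟩
    · exact ⟨[], fun h => absurd h hc⟩
  choose Lc hLc using h'
  refine ⟨L.flatMap Lc, fun d hd => ?_, fun k => ?_⟩
  · obtain ⟨c, hc, hd⟩ := List.mem_flatMap.1 hd
    exact (hLc c hc).1 d hd
  · simp only [h2, List.flatMap_map, List.map_flatMap]
    exact List.flatMap_congr fun c hc => (hLc c hc).2 k

/-- Worlds in which only the state of the memory depends on the key. -/
def WorldFamily (w : K → World) : Prop :=
  ∃ n κ L, KetFamily κ ∧ w = fun k => ⟨n, κ k, L⟩

/-- Results in which only the state of the memory depends on the key. -/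
def ResultFamily {β : Type} (r : K → β × World) : Prop :=
  ∃ b w, WorldFamily w ∧ r = fun k => (b, w k)

/-- Results in which only the state of the memory depends on the key. -/
def ResultFamily₂ {β γ : Type} (r : K → β × γ × World) : Prop :=
  ∃ b c w, WorldFamily w ∧ r = fun k => (b, c, w k)

/-- Configurations in which only the state of the memory depends on the key. -/
def ConfigFamily {O C Q : Type} (c : K → Config O C Q) : Prop :=
  ∃ cont cl qu w, WorldFamily w ∧ c = fun k => ⟨cont, cl, qu, w k⟩

theorem WorldFamily.takeQubits {w : K → World} (hw : WorldFamily w) (n : ℕ) (l : List ℕ) :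
    ∃ (a b : List ℕ) (w' : K → World), WorldFamily w' ∧
      (fun k => QCoin.takeQubits n l (w k)) = (fun k => (a, b, w' k)) ∧ a.length = n := by
  obtain ⟨m, κ, L, hκ, rfl⟩ := hw
  exact ⟨(QCoin.takeQubits n l ⟨m, 0, L⟩).1, (QCoin.takeQubits n l ⟨m, 0, L⟩).2.1, _,
    ⟨(QCoin.takeQubits n l ⟨m, 0, L⟩).2.2.next, κ, L, hκ, rfl⟩, rfl, takeQubits_length _ _ _⟩

theorem WorldFamily.append_log {w : K → World} (hw : WorldFamily w) (e : List Event) :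
    WorldFamily fun k => { w k with log := (w k).log ++ e } := by
  obtain ⟨m, κ, L, hκ, rfl⟩ := hw
  exact ⟨m, κ, L ++ e, hκ, rfl⟩

theorem WorldFamily.run {n m : ℕ} {res : Fin m → Bool}
    {A : K → Fin m → Matrix (Bits n) (Bits n) ℂ} {hc : ∀ k, ∑ i, (A k i)ᴴ * A k i = 1}
    (hA : ∀ i a b, BoundedMeasurable fun k => A k i a b) {w : K → World} (hw : WorldFamily w)
    (hs : List ℕ) :
    ListFamily ResultFamily fun k => (Instrument.mk m (A k) res (hc k)).run hs (w k) := by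
  obtain ⟨N, κ, L, hκ, rfl⟩ := hw
  refine ListFamily.map_list (P := ResultFamily) (List.finRange m)
    (f := fun k i => (res i, ⟨N, applyOp (A k i) hs (κ k), L⟩)) fun i _ => ?_
  exact ⟨_, _, ⟨N, _, L, hκ.applyOp (hA i) hs, rfl⟩, rfl⟩

/-- Oracles for which only the state of the memory depends on the key. -/
def OracleFamily {O : Type} (orc : K → Oracles O) : Prop :=
  ∀ o q x w, WorldFamily w → ListFamily ResultFamily₂ fun k => orc k o q x (w k)

/-- States are not normalised and branches of probability zero are kept, so the branching is given
by classical data that do not involve the key. -/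
theorem step_family {O C Q : Type} [DecidableEq C] [DecidableEq Q] {orc : K → Oracles O}
    (ho : OracleFamily orc) {c : K → Config O C Q} (hc : ConfigFamily c) :
    ListFamily ConfigFamily fun k => step (orc k) (c k) := by
  obtain ⟨cont, cl, qu, w, hw, rfl⟩ := hc
  rcases cont with _ | ⟨a, k⟩
  · exact .singleton ⟨_, _, _, w, hw, rfl⟩
  cases a with
  | skip | seq | push | pop | clear | discard =>
    dsimp only [step]
    exact .singleton ⟨_, _, _, w, hw, rfl⟩
  | branch x a b e =>
    rcases h : cl x with _ | ⟨_ | _, _⟩ <;> simp only [step, h] <;>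
      exact .singleton ⟨_, _, _, w, hw, rfl⟩
  | loop x a =>
    rcases h : cl x with _ | ⟨_, _⟩ <;> simp only [step, h] <;>
      exact .singleton ⟨_, _, _, w, hw, rfl⟩
  | move q r =>
    obtain ⟨a, b, w', hw', he, -⟩ := WorldFamily.takeQubits hw 1 (qu q)
    simp only [step, fun k => congrFun he k]
    exact .singleton ⟨_, _, _, w', hw', rfl⟩
  | gate g y q x =>
    obtain ⟨a, b, w', hw', he, -⟩ := WorldFamily.takeQubits hw (g (cl y).length).1 (qu q)
    simp only [step, fun k => congrFun he k]
    refine ListFamily.map (hw'.run (A := fun _ => (g (cl y).length).2.kraus)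
      (res := (g (cl y).length).2.result) (hc := fun _ => (g (cl y).length).2.complete)
      (fun i a b => .const _) a) ?_
    rintro _ ⟨b, w'', hw'', rfl⟩
    dsimp only
    exact ⟨_, _, _, w'', hw'', rfl⟩
  | call o q x =>
    refine ListFamily.map (ho o (qu q) (cl x) w hw) ?_
    rintro _ ⟨b, c, w'', hw'', rfl⟩
    dsimp only
    exact ⟨_, _, _, w'', hw'', rfl⟩

theorem run_family {O C Q : Type} [DecidableEq C] [DecidableEq Q] {orc : K → Oracles O}
    (ho : OracleFamily orc) (t : ℕ) {c : K → Config O C Q} (hc : ConfigFamily c) :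
    ListFamily ConfigFamily fun k => run (orc k) t (c k) := by
  induction t generalizing c with
  | zero => exact .singleton hc
  | succ t ih => exact (step_family ho hc).flatMap fun d hd _ => ih hd

/-- The least halting time inside `exec` could vary with the key; the common bound `t` replaces it
by one run length for all keys. -/
theorem verify_family (V : PublicVerifier) {s : V.Memory} {w : K → World} {hs : List ℕ} {t : ℕ}
    (hw : WorldFamily w) (ht : ∀ k, HaltsIn noOracles t (V.load s (w k) hs)) :
    ListFamily ResultFamily₂ fun k => V.verify s (w k) hs := by
  simp only [PublicVerifier.verify, (ht _).exec_eq]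
  refine ListFamily.map (run_family (orc := fun _ => noOracles) (fun o => o.elim) t
    (c := fun k => V.load s (w k) hs) ⟨_, _, _, w, hw, rfl⟩) ?_
  rintro _ ⟨_, cl, _, w', hw', rfl⟩
  dsimp only
  exact ⟨decide ((cl V.answer).head? = some true), _, w', hw', rfl⟩

theorem count_family (V : PublicVerifier) {l : ℕ} {T : ℕ → ℕ} {coins : List (List ℕ)}
    (hl : ∀ c ∈ coins, c.length = l) {s : V.Memory} {w : K → World} (hw : WorldFamily w)
    (hT : ∀ k, V.KeepsHalting l T s (w k)) :
    ListFamily ResultFamily₂ fun k => V.count coins s (w k) := by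
  induction coins generalizing s w T with
  | nil => exact .singleton ⟨_, _, w, hw, rfl⟩
  | cons hs rest ih =>
    simp only [List.mem_cons, forall_eq_or_imp] at hl
    refine ListFamily.flatMap (verify_family V hw fun k => (hT k).halts hl.1) ?_
    rintro _ ⟨b, s', w', hw', rfl⟩ hmem
    refine ListFamily.map (ih hl.2 hw' fun k => (hT k).next hl.1 (hmem k)) ?_
    rintro _ ⟨a, _, w'', hw'', rfl⟩
    dsimp only
    exact ⟨(if b then 1 else 0) + a, _, w'', hw'', rfl⟩

end Families

/-! ### The game as a function of the key -/

namespace CoinScheme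

variable (M : CoinScheme) (lam : ℕ)

theorem boundedMeasurable_coin (b : Bits (M.coinLen lam)) :
    BoundedMeasurable fun sk => M.coin lam sk b := by
  refine ⟨M.coin_measurable lam b, 1, fun sk => ?_⟩
  have h : ‖M.coin lam sk b‖ ^ 2 ≤ 1 := by
    rw [← M.coin_norm lam sk]
    exact Finset.single_le_sum (f := fun b => ‖M.coin lam sk b‖ ^ 2) (fun _ _ => by positivity)
      (Finset.mem_univ b)
  exact (sq_le_one_iff₀ (norm_nonneg _)).1 h

/-- The diagonal entry at `b` of the completeness relation says that the squared moduli of the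
entries in column `b`, over all Kraus operators, sum to one. -/
theorem boundedMeasurable_privKraus (i : Fin (M.privBranches lam))
    (a b : Bits (M.coinLen lam)) : BoundedMeasurable fun sk => M.privKraus lam sk i a b := by
  refine ⟨M.priv_measurable lam i a b, 1, fun sk => ?_⟩
  have h : ∑ i, ∑ a, ‖M.privKraus lam sk i a b‖ ^ 2 = 1 := by
    have h1 := congrFun (congrFun (M.priv_complete lam sk) b) b
    rw [Matrix.sum_apply, Matrix.one_apply_eq] at h1
    simp only [Matrix.mul_apply, Matrix.conjTranspose_apply, RCLike.star_def,
      Complex.conj_mul'] at h1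
    exact_mod_cast h1
  refine (sq_le_one_iff₀ (norm_nonneg _)).1 ?_
  rw [← h]
  exact (Finset.single_le_sum (f := fun a => ‖M.privKraus lam sk i a b‖ ^ 2)
    (fun _ _ => by positivity) (Finset.mem_univ a)).trans
    (Finset.single_le_sum (f := fun i => ∑ a, ‖M.privKraus lam sk i a b‖ ^ 2)
    (fun _ _ => by positivity) (Finset.mem_univ i))

theorem mint_family {w : M.Key lam → World} (hw : WorldFamily w) :
    ResultFamily fun sk => M.mint lam sk (w sk) := by
  obtain ⟨n, κ, L, hκ, rfl⟩ := hw
  dsimp only [mint]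
  exact ⟨_, _, ⟨_, _, L, hκ.applyOp
    (A := fun sk => Matrix.of fun b _ => M.coin lam sk b)
    (fun a _ => M.boundedMeasurable_coin lam a) _, rfl⟩, rfl⟩

theorem privVerify_family {w : M.Key lam → World} (hw : WorldFamily w) (hs : List ℕ) :
    ListFamily ResultFamily fun sk => (M.privVerify lam sk).run hs (w sk) :=
  hw.run (A := fun sk => M.privKraus lam sk) (hc := M.priv_complete lam)
    (fun i a b => M.boundedMeasurable_privKraus lam i a b) hs

theorem privCount_family (coins : List (List ℕ)) {w : M.Key lam → World} (hw : WorldFamily w) :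
    ListFamily ResultFamily fun sk => M.privCount lam sk coins (w sk) := by
  induction coins generalizing w with
  | nil => exact .singleton ⟨_, w, hw, rfl⟩
  | cons hs rest ih =>
    refine ListFamily.flatMap (M.privVerify_family lam hw hs) ?_
    rintro _ ⟨b, w', hw', rfl⟩ -
    refine ListFamily.map (ih hw') ?_
    rintro _ ⟨a, w'', hw'', rfl⟩
    dsimp only
    exact ⟨(if b then 1 else 0) + a, w'', hw'', rfl⟩

theorem receive_family {coins : List (List ℕ)} (hl : ∀ c ∈ coins, c.length = M.coinLen lam)
    {w : M.Key lam → World} (hw : WorldFamily w) :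
    ListFamily ResultFamily fun sk => M.receive lam sk coins (w sk) := by
  obtain ⟨T, hT⟩ := M.verifier_halts lam
  obtain ⟨a, w', hw', he⟩ := M.mint_family lam hw
  simp only [receive, fun sk => congrFun he sk]
  have ha : ∀ sk, a.length = M.coinLen lam := fun sk => by
    rw [← M.mint_length lam sk (w sk), congrFun he sk]
  refine ListFamily.flatMap (count_family _ hl hw' fun sk => hT.keepsHalting (ha sk) _) ?_
  rintro _ ⟨b, s, w'', hw'', rfl⟩ -
  dsimp only
  refine ListFamily.map (M.privCount_family lam _ hw'') ?_
  rintro _ ⟨u, w3, hw3, rfl⟩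
  dsimp only
  exact ⟨_, _, hw3.append_log _, rfl⟩

theorem oracleFamily_oracles : OracleFamily (M.oracles lam) := by
  intro o q x w hw
  cases o with
  | mint =>
    obtain ⟨a, w', hw', he⟩ := M.mint_family lam hw
    simp only [oracles, fun sk => congrFun he sk]
    exact .singleton ⟨_, _, _, hw'.append_log _, rfl⟩
  | privVerify =>
    obtain ⟨a, b, w', hw', he, -⟩ := WorldFamily.takeQubits hw (M.coinLen lam) q
    simp only [oracles, fun k => congrFun he k]
    refine ListFamily.map (M.privVerify_family lam hw' a) ?_
    rintro _ ⟨b, w'', hw'', rfl⟩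
    dsimp only
    exact ⟨_, _, _, hw''.append_log _, rfl⟩
  | pay =>
    obtain ⟨a, b, w', hw', he, ha⟩ := WorldFamily.takeQubits hw (x.length * M.coinLen lam) q
    simp only [oracles, fun k => congrFun he k]
    refine ListFamily.map (M.receive_family lam (fun c hc =>
      length_of_mem_blocks ha.ge hc) hw') ?_
    rintro _ ⟨b, w'', hw'', rfl⟩
    dsimp only
    exact ⟨_, _, _, hw'', rfl⟩

/-- Expectations over the runs of a game depend on the key in an integrable way. -/
theorem integrable_run {C Q : Type} [DecidableEq C] [DecidableEq Q] (t : ℕ)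
    (c : Config GameOracle C Q) (g : List Event → ℝ) :
    MeasureTheory.Integrable (fun sk => ((run (M.oracles lam sk) t c).map fun d =>
      normSq d.world.ket * g d.world.log).sum) (M.keyGen lam) := by
  obtain ⟨L, h1, h2⟩ := run_family (M.oracleFamily_oracles lam) t (c := fun _ => c)
    ⟨_, _, _, _, ⟨_, _, _, .const c.world.ket, rfl⟩, rfl⟩
  simp only [h2, List.map_map]
  clear h2
  induction L with
  | nil => simp
  | cons d L ih =>
    simp only [List.mem_cons, forall_eq_or_imp] at h1
    simp only [List.map_cons, List.sum_cons]
    refine MeasureTheory.Integrable.add ?_ (ih h1.2)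
    obtain ⟨_, _, _, _, ⟨n, κ, l, hκ, rfl⟩, rfl⟩ := h1.1
    exact (hκ.integrable_normSq (M.keyGen lam)).mul_const (g l)

end CoinScheme

/-! ### Subroutines -/

theorem replicate_append_cons_self {α : Type*} (n : ℕ) (a : α) (l : List α) :
    List.replicate n a ++ a :: l = List.replicate (n + 1) a ++ l := by
  rw [List.replicate_succ', List.append_assoc, List.singleton_append]

section Subroutines

variable {O C Q : Type}

/-- Moves the contents of `s` to `y`, in unary. -/
def Cmd.transfer (s y : C) : Cmd O C Q := .loop s (.seq (.pop s) (.push y true))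

/-- Copies the unary contents of `s` to `y`, with the auxiliary stack `z`. -/
def Cmd.copy (s z y : C) : Cmd O C Q :=
  .seq (.loop s (.seq (.pop s) (.seq (.push z true) (.push y true)))) (.transfer z s)

/-- Moves as many qubits from `q` to `r` as `x` says. -/
def Cmd.moveQubits (x : C) (q r : Q) : Cmd O C Q := .loop x (.seq (.pop x) (.move q r))

/-- Empties the classical stacks `xs`. -/
def Cmd.clearAll : List C → Cmd O C Q
  | [] => .skip
  | x :: xs => .seq (.clear x) (clearAll xs)

/-- Empties the stacks of qubits `qs`. -/
def Cmd.discardAll : List Q → Cmd O C Q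
  | [] => .skip
  | x :: xs => .seq (.discard x) (discardAll xs)

variable [DecidableEq C] [DecidableEq Q] {orc : Oracles O}

theorem Big.transfer {s y : C} (h : s ≠ y) {n : ℕ} {cl : C → List Bool} {qu : Q → List ℕ}
    {w : World} (hn : (cl s).length = n) : Big orc (4 * n + 1) (.transfer s y) ⟨cl, qu, w⟩
      [⟨Function.update (Function.update cl s []) y (List.replicate n true ++ cl y), qu, w⟩] := by
  induction n generalizing cl with
  | zero =>
    have hs : cl s = [] := List.length_eq_zero_iff.1 hn
    exact (Big.loop_nil (s := ⟨cl, qu, w⟩) hs).cast le_rfl (by simp [← hs])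
  | succ n ih =>
    have hne : cl s ≠ [] := by rintro h0; simp [h0] at hn
    refine Big.cast (Big.loop_cons_single (s := ⟨cl, qu, w⟩) hne (.seq_single (.pop s _) (.push y _
        _))
      (ih (by simp [h, hn]))) (by omega) ?_
    simp only [List.cons.injEq, Store.mk.injEq, and_true]
    funext z
    by_cases hz : z = y
    · subst hz
      simp [h.symm, replicate_append_cons_self]
    · by_cases hz' : z = s <;> simp [hz, hz', h]

/-- The loop empties `s` onto `z` and `y` at once, and `z` is then poured back. As only lengths
survive this, the contents of `s` have to be unary. -/
theorem Big.copy {s z y : C} (h1 : s ≠ z) (h2 : s ≠ y) (h3 : z ≠ y) {n : ℕ} {cl : C → List Bool}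
    {qu : Q → List ℕ} {w : World} (hn : cl s = List.replicate n true) (hz : cl z = []) :
    Big orc (10 * n + 3) (.copy s z y) ⟨cl, qu, w⟩
      [⟨Function.update cl y (List.replicate n true ++ cl y), qu, w⟩] := by
  have key : ∀ n (cl : C → List Bool), (cl s).length = n →
      Big orc (6 * n + 1) (.loop s (.seq (.pop s) (.seq (.push z true) (.push y true))))
        ⟨cl, qu, w⟩ [⟨Function.update (Function.update (Function.update cl s []) z
          (List.replicate n true ++ cl z)) y (List.replicate n true ++ cl y), qu, w⟩] := by
    intro n
    induction n with
    | zero =>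
      intro cl hn
      have hs : cl s = [] := List.length_eq_zero_iff.1 hn
      have hu : Function.update cl s [] = cl := by rw [← hs, Function.update_eq_self]
      exact (Big.loop_nil (s := ⟨cl, qu, w⟩) hs).cast le_rfl (by simp [hu])
    | succ n ih =>
      intro cl hn
      have hne : cl s ≠ [] := by rintro h0; simp [h0] at hn
      refine Big.cast (Big.loop_cons_single (s := ⟨cl, qu, w⟩) hne (.seq_single (.pop s _)
        (.seq_single (.push z _ _) (.push y _ _))) (ih _ (by simp [h1, h2, hn]))) (by omega) ?_
      simp only [List.cons.injEq, Store.mk.injEq, and_true]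
      funext u
      by_cases hu : u = y
      · subst hu
        simp [h2.symm, h3.symm, replicate_append_cons_self]
      · by_cases hu' : u = z
        · subst hu'
          simp [h1.symm, h3, replicate_append_cons_self]
        · by_cases hu'' : u = s <;> simp [hu, hu', hu'', h1, h2]
  refine Big.cast (Big.seq_single (key n cl (by simp [hn])) (Big.transfer h1.symm (n := n)
    (by simp [h3, hz]))) (by omega) ?_
  simp only [List.cons.injEq, Store.mk.injEq, and_true]
  funext u
  by_cases hu : u = s
  · subst hu
    simp [h1, h2, hn]
  · by_cases hu' : u = z
    · subst hu'
      simp [h3, hz, hu]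
    · by_cases hu'' : u = y <;> simp [hu, hu', hu'', h2.symm, h3.symm]

/-- Fresh names are consecutive, so taking qubits in two portions gives the same names as taking
them at once, even below the bottom of the stack. -/
theorem takeQubits_add (n m : ℕ) (l : List ℕ) (w : World) :
    takeQubits (n + m) l w =
      ((takeQubits n l w).1 ++
          (takeQubits m (takeQubits n l w).2.1 (takeQubits n l w).2.2).1,
        (takeQubits m (takeQubits n l w).2.1 (takeQubits n l w).2.2).2.1,
        (takeQubits m (takeQubits n l w).2.1 (takeQubits n l w).2.2).2.2) := by
  have hlen : (l ++ List.range' w.next (n - l.length)).length - n = l.length - n := by simp; omega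
  have hr : l ++ List.range' w.next (n + m - l.length) =
      (l ++ List.range' w.next (n - l.length)) ++
        List.range' (w.next + (n - l.length)) (m - (l.length - n)) := by
    rw [List.append_assoc, List.range'_append_1]
    congr 2
    omega
  have hle : n ≤ (l ++ List.range' w.next (n - l.length)).length := by simp; omega
  simp only [takeQubits, List.length_drop, hlen, Prod.mk.injEq]
  refine ⟨?_, ?_, ?_⟩
  · rw [hr, List.take_add, List.take_append_of_le_length hle, List.drop_append_of_le_length hle]
  · rw [hr, ← List.drop_drop, List.drop_append_of_le_length hle]
  · congr 1
    omega

theorem takeQubits_of_le {n : ℕ} {l : List ℕ} (h : n ≤ l.length) (w : World) :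
    takeQubits n l w = (l.take n, l.drop n, w) := by
  simp [takeQubits, Nat.sub_eq_zero_of_le h]

theorem takeQubits_zero (l : List ℕ) (w : World) : takeQubits 0 l w = ([], l, w) := by
  simp [takeQubits]

/-- Each qubit is put on top of the previous one, so the order is reversed; a second move restores
it. -/
theorem Big.moveQubits {x : C} {q r : Q} (h : q ≠ r) {n : ℕ} {cl : C → List Bool}
    {qu : Q → List ℕ} {w : World} (hn : (cl x).length = n) :
    Big orc (4 * n + 1) (.moveQubits x q r) ⟨cl, qu, w⟩
      [⟨Function.update cl x [], Function.update (Function.update qu q (takeQubits n (qu q) w).2.1)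
        r ((takeQubits n (qu q) w).1.reverse ++ qu r), (takeQubits n (qu q) w).2.2⟩] := by
  induction n generalizing cl qu w with
  | zero =>
    have hs : cl x = [] := List.length_eq_zero_iff.1 hn
    exact (Big.loop_nil (s := ⟨cl, qu, w⟩) hs).cast le_rfl (by simp [← hs, takeQubits_zero])
  | succ n ih =>
    have hne : cl x ≠ [] := by rintro h0; simp [h0] at hn
    have hm : ∀ s : Store C Q, Big orc 1 (.move q r) s [⟨s.cl, Function.update
        (Function.update s.qu q (takeQubits 1 (s.qu q) s.world).2.1) r
        ((takeQubits 1 (s.qu q) s.world).1 ++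
          Function.update s.qu q (takeQubits 1 (s.qu q) s.world).2.1 r),
        (takeQubits 1 (s.qu q) s.world).2.2⟩] := fun s => .of_step_eq fun _ => rfl
    refine Big.cast (Big.loop_cons_single (s := ⟨cl, qu, w⟩) hne (.seq_single (.pop x _) (hm _))
      (ih (by simp [hn]))) (by omega) ?_
    have h1 : ∀ l : List ℕ, l.length = 1 → l.reverse = l := fun l hl => by
      obtain ⟨a, rfl⟩ := List.length_eq_one_iff.1 hl
      rfl
    rw [Nat.add_comm n 1]
    simp only [List.cons.injEq, Store.mk.injEq, and_true]
    refine ⟨?_, ?_, ?_⟩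
    · simp
    · funext z
      by_cases hz : z = r
      · subst hz
        simp [h, h.symm, takeQubits_add 1 n (qu q) w, h1 _ (takeQubits_length 1 (qu q) w)]
      · by_cases hz' : z = q
        · subst hz'
          simp [hz, takeQubits_add 1 n (qu z) w]
        · simp [hz, hz']
    · simp [h, takeQubits_add 1 n (qu q) w]

theorem Big.clearAll (xs : List C) (s : Store C Q) :
    Big orc (2 * xs.length + 1) (.clearAll xs) s
      [⟨fun x => if x ∈ xs then [] else s.cl x, s.qu, s.world⟩] := by
  induction xs generalizing s with
  | nil => exact .skip s
  | cons x xs ih =>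
    refine Big.cast (Big.seq_single (.clear x s) (ih _)) (by simp; omega) ?_
    simp only [List.cons.injEq, Store.mk.injEq, and_true]
    funext y
    by_cases h : y = x
    · subst h
      simp
    · simp [h]

theorem Big.discardAll (qs : List Q) (s : Store C Q) :
    Big orc (2 * qs.length + 1) (.discardAll qs) s
      [⟨s.cl, fun q => if q ∈ qs then [] else s.qu q, s.world⟩] := by
  induction qs generalizing s with
  | nil => exact .skip s
  | cons x xs ih =>
    refine Big.cast (Big.seq_single (.discard x s) (ih _)) (by simp; omega) ?_
    simp only [List.cons.injEq, Store.mk.injEq, and_true, true_and]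
    funext y
    by_cases h : y = x
    · subst h
      simp
    · simp [h]

end Subroutines

/-! ### Stacks that a program leaves alone -/

section Frame

variable {O C Q : Type}

/-- The classical stacks that occur in a program. -/
def Cmd.clStacks : Cmd O C Q → List C
  | .seq a b => a.clStacks ++ b.clStacks
  | .push x _ | .pop x | .clear x => [x]
  | .branch x a b e => x :: (a.clStacks ++ b.clStacks ++ e.clStacks)
  | .loop x a => x :: a.clStacks
  | .gate _ y _ x => [x, y]
  | .call _ _ x => [x]
  | _ => []

/-- The stacks of qubits that occur in a program. -/
def Cmd.quStacks : Cmd O C Q → List Q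
  | .seq a b => a.quStacks ++ b.quStacks
  | .branch _ a b e => a.quStacks ++ b.quStacks ++ e.quStacks
  | .loop _ a => a.quStacks
  | .move q r => [q, r]
  | .discard q => [q]
  | .gate _ _ q _ => [q]
  | .call _ q _ => [q]
  | _ => []

variable [DecidableEq C] [DecidableEq Q] {orc : Oracles O}

theorem step_frame {X : List C} {Y : List Q} {c d : Config O C Q}
    (hX : ∀ a ∈ c.cont, a.clStacks ⊆ X) (hY : ∀ a ∈ c.cont, a.quStacks ⊆ Y)
    (hd : d ∈ step orc c) :
    ((∀ a ∈ d.cont, a.clStacks ⊆ X) ∧ ∀ a ∈ d.cont, a.quStacks ⊆ Y) ∧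
      (∀ x, x ∉ X → d.cl x = c.cl x) ∧ ∀ q, q ∉ Y → d.qu q = c.qu q := by
  obtain ⟨cont, cl, qu, w⟩ := c
  rcases cont with _ | ⟨a, k⟩
  · simp only [step, List.mem_singleton] at hd
    subst hd
    exact ⟨⟨hX, hY⟩, fun _ _ => rfl, fun _ _ => rfl⟩
  have hcl : ∀ {x v}, x ∈ X → ∀ y, y ∉ X → Function.update cl x v y = cl y := fun hx y hy =>
    Function.update_of_ne (fun h => hy (by rwa [h])) _ _
  have hqu : ∀ {qu : Q → List ℕ} {x v}, x ∈ Y → ∀ y, y ∉ Y → Function.update qu x v y = qu y :=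
    fun hx y hy => Function.update_of_ne (fun h => hy (by rwa [h])) _ _
  cases a with
  | skip =>
    simp only [step, List.mem_singleton] at hd
    subst hd
    simp only [List.mem_cons, forall_eq_or_imp] at hX hY
    exact ⟨⟨hX.2, hY.2⟩, fun _ _ => rfl, fun _ _ => rfl⟩
  | seq a b =>
    simp only [step, List.mem_singleton] at hd
    subst hd
    simp only [List.mem_cons, forall_eq_or_imp, Cmd.clStacks, Cmd.quStacks,
      List.append_subset] at hX hY ⊢
    tauto
  | push x b | pop x | clear x =>
    simp only [step, List.mem_singleton] at hd
    subst hd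
    simp only [List.mem_cons, forall_eq_or_imp, Cmd.clStacks, List.cons_subset] at hX hY
    exact ⟨⟨hX.2, hY.2⟩, hcl hX.1.1, fun _ _ => rfl⟩
  | branch x a b e =>
    simp only [List.mem_cons, forall_eq_or_imp, Cmd.clStacks, Cmd.quStacks, List.cons_subset,
      List.append_subset] at hX hY
    rcases h : cl x with _ | ⟨_ | _, _⟩ <;> simp only [step, h, List.mem_singleton] at hd <;>
      subst hd <;> simp only [List.mem_cons, forall_eq_or_imp] <;> tauto
  | loop x a =>
    simp only [List.mem_cons, forall_eq_or_imp, Cmd.clStacks, Cmd.quStacks,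
      List.cons_subset] at hX hY
    rcases h : cl x with _ | ⟨_, _⟩ <;> simp only [step, h, List.mem_singleton] at hd <;>
      subst hd <;> simp only [List.mem_cons, forall_eq_or_imp, Cmd.clStacks, Cmd.quStacks,
        List.cons_subset] <;> tauto
  | move q r =>
    simp only [step, List.mem_singleton] at hd
    subst hd
    simp only [List.mem_cons, forall_eq_or_imp, Cmd.quStacks, List.cons_subset] at hX hY
    exact ⟨⟨hX.2, hY.2⟩, fun _ _ => rfl, fun y hy =>
      (hqu hY.1.2.1 y hy).trans (hqu hY.1.1 y hy)⟩
  | discard q =>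
    simp only [step, List.mem_singleton] at hd
    subst hd
    simp only [List.mem_cons, forall_eq_or_imp, Cmd.quStacks, List.cons_subset] at hX hY
    exact ⟨⟨hX.2, hY.2⟩, fun _ _ => rfl, hqu hY.1.1⟩
  | gate g y q x =>
    simp only [step, List.mem_map] at hd
    obtain ⟨r, -, rfl⟩ := hd
    simp only [List.mem_cons, forall_eq_or_imp, Cmd.clStacks, Cmd.quStacks,
      List.cons_subset] at hX hY
    exact ⟨⟨hX.2, hY.2⟩, hcl hX.1.1, hqu hY.1.1⟩
  | call o q x =>
    simp only [step, List.mem_map] at hd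
    obtain ⟨r, -, rfl⟩ := hd
    simp only [List.mem_cons, forall_eq_or_imp, Cmd.clStacks, Cmd.quStacks,
      List.cons_subset] at hX hY
    exact ⟨⟨hX.2, hY.2⟩, hcl hX.1.1, hqu hY.1.1⟩

/-- A verifier may have infinitely many stacks, but its code mentions only finitely many. Hence a
finite program can reset its memory between two simulated payments. -/
theorem run_frame {X : List C} {Y : List Q} (t : ℕ) {c d : Config O C Q}
    (hX : ∀ a ∈ c.cont, a.clStacks ⊆ X) (hY : ∀ a ∈ c.cont, a.quStacks ⊆ Y)
    (hd : d ∈ run orc t c) :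
    (∀ x, x ∉ X → d.cl x = c.cl x) ∧ ∀ q, q ∉ Y → d.qu q = c.qu q := by
  induction t generalizing c with
  | zero =>
    simp only [run, List.mem_singleton] at hd
    subst hd
    exact ⟨fun _ _ => rfl, fun _ _ => rfl⟩
  | succ t ih =>
    obtain ⟨e, he, hd⟩ := List.mem_flatMap.1 hd
    obtain ⟨⟨h1, h2⟩, h3, h4⟩ := step_frame hX hY he
    obtain ⟨h5, h6⟩ := ih h1 h2 hd
    exact ⟨fun x hx => (h5 x hx).trans (h3 x hx), fun q hq => (h6 q hq).trans (h4 q hq)⟩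

end Frame

/-- The classical stacks used in a public verification. -/
def PublicVerifier.clUsed (V : PublicVerifier) : List V.C :=
  V.secParam :: V.coinSize :: V.answer :: V.code.clStacks

/-- The stacks of qubits used in a public verification. -/
def PublicVerifier.quUsed (V : PublicVerifier) : List V.Q :=
  V.wallet :: V.incoming :: V.code.quStacks

theorem PublicVerifier.verify_frame (V : PublicVerifier) {s : V.Memory} {w : World}
    {hs : List ℕ} {r : Bool × V.Memory × World} (hr : r ∈ V.verify s w hs) :
    (∀ x, x ∉ V.clUsed → r.2.1.cl x = s.cl x) ∧ ∀ q, q ∉ V.quUsed → r.2.1.qu q = s.qu q := by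
  obtain ⟨d, hd, rfl⟩ := List.mem_map.1 hr
  obtain ⟨t, -, hd⟩ := exists_mem_run_of_mem_exec hd
  obtain ⟨h1, h2⟩ := run_frame (X := V.clUsed) (Y := V.quUsed) t
    (by simp [load, clUsed, List.subset_def]; tauto)
    (by simp [load, quUsed, List.subset_def]; tauto) hd
  refine ⟨fun x hx => ?_, fun q hq => ?_⟩
  · have : x ≠ V.answer := by rintro rfl; simp [clUsed] at hx
    simpa [this, load] using h1 x hx
  · have : q ≠ V.incoming := by rintro rfl; simp [quUsed] at hq
    simpa [this, load] using h2 q hq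

theorem PublicVerifier.count_frame (V : PublicVerifier) {coins : List (List ℕ)} {s : V.Memory}
    {w : World} {r : ℕ × V.Memory × World} (hr : r ∈ V.count coins s w) :
    ((∀ x, x ∉ V.clUsed → r.2.1.cl x = s.cl x) ∧ ∀ q, q ∉ V.quUsed → r.2.1.qu q = s.qu q) ∧
      r.1 ≤ coins.length := by
  induction coins generalizing s w r with
  | nil =>
    simp only [count, List.mem_singleton] at hr
    subst hr
    exact ⟨⟨fun _ _ => rfl, fun _ _ => rfl⟩, le_rfl⟩
  | cons hs rest ih =>
    simp only [count, List.mem_flatMap, List.mem_map] at hr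
    obtain ⟨r1, hr1, u, hu, rfl⟩ := hr
    obtain ⟨⟨h1, h2⟩, h3⟩ := ih hu
    obtain ⟨h4, h5⟩ := V.verify_frame hr1
    refine ⟨⟨fun x hx => (h1 x hx).trans (h4 x hx), fun q hq => (h2 q hq).trans (h5 q hq)⟩, ?_⟩
    simp only [List.length_cons]
    split <;> omega

/-! ### The stacks of the reduction -/

/-- The contents of the stacks of the reduction: those of the simulated adversary, those of the
simulated verifier, and its own. -/
def join {A B α : Type*} (f : A → α) (g : B → α) (h : ℕ → α) : A ⊕ B ⊕ ℕ → α :=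
  Sum.elim f (Sum.elim g h)

section Join

variable {A B α : Type*} (f : A → α) (g : B → α) (h : ℕ → α)

@[simp] theorem join_inl (x : A) : join f g h (Sum.inl x) = f x := rfl

@[simp] theorem join_inr_inl (x : B) : join f g h (Sum.inr (Sum.inl x)) = g x := rfl

@[simp] theorem join_inr_inr (x : ℕ) : join f g h (Sum.inr (Sum.inr x)) = h x := rfl

@[simp] theorem update_join_inl [DecidableEq A] [DecidableEq B] (x : A) (v : α) :
    Function.update (join f g h) (Sum.inl x) v = join (Function.update f x v) g h :=
  Sum.update_elim_inl

@[simp] theorem update_join_inr_inl [DecidableEq A] [DecidableEq B] (x : B) (v : α) :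
    Function.update (join f g h) (Sum.inr (Sum.inl x)) v = join f (Function.update g x v) h :=
  Sum.update_elim_inr.trans (congrArg _ Sum.update_elim_inl)

@[simp] theorem update_join_inr_inr [DecidableEq A] [DecidableEq B] (x : ℕ) (v : α) :
    Function.update (join f g h) (Sum.inr (Sum.inr x)) v = join f g (Function.update h x v) :=
  Sum.update_elim_inr.trans (congrArg _ Sum.update_elim_inr)

end Join

/-- The contents of the reduction's own stacks. -/
def own {α : Type*} (a b c d e f g h : List α) : ℕ → List α
  | 0 => a | 1 => b | 2 => c | 3 => d | 4 => e | 5 => f | 6 => g | 7 => h | _ => []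

section Own

variable {α : Type*} (a b c d e f g h v : List α)

@[simp] theorem update_own_0 :
    Function.update (own a b c d e f g h) 0 v = own v b c d e f g h := by
  funext n; rcases n with _ | _ | _ | _ | _ | _ | _ | _ | n <;> rfl

@[simp] theorem update_own_1 :
    Function.update (own a b c d e f g h) 1 v = own a v c d e f g h := by
  funext n; rcases n with _ | _ | _ | _ | _ | _ | _ | _ | n <;> rfl

@[simp] theorem update_own_2 :
    Function.update (own a b c d e f g h) 2 v = own a b v d e f g h := by
  funext n; rcases n with _ | _ | _ | _ | _ | _ | _ | _ | n <;> rfl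

@[simp] theorem update_own_3 :
    Function.update (own a b c d e f g h) 3 v = own a b c v e f g h := by
  funext n; rcases n with _ | _ | _ | _ | _ | _ | _ | _ | n <;> rfl

@[simp] theorem update_own_4 :
    Function.update (own a b c d e f g h) 4 v = own a b c d v f g h := by
  funext n; rcases n with _ | _ | _ | _ | _ | _ | _ | _ | n <;> rfl

@[simp] theorem update_own_5 :
    Function.update (own a b c d e f g h) 5 v = own a b c d e v g h := by
  funext n; rcases n with _ | _ | _ | _ | _ | _ | _ | _ | n <;> rfl

@[simp] theorem update_own_6 :
    Function.update (own a b c d e f g h) 6 v = own a b c d e f v h := by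
  funext n; rcases n with _ | _ | _ | _ | _ | _ | _ | _ | n <;> rfl

@[simp] theorem update_own_7 :
    Function.update (own a b c d e f g h) 7 v = own a b c d e f g v := by
  funext n; rcases n with _ | _ | _ | _ | _ | _ | _ | _ | n <;> rfl

@[simp] theorem own_0 : own a b c d e f g h 0 = a := rfl
@[simp] theorem own_1 : own a b c d e f g h 1 = b := rfl
@[simp] theorem own_2 : own a b c d e f g h 2 = c := rfl
@[simp] theorem own_3 : own a b c d e f g h 3 = d := rfl
@[simp] theorem own_4 : own a b c d e f g h 4 = e := rfl
@[simp] theorem own_5 : own a b c d e f g h 5 = f := rfl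
@[simp] theorem own_6 : own a b c d e f g h 6 = g := rfl
@[simp] theorem own_7 : own a b c d e f g h 7 = h := rfl

end Own

/-- The reduction's own stacks. -/
abbrev stk {A B : Type} (n : ℕ) : A ⊕ B ⊕ ℕ := Sum.inr (Sum.inr n)

/-- The stacks of the simulated verifier. -/
abbrev ver {A B : Type} (x : B) : A ⊕ B ⊕ ℕ := Sum.inr (Sum.inl x)

/-- Own stack that holds the security parameter. -/
abbrev lamStk {A B : Type} : A ⊕ B ⊕ ℕ := stk 0
/-- Own stack that holds the number of qubits of a coin. -/
abbrev lenStk {A B : Type} : A ⊕ B ⊕ ℕ := stk 1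
/-- Own stack that counts down to the selected payment. -/
abbrev ctrStk {A B : Type} : A ⊕ B ⊕ ℕ := stk 2
/-- Own auxiliary stack. -/
abbrev tmpStk {A B : Type} : A ⊕ B ⊕ ℕ := stk 3
/-- Own auxiliary stack. -/
abbrev auxStk {A B : Type} : A ⊕ B ⊕ ℕ := stk 4
/-- Own auxiliary stack. -/
abbrev todoStk {A B : Type} : A ⊕ B ⊕ ℕ := stk 5
/-- Own auxiliary stack. -/
abbrev keepStk {A B : Type} : A ⊕ B ⊕ ℕ := stk 6
/-- Own auxiliary stack. -/
abbrev bitStk {A B : Type} : A ⊕ B ⊕ ℕ := stk 7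

/-- The contents of the reduction's own stacks of qubits. -/
def ownQ (a b : List ℕ) : ℕ → List ℕ := own a b [] [] [] [] [] []

@[simp] theorem ownQ_0 (a b : List ℕ) : ownQ a b 0 = a := rfl
@[simp] theorem ownQ_1 (a b : List ℕ) : ownQ a b 1 = b := rfl
@[simp] theorem update_ownQ_0 (a b v : List ℕ) :
    Function.update (ownQ a b) 0 v = ownQ v b := update_own_0 ..
@[simp] theorem update_ownQ_1 (a b v : List ℕ) :
    Function.update (ownQ a b) 1 v = ownQ a v := update_own_1 ..

/-! ### Moving coins -/

section Shift

variable {O C Q : Type}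

/-- For each element of `cnt`, moves as many qubits from `q` to `r` as `len` says, and pushes
an element on `keep`. -/
def Cmd.shift (len tmp aux cnt keep : C) (q r : Q) : Cmd O C Q :=
  .loop cnt (.seq (.pop cnt) (.seq (.push keep true)
    (.seq (.copy len tmp aux) (.moveQubits aux q r))))

variable [DecidableEq C] [DecidableEq Q] {orc : Oracles O}

/-- The whole block of `m * l` qubits arrives reversed, and the number of coins is carried over from
`cnt` to `keep`, ready for a second shift that restores the order. A coin costs `10 * l + 3` for
copying its length, `4 * l + 1` for the qubits, and the overhead of the loop. -/
theorem Big.shift {len tmp aux cnt keep : C} (h : [len, tmp, aux, cnt, keep].Nodup) {q r : Q}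
    (hqr : q ≠ r) {l m : ℕ} {cl : C → List Bool} {qu : Q → List ℕ} {w : World}
    (hl : cl len = List.replicate l true) (ht : cl tmp = []) (ha : cl aux = [])
    (hm : (cl cnt).length = m) :
    Big orc (m * (14 * l + 10) + 1) (.shift len tmp aux cnt keep q r) ⟨cl, qu, w⟩
      [⟨Function.update (Function.update cl cnt []) keep (List.replicate m true ++ cl keep),
        Function.update (Function.update qu q (takeQubits (m * l) (qu q) w).2.1)
          r ((takeQubits (m * l) (qu q) w).1.reverse ++ qu r),
        (takeQubits (m * l) (qu q) w).2.2⟩] := by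
  simp only [List.nodup_cons, List.mem_cons, List.not_mem_nil, or_false, not_or,
    not_false_eq_true, List.nodup_nil, and_true] at h
  obtain ⟨⟨h1, h2, h3, h4⟩, ⟨h5, h6, h7⟩, ⟨h8, h9⟩, h10⟩ := h
  induction m generalizing cl qu w with
  | zero =>
    have hs : cl cnt = [] := List.length_eq_zero_iff.1 hm
    exact (Big.loop_nil (s := ⟨cl, qu, w⟩) hs).cast (by omega)
      (by simp [← hs, takeQubits_zero])
  | succ m ih =>
    have hne : cl cnt ≠ [] := by rintro h0; simp [h0] at hm
    have hb := (Big.copy (orc := orc) h1 h2 h5 (n := l)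
      (cl := Function.update (Function.update cl cnt (cl cnt).tail) keep
        (true :: Function.update cl cnt (cl cnt).tail keep)) (qu := qu) (w := w)
      (by simp [h3, h4, hl]) (by simp [h6, h7, ht])).seq_single
      (Big.moveQubits (x := aux) hqr (n := l) (by simp [h8, h9, ha]))
    refine Big.cast (Big.loop_cons_single (s := ⟨cl, qu, w⟩) hne (.seq_single (.pop cnt _)
      (.seq_single (.push keep _ _) hb))
      (ih (by simp [h2, h3, h4, hl]) (by simp [h5, h6, h7, ht]) (by simp)
        (by simp [Ne.symm h8, h10, hm]))) (by rw [Nat.add_one_mul m]; omega) ?_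
    rw [Nat.succ_mul, Nat.add_comm (m * l) l]
    simp only [List.cons.injEq, Store.mk.injEq, and_true]
    refine ⟨?_, ?_, ?_⟩
    · funext z
      by_cases hz : z = keep
      · subst hz
        simp [Ne.symm h10, Ne.symm h9, replicate_append_cons_self]
      · by_cases hz' : z = cnt
        · subst hz'
          simp [hz]
        · by_cases hz'' : z = aux
          · subst hz''
            simp [hz, hz', ha]
          · simp [hz, hz', hz'']
    · funext z
      by_cases hz : z = r
      · subst hz
        simp [hqr, takeQubits_add l (m * l) (qu q) w]
      · by_cases hz' : z = q
        · subst hz'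
          simp [hz, takeQubits_add l (m * l) (qu z) w]
        · simp [hz, hz']
    · simp [hqr, takeQubits_add l (m * l) (qu q) w]

end Shift

/-! ### Simulation of a verifier -/

namespace PublicVerifier

variable (V : PublicVerifier) {C Q : Type} [DecidableEq C] [DecidableEq Q]

/-- The verifier as a part of the reduction. -/
def embedding (a : C → List Bool) (qa : Q → List ℕ) (o : ℕ → List Bool) (qo : ℕ → List ℕ)
    (L : List Event) :
    Embedding Empty V.C V.Q GameOracle (C ⊕ V.C ⊕ ℕ) (Q ⊕ V.Q ⊕ ℕ) where
  onC := ver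
  onQ := ver
  onCall o := o.elim
  cl _ f := join a f o
  qu f := join qa f qo
  log _ := L
  cl_apply _ _ _ := rfl
  cl_update _ _ _ _ := update_join_inr_inl ..
  qu_apply _ _ := rfl
  qu_update _ _ _ := update_join_inr_inl ..

/-- The code of the verifier as a part of the reduction. -/
def embeddedCode : Cmd GameOracle (C ⊕ V.C ⊕ ℕ) (Q ⊕ V.Q ⊕ ℕ) :=
  V.code.embed ver ver fun o => o.elim

/-- Verifies the next coin and pushes an element on `x` if it is accepted. -/
def verifyNext (x : C) : Cmd GameOracle (C ⊕ V.C ⊕ ℕ) (Q ⊕ V.Q ⊕ ℕ) :=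
  .seq (.copy lenStk tmpStk auxStk) (.seq (.moveQubits auxStk (stk 1) (stk 0))
    (.seq (.copy lenStk tmpStk auxStk) (.seq (.moveQubits auxStk (stk 0) (ver V.incoming))
      (.seq V.embeddedCode (.branch (ver V.answer)
        (.seq (.push (Sum.inl x) true) (.pop (ver V.answer))) (.pop (ver V.answer)) .skip)))))

variable {V} {orc : Oracles GameOracle}

theorem big_embeddedCode {s : V.Memory} {w : World} {hs : List ℕ} {t : ℕ}
    (h : HaltsIn noOracles t (V.load s w hs)) (a : C → List Bool) (qa : Q → List ℕ)
    (o : ℕ → List Bool) (qo : ℕ → List ℕ) (L : List Event) :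
    Big orc t V.embeddedCode
      ⟨join a s.cl o, join qa (Function.update s.qu V.incoming (hs ++ s.qu V.incoming)) qo,
        ⟨w.next, w.ket, L⟩⟩
      ((exec noOracles (V.load s w hs)).map fun d =>
        ⟨join a d.cl o, join qa d.qu qo, ⟨d.world.next, d.world.ket, L⟩⟩) := by
  intro k
  have h1 := (V.embedding a qa o qo L).unfolds_run (orc := noOracles) (orc' := orc) k t
    (V.load s w hs)
  rw [h.exec_eq, List.map_map]
  have h2 : (run noOracles t (V.load s w hs)).map ((V.embedding a qa o qo L).config k) =
      (run noOracles t (V.load s w hs)).map ((fun r : Store _ _ => r.config k) ∘ fun d =>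
        ⟨join a d.cl o, join qa d.qu qo, ⟨d.world.next, d.world.ket, L⟩⟩) := by
    refine List.map_congr_left fun d hd => ?_
    simp only [Embedding.config, h d hd, List.map_nil, List.nil_append]
    rfl
  rw [← h2]
  exact h1

/-- The coin passes through own stack `0` on its way from own stack `1` to `incoming`: two reversals
leave its qubits in the right order. -/
theorem big_verifyNext {s : V.Memory} {w : World} {hs : List ℕ} {t l : ℕ}
    (h : HaltsIn noOracles t (V.load s w hs)) (hl : hs.length = l) (a : C → List Bool) (x : C)
    (qa : Q → List ℕ) (p c td kp b : List Bool) (rest : List ℕ) (L : List Event) :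
    Big orc (t + 28 * l + 20) (V.verifyNext x)
      ⟨join a s.cl (own p (List.replicate l true) c [] [] td kp b),
        join qa s.qu (ownQ [] (hs ++ rest)), ⟨w.next, w.ket, L⟩⟩
      ((V.verify s w hs).map fun r =>
        ⟨join (if r.1 then Function.update a x (true :: a x) else a) r.2.1.cl
            (own p (List.replicate l true) c [] [] td kp b),
          join qa r.2.1.qu (ownQ [] rest), ⟨r.2.2.next, r.2.2.ket, L⟩⟩) := by
  have h5 := (big_embeddedCode (orc := orc) h a qa
    (own p (List.replicate l true) c [] [] td kp b) (ownQ [] rest) L).seq (m := 4)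
    (b := .branch (ver V.answer)
        (.seq (.push (Sum.inl x) true) (.pop (ver V.answer))) (.pop (ver V.answer)) .skip)
    (L := fun d => [⟨join (if (d.cl V.answer).head? = some true
            then Function.update a x (true :: a x) else a)
            (Function.update d.cl V.answer (d.cl V.answer).tail)
            (own p (List.replicate l true) c [] [] td kp b),
          join qa d.qu (ownQ [] rest), ⟨d.world.next, d.world.ket, L⟩⟩]) (by
      intro d _
      -- A missing answer counts as rejection. Nothing is popped then, which agrees with `tail` of
      -- the empty stack in `verify`.
      rcases hd : d.cl V.answer with _ | ⟨_ | _, k⟩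
      · refine (Big.branch_nil (by simp [hd]) (.skip _)).cast (by omega) ?_
        have hu : Function.update d.cl V.answer [] = d.cl := by rw [← hd, Function.update_eq_self]
        simp [hu]
      · refine (Big.branch_false (l := k) (by simp [hd]) (.pop _ _)).cast (by omega) ?_
        simp [hd]
      · refine (Big.branch_true (l := k) (by simp [hd])
          (.seq_single (.push _ _ _) (.pop _ _))).cast (by omega) ?_
        simp [hd])
  have h1 := Big.copy (orc := orc) (s := lenStk) (z := tmpStk) (y := auxStk) (by simp) (by simp)
    (by simp) (n := l) (cl := join a s.cl (own p (List.replicate l true) c [] [] td kp b))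
    (qu := join qa s.qu (ownQ [] (hs ++ rest))) (w := ⟨w.next, w.ket, L⟩) (by simp) (by simp)
  have h2 := Big.moveQubits (orc := orc) (x := auxStk) (q := stk 1) (r := stk 0) (by simp) (n := l)
    (cl := join a s.cl (own p (List.replicate l true) c [] (List.replicate l true) td kp b))
    (qu := join qa s.qu (ownQ [] (hs ++ rest))) (w := ⟨w.next, w.ket, L⟩) (by simp)
  have h3 := Big.copy (orc := orc) (s := lenStk) (z := tmpStk) (y := auxStk) (by simp) (by simp)
    (by simp) (n := l) (cl := join a s.cl (own p (List.replicate l true) c [] [] td kp b))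
    (qu := join qa s.qu (ownQ hs.reverse rest)) (w := ⟨w.next, w.ket, L⟩) (by simp) (by simp)
  have h4 := Big.moveQubits (orc := orc) (x := auxStk) (q := stk 0) (r := ver V.incoming)
    (by simp) (n := l)
    (cl := join a s.cl (own p (List.replicate l true) c [] (List.replicate l true) td kp b))
    (qu := join qa s.qu (ownQ hs.reverse rest)) (w := ⟨w.next, w.ket, L⟩) (by simp)
  have e1 : takeQubits l (hs ++ rest) ⟨w.next, w.ket, L⟩ = (hs, rest, ⟨w.next, w.ket, L⟩) := by
    rw [takeQubits_of_le (by simp [hl])]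
    simp [← hl]
  have e2 : takeQubits l hs.reverse ⟨w.next, w.ket, L⟩ =
      (hs.reverse, [], ⟨w.next, w.ket, L⟩) := by
    rw [takeQubits_of_le (by simp [hl])]
    simp [← hl]
  simp only [join_inr_inr, own_4, List.append_nil, update_join_inr_inr, update_own_4, ownQ_1,
    ownQ_0, e1, e2, update_ownQ_0, update_ownQ_1, update_join_inr_inl, join_inr_inl,
    List.reverse_reverse] at h1 h2 h3 h4
  refine (h1.seq_single (h2.seq_single (h3.seq_single (h4.seq_single h5)))).cast (by omega) ?_
  rw [verify, List.map_map, List.map_eq_flatMap]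
  refine List.flatMap_congr fun d _ => ?_
  simp

/-- The verification of all remaining coins. -/
theorem big_count {coins : List (List ℕ)} {l τ : ℕ} {T : ℕ → ℕ} {s : V.Memory} {w : World}
    (h : V.KeepsHalting l T s w) (hl : ∀ c ∈ coins, c.length = l)
    (hτ : ∀ n < coins.length, T n ≤ τ) (a : C → List Bool) (x : C) (acc : ℕ) (qa : Q → List ℕ)
    (p c td b : List Bool) (L : List Event) :
    Big orc (coins.length * (τ + 28 * l + 23) + 1)
      (.loop keepStk (.seq (.pop keepStk) (V.verifyNext x)))
      ⟨join (Function.update a x (List.replicate acc true)) s.cl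
          (own p (List.replicate l true) c [] [] td (List.replicate coins.length true) b),
        join qa s.qu (ownQ [] coins.flatten), ⟨w.next, w.ket, L⟩⟩
      ((V.count coins s w).map fun r =>
        ⟨join (Function.update a x (List.replicate (acc + r.1) true)) r.2.1.cl
            (own p (List.replicate l true) c [] [] td [] b),
          join qa r.2.1.qu (ownQ [] []), ⟨r.2.2.next, r.2.2.ket, L⟩⟩) := by
  induction coins generalizing s w T acc with
  | nil =>
    refine (Big.loop_nil ?_).cast (by omega) ?_
    · simp
    · simp [count]
  | cons hs rest ih =>
    simp only [List.mem_cons, forall_eq_or_imp] at hl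
    have h1 := big_verifyNext (orc := orc) (h.halts hl.1) hl.1
      (Function.update a x (List.replicate acc true)) x qa p c td
      (List.replicate rest.length true) b rest.flatten L
    have h2 := Big.pop (orc := orc) keepStk
      ⟨join (Function.update a x (List.replicate acc true)) s.cl
          (own p (List.replicate l true) c [] [] td (List.replicate (hs :: rest).length true) b),
        join qa s.qu (ownQ [] (hs :: rest).flatten), ⟨w.next, w.ket, L⟩⟩
    simp only [join_inr_inr, own_6, update_join_inr_inr, update_own_6, List.length_cons,
      List.tail_replicate, Nat.add_sub_cancel, List.flatten_cons] at h2
    refine (Big.loop_cons (by simp [List.replicate_succ]) (h2.seq_single h1)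
      (L := fun r => (V.count rest r.2.1 r.2.2).map fun u =>
        ⟨join (Function.update a x (List.replicate ((acc + if r.1 then 1 else 0) + u.1) true))
            u.2.1.cl (own p (List.replicate l true) c [] [] td [] b),
          join qa u.2.1.qu (ownQ [] []), ⟨u.2.2.next, u.2.2.ket, L⟩⟩)
      (m := rest.length * (τ + 28 * l + 23) + 1) fun r hr => ?_).cast ?_ ?_
    -- The stack `x` appears with one element pushed upon acceptance, or as a unary number with the
    -- verdict added; cases on the verdict identify the two forms.
    · refine (ih (h.next hl.1 hr) hl.2 (fun n hn => hτ (n + 1) (by simpa using hn))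
        (acc + if r.1 then 1 else 0)).cast le_rfl rfl |> cast ?_
      rcases r.1 <;> simp [List.replicate_succ]
    · have := hτ 0 (by simp)
      simp only [List.length_cons, Nat.succ_mul]
      omega
    · simp only [count, List.map_flatMap, List.map_map]
      refine List.flatMap_congr fun r _ => List.map_congr_left fun u _ => ?_
      simp [Nat.add_assoc]

end PublicVerifier

/-! ### Simulation of a payment -/

section Simulation

variable (V : PublicVerifier) {C Q : Type} [DecidableEq C] [DecidableEq Q]

/-- Puts the inputs on the stacks of a program that is part of the reduction. -/
def Cmd.setInput {C Q : Type} (s l : C ⊕ V.C ⊕ ℕ) : Cmd GameOracle (C ⊕ V.C ⊕ ℕ) Q :=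
  .seq (.copy lamStk tmpStk s) (.seq (.clear l) (.copy lenStk tmpStk l))

/-- Simulates a payment of the number of coins on `x` from `q` to a verifier with a new coin, and
puts the number of accepted coins on `x`. -/
def Cmd.simulatePayment (q : Q) (x : C) : Cmd GameOracle (C ⊕ V.C ⊕ ℕ) (Q ⊕ V.Q ⊕ ℕ) :=
  .seq (.shift lenStk tmpStk auxStk (Sum.inl x) todoStk (Sum.inl q) (stk 0))
    (.seq (.shift lenStk tmpStk auxStk todoStk keepStk (stk 0) (stk 1))
      (.seq (.call .mint (ver V.wallet) tmpStk)
        (.seq (.setInput V (ver V.secParam) (ver V.coinSize))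
          (.seq (.loop keepStk (.seq (.pop keepStk) (V.verifyNext x)))
            (.seq (.clearAll (V.clUsed.map ver)) (.discardAll (V.quUsed.map ver)))))))

variable {V}

theorem Big.setInput_inner {orc : Oracles GameOracle} (s l : V.C) (lam len : ℕ)
    (a : C → List Bool) (c td kp b : List Bool) {Q : Type} [DecidableEq Q] (qu : Q → List ℕ)
    (w : World) : Big orc (10 * lam + 10 * len + 9) (.setInput V (ver s) (ver l))
      ⟨join a (fun _ => []) (own (List.replicate lam true) (List.replicate len true) c [] []
        td kp b), qu, w⟩
      [⟨join a (Function.update (Function.update (fun _ => []) s (List.replicate lam true)) l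
        (List.replicate len true)) (own (List.replicate lam true) (List.replicate len true) c [] []
        td kp b), qu, w⟩] := by
  have h1 := Big.copy (orc := orc) (s := lamStk) (z := tmpStk) (y := ver s) (by simp) (by simp)
    (by simp) (n := lam) (cl := join a (fun _ => []) (own (List.replicate lam true)
      (List.replicate len true) c [] [] td kp b)) (qu := qu) (w := w) (by simp) (by simp)
  have h2 := Big.clear (orc := orc) (ver l) ⟨join a (Function.update (fun _ => []) s
      (List.replicate lam true)) (own (List.replicate lam true) (List.replicate len true) c [] []
        td kp b), qu, w⟩
  have h3 := Big.copy (orc := orc) (s := lenStk) (z := tmpStk) (y := ver l) (by simp) (by simp)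
    (by simp) (n := len) (cl := join a (Function.update (Function.update (fun _ => []) s
      (List.replicate lam true)) l []) (own (List.replicate lam true)
      (List.replicate len true) c [] [] td kp b)) (qu := qu) (w := w) (by simp) (by simp)
  simp only [update_join_inr_inl, join_inr_inl, List.append_nil, Function.update_self,
    Function.update_idem] at h1 h2 h3
  exact (h1.seq_single (h2.seq_single h3)).cast (by omega) rfl

theorem Big.setInput_outer {orc : Oracles GameOracle} (s l : C) (lam len : ℕ)
    (c td kp b : List Bool) {Q : Type} [DecidableEq Q] (qu : Q → List ℕ)
    (w : World) : Big orc (10 * lam + 10 * len + 9) (.setInput V (Sum.inl s) (Sum.inl l))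
      ⟨join (fun _ => []) (fun _ => []) (own (List.replicate lam true) (List.replicate len true) c
        [] [] td kp b), qu, w⟩
      [⟨join (Function.update (Function.update (fun _ => []) s (List.replicate lam true)) l
        (List.replicate len true)) (fun _ => []) (own (List.replicate lam true)
        (List.replicate len true) c [] [] td kp b), qu, w⟩] := by
  have h1 := Big.copy (orc := orc) (s := lamStk) (z := tmpStk) (y := Sum.inl s) (by simp)
    (by simp) (by simp) (n := lam) (cl := join (fun _ : C => []) (fun _ : V.C => [])
      (own (List.replicate lam true) (List.replicate len true) c [] [] td kp b)) (qu := qu) (w := w)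
    (by simp) (by simp)
  have h2 := Big.clear (orc := orc) (Sum.inl l) ⟨join (Function.update (fun _ : C => []) s
      (List.replicate lam true)) (fun _ : V.C => []) (own (List.replicate lam true)
      (List.replicate len true) c [] [] td kp b), qu, w⟩
  have h3 := Big.copy (orc := orc) (s := lenStk) (z := tmpStk) (y := Sum.inl l) (by simp)
    (by simp) (by simp) (n := len) (cl := join (Function.update (Function.update (fun _ : C => []) s
      (List.replicate lam true)) l []) (fun _ : V.C => []) (own (List.replicate lam true)
      (List.replicate len true) c [] [] td kp b)) (qu := qu) (w := w) (by simp) (by simp)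
  simp only [update_join_inl, join_inl, List.append_nil, Function.update_self,
    Function.update_idem] at h1 h2 h3
  exact (h1.seq_single (h2.seq_single h3)).cast (by omega) rfl

/-- A bound for the number of steps that the simulation of a payment of `m` coins takes. -/
def simulationTime (V : PublicVerifier) (lam l τ m : ℕ) : ℕ :=
  m * (τ + 56 * l + 43) + 10 * lam + 10 * l + 2 * V.clUsed.length + 2 * V.quUsed.length + 30

end Simulation

namespace CoinScheme

variable (M : CoinScheme) (lam : ℕ) (sk : M.Key lam) {C Q : Type} [DecidableEq C] [DecidableEq Q]

/-- Two shifts bring the coins to own stack `1` in their original order, and their number from `x`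
to `keepStk`. A minted coin and the inputs then make up a fresh verifier, which counts the coins.
Its stacks are emptied at the end, so the next simulation meets the same initial situation. In the
log, the payment has become a query to the mint. -/
theorem big_simulatePayment {T : ℕ → ℕ} (hT : (M.verifier lam).RunsIn lam (M.coinLen lam) T)
    {τ : ℕ} (q : Q) (x : C) (cl : C → List Bool) (qu : Q → List ℕ) (w : World) (L : List Event)
    (c b : List Bool) (hτ : ∀ n < (cl x).length, T n ≤ τ) :
    let t := takeQubits ((cl x).length * (M.coinLen lam)) (qu q) w
    Big (M.oracles lam sk) (simulationTime (M.verifier lam) lam (M.coinLen lam) τ (cl x).length)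
        (.simulatePayment (M.verifier lam) q x)
      ⟨join cl (fun _ => []) (own (List.replicate lam true) (List.replicate (M.coinLen lam) true) c
          [] [] [] []
        b), join qu (fun _ => []) (ownQ [] []), ⟨w.next, w.ket, L⟩⟩
      (((M.verifier lam).count (blocks (M.coinLen lam) (cl x).length t.1) ((M.verifier lam).fresh
          lam (M.coinLen lam) (M.mint lam sk t.2.2).1)
          (M.mint lam sk t.2.2).2).map fun r =>
        ⟨join (Function.update cl x (List.replicate r.1 true)) (fun _ => [])
            (own (List.replicate lam true) (List.replicate (M.coinLen lam) true) c [] [] [] [] b),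
          join (Function.update qu q t.2.1) (fun _ => []) (ownQ [] []),
          ⟨r.2.2.next, r.2.2.ket, L ++ [.mint]⟩⟩) := by
  intro t
  set m := (cl x).length with hm
  have ht : t.1.length = m * (M.coinLen lam) := takeQubits_length _ _ _
  have hflat : (blocks (M.coinLen lam) m t.1).flatten = t.1 := by
    rw [flatten_blocks, List.take_of_length_le ht.le]
  have h1 := Big.shift (orc := M.oracles lam sk) (len := lenStk) (tmp := tmpStk) (aux := auxStk)
    (cnt := Sum.inl x) (keep := todoStk) (by simp) (q := Sum.inl q) (r := stk 0) (by simp)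
    (cl := join cl (fun _ : (M.verifier lam).C => []) (own (List.replicate lam true)
        (List.replicate (M.coinLen lam) true) c
      [] [] [] [] b)) (qu := join qu (fun _ : (M.verifier lam).Q => []) (ownQ [] [])) (w :=
          ⟨w.next, w.ket, L⟩)
    (l := (M.coinLen lam)) (m := m) (by simp) (by simp) (by simp) (by simp [hm])
  have e1 : takeQubits (m * (M.coinLen lam)) (qu q) ⟨w.next, w.ket, L⟩ =
      (t.1, t.2.1, ⟨t.2.2.next, t.2.2.ket, L⟩) := rfl
  simp only [update_join_inl, update_join_inr_inr, update_own_5, join_inr_inr, join_inl, own_5,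
    List.append_nil, e1, update_ownQ_0, ownQ_0] at h1
  have h2 := Big.shift (orc := M.oracles lam sk) (len := lenStk) (tmp := tmpStk) (aux := auxStk)
    (cnt := todoStk) (keep := keepStk) (by simp) (q := stk 0) (r := stk 1) (by simp)
    (cl := join (Function.update cl x []) (fun _ : (M.verifier lam).C => []) (own (List.replicate
        lam true)
      (List.replicate (M.coinLen lam) true) c [] [] (List.replicate m true) [] b))
    (qu := join (Function.update qu q t.2.1) (fun _ : (M.verifier lam).Q => []) (ownQ t.1.reverse
        []))
    (w := ⟨t.2.2.next, t.2.2.ket, L⟩)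
    (l := (M.coinLen lam)) (m := m) (by simp) (by simp) (by simp) (by simp)
  have e2 : takeQubits (m * (M.coinLen lam)) t.1.reverse ⟨t.2.2.next, t.2.2.ket, L⟩ =
      (t.1.reverse, [], ⟨t.2.2.next, t.2.2.ket, L⟩) := by
    rw [takeQubits_of_le (by simp [ht])]
    simp [← ht]
  simp only [update_join_inr_inr, update_own_5, update_own_6, join_inr_inr, own_6,
    List.append_nil, e2, update_ownQ_0, update_ownQ_1, ownQ_0, ownQ_1,
    List.reverse_reverse] at h2
  -- The wallet is empty before the call, so afterwards it holds exactly the new coin, as for a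
  -- fresh verifier.
  have h3 : Big (M.oracles lam sk) 1 (.call .mint (ver (M.verifier lam).wallet) tmpStk)
      ⟨join (Function.update cl x []) (fun _ : (M.verifier lam).C => []) (own (List.replicate lam
          true)
        (List.replicate (M.coinLen lam) true) c [] [] [] (List.replicate m true) b),
        join (Function.update qu q t.2.1) (fun _ : (M.verifier lam).Q => []) (ownQ [] t.1),
        ⟨t.2.2.next, t.2.2.ket, L⟩⟩
      [⟨join (Function.update cl x []) (fun _ : (M.verifier lam).C => []) (own (List.replicate lam
          true)
        (List.replicate (M.coinLen lam) true) c [] [] [] (List.replicate m true) b),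
        join (Function.update qu q t.2.1) ((M.verifier lam).fresh lam (M.coinLen lam) (M.mint lam
            sk t.2.2).1).qu (ownQ [] t.1),
        ⟨(M.mint lam sk t.2.2).2.next, (M.mint lam sk t.2.2).2.ket, L ++ [.mint]⟩⟩] := by
    refine .of_step_eq fun k => ?_
    simp [step, Store.config, oracles, PublicVerifier.fresh, mint]
  have h4 := Big.setInput_inner (orc := M.oracles lam sk) (M.verifier lam).secParam (M.verifier
      lam).coinSize lam (M.coinLen lam)
    (Function.update cl x []) c [] (List.replicate m true) b
    (join (Function.update qu q t.2.1) ((M.verifier lam).fresh lam (M.coinLen lam) (M.mint lam sk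
        t.2.2).1).qu (ownQ [] t.1))
    ⟨(M.mint lam sk t.2.2).2.next, (M.mint lam sk t.2.2).2.ket, L ++ [.mint]⟩
  have h5 := PublicVerifier.big_count (orc := M.oracles lam sk) (coins := blocks (M.coinLen lam) m
      t.1)
    (hT.keepsHalting (M.mint_length lam sk t.2.2) (M.mint lam sk t.2.2).2)
    (fun c hc => length_of_mem_blocks ht.ge hc) (by rwa [length_blocks]) cl x 0
    (Function.update qu q t.2.1) (List.replicate lam true) c [] b (L ++ [.mint])
  rw [hflat, length_blocks] at h5
  have h6 := h5.seq (b := .seq (.clearAll ((M.verifier lam).clUsed.map ver)) (.discardAll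
      ((M.verifier lam).quUsed.map ver)))
    (m := 2 * (M.verifier lam).clUsed.length + 2 * (M.verifier lam).quUsed.length + 3)
    (L := fun r => [⟨join (Function.update cl x (List.replicate r.1 true)) (fun _ => [])
            (own (List.replicate lam true) (List.replicate (M.coinLen lam) true) c [] [] [] [] b),
          join (Function.update qu q t.2.1) (fun _ => []) (ownQ [] []),
          ⟨r.2.2.next, r.2.2.ket, L ++ [.mint]⟩⟩]) (by
      intro r hr
      -- Stacks outside the used ones are as in the fresh memory, that is empty; emptying the used
      -- ones therefore erases the whole verifier.
      obtain ⟨⟨h7, h8⟩, -⟩ := (M.verifier lam).count_frame hr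
      refine ((Big.clearAll _ _).seq_single (Big.discardAll _ _)).cast ?_ ?_
      · simp only [List.length_map]
        omega
      · simp only [List.cons.injEq, Store.mk.injEq, and_true]
        constructor
        · funext z
          rcases z with z | z | z
          · simp
          · by_cases hz : z ∈ (M.verifier lam).clUsed
            · simp [hz]
            · have h9 : z ≠ (M.verifier lam).secParam := by rintro rfl; simp
                [PublicVerifier.clUsed] at hz
              have h10 : z ≠ (M.verifier lam).coinSize := by rintro rfl; simp
                  [PublicVerifier.clUsed] at hz
              simpa [hz, PublicVerifier.fresh, Program.input, h9, h10] using h7 z hz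
          · simp
        · funext z
          rcases z with z | z | z
          · simp
          · by_cases hz : z ∈ (M.verifier lam).quUsed
            · simp [hz]
            · have h9 : z ≠ (M.verifier lam).wallet := by rintro rfl; simp [PublicVerifier.quUsed]
                at hz
              simpa [hz, PublicVerifier.fresh, h9] using h8 z hz
          · simp)
  refine (h1.seq_single (h2.seq_single (h3.seq_single (h4.seq_single h6)))).cast ?_ ?_
  -- The time per coin is that of two shifts and one verification: `56 = 14 + 14 + 28` and `43 = 10
  -- + 10 + 23`.
  · have e : m * (τ + 56 * (M.coinLen lam) + 43) = m * (14 * (M.coinLen lam) + 10) + m * (14 *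
      (M.coinLen lam) + 10) +
        m * (τ + 28 * (M.coinLen lam) + 23) := by ring
    simp only [simulationTime, e]
    omega
  · rw [List.map_eq_flatMap]

/-- The contents of the counter. -/
def counter : Option ℕ → List Bool
  | none => [false]
  | some n => List.replicate n true

end CoinScheme

/-- The payment in the reduction: real if it is the selected one, otherwise simulated. -/
def Cmd.payment (V : PublicVerifier) {C Q : Type} (q : Q) (x : C) :
    Cmd GameOracle (C ⊕ V.C ⊕ ℕ) (Q ⊕ V.Q ⊕ ℕ) :=
  .branch ctrStk (.seq (.pop ctrStk) (.simulatePayment V q x)) (.simulatePayment V q x)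
    (.seq (.call .pay (Sum.inl q) (Sum.inl x)) (.push ctrStk false))

/-- The oracle calls of the simulated adversary. -/
def Cmd.onCall (V : PublicVerifier) {C Q : Type} :
    GameOracle → Q → C → Cmd GameOracle (C ⊕ V.C ⊕ ℕ) (Q ⊕ V.Q ⊕ ℕ)
  | .pay, q, x => .payment V q x
  | o, q, x => .call o (Sum.inl q) (Sum.inl x)

/-- The adversary as a part of the reduction. -/
def adversaryEmbedding (V : PublicVerifier) (C Q : Type) [DecidableEq C] [DecidableEq Q]
    (lam l j : ℕ) :
    Embedding GameOracle C Q GameOracle (C ⊕ V.C ⊕ ℕ) (Q ⊕ V.Q ⊕ ℕ) where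
  onC := Sum.inl
  onQ := Sum.inl
  onCall := Cmd.onCall V
  cl L f := join f (fun _ => []) (own (List.replicate lam true) (List.replicate l true)
    (CoinScheme.counter (position (some j) L)) [] [] [] [] [])
  qu f := join f (fun _ => []) (ownQ [] [])
  log := select (some j)
  cl_apply _ _ _ := rfl
  cl_update _ _ _ _ := update_join_inl ..
  qu_apply _ _ := rfl
  qu_update _ _ _ := update_join_inl ..

namespace CoinScheme

variable (M : CoinScheme) (lam : ℕ) (sk : M.Key lam) (j : ℕ) {C Q : Type} [DecidableEq C]
  [DecidableEq Q]

theorem position_snoc (l : List Event) (e : Event) :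
    position (some j) (l ++ [e]) = advance (position (some j) l) e := by
  rw [position_append]; rfl

theorem select_snoc (l : List Event) (e : Event) :
    select (some j) (l ++ [e]) = select (some j) l ++ [relabel (position (some j) l) e] := by
  rw [select_append]; rfl

/-- A payment received in a world with another log. -/
theorem receive_log {coins : List (List ℕ)} {w : World} (hn : coins.flatten.Nodup)
    (hlt : ∀ u ∈ coins.flatten, u < w.next) (L : List Event) :
    M.receive lam sk coins ⟨w.next, w.ket, L⟩ =
      (M.receive lam sk coins ⟨w.next, w.ket, []⟩).map fun r =>
        (r.1, ⟨r.2.next, r.2.ket, L ++ r.2.log⟩) := by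
  have h := M.receive_map lam sk (CommutesOff.id ∅) (g := (L ++ ·))
    (fun l e => (List.append_assoc _ _ _).symm) (w := ⟨w.next, w.ket, []⟩) hn hlt (by simp)
    (by simp)
  simpa [World.map] using h

theorem exists_log_of_mem_receive {coins : List (List ℕ)} {w : World}
    (hn : coins.flatten.Nodup) (hlt : ∀ u ∈ coins.flatten, u < w.next) {r : ℕ × World}
    (hr : r ∈ M.receive lam sk coins w) :
    ∃ u, r.2.log = w.log ++ [.payment coins.length r.1 u] := by
  simp only [receive, List.mem_flatMap, List.mem_map] at hr
  obtain ⟨r1, hr1, u, hu, rfl⟩ := hr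
  have h1 := M.fresh_sep lam sk (S := ∅ ∪ {u | u ∈ coins.flatten}) (M.verifier lam)
    (w := w) (by simpa using hlt) (M.coinLen lam)
  refine ⟨u.1, ?_⟩
  simp only
  rw [(M.privCount_world lam sk hu).2.1, PublicVerifier.count_log _ h1 hn hr1]
  rfl

/-- The reduction simulates one step of the hybrid game. -/
theorem unfolds_step_hybrid {T : ℕ → ℕ}
    (hT : (M.verifier lam).RunsIn lam (M.coinLen lam) T) {τ N : ℕ} (hτ : ∀ n < N, T n ≤ τ)
    {c : Config GameOracle C Q} (hc : Sep ∅ c.world.next c.qu)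
    (hN : ∀ x, (c.cl x).length ≤ N) (hne : c.cont ≠ [])
    (k : List (Cmd GameOracle (C ⊕ (M.verifier lam).C ⊕ ℕ) (Q ⊕ (M.verifier lam).Q ⊕ ℕ))) :
    Unfolds (M.oracles lam sk)
      (simulationTime (M.verifier lam) lam (M.coinLen lam) τ N + 3)
      ((adversaryEmbedding (M.verifier lam) C Q lam (M.coinLen lam) j).config k c)
      ((step (M.hybrid lam sk j) c).map
        ((adversaryEmbedding (M.verifier lam) C Q lam (M.coinLen lam) j).config k)) := by
  set E := adversaryEmbedding (M.verifier lam) C Q lam (M.coinLen lam) j with hE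
  by_cases hcall : ∀ o q x k', c.cont ≠ .call o q x :: k'
  · refine Unfolds.mono (n := 1) ?_ (by omega)
    rw [← E.step_config (orc' := M.oracles lam sk) k hne hcall]
    exact .step _
  push Not at hcall
  obtain ⟨o, q, x, k', hk'⟩ := hcall
  obtain ⟨cont, cl, qu, w⟩ := c
  subst hk'
  cases o with
  | mint =>
    refine Unfolds.mono (n := 1) ?_ (by omega)
    have : step (M.oracles lam sk) (E.config k ⟨.call .mint q x :: k', cl, qu, w⟩) =
        (step (M.hybrid lam sk j) ⟨.call .mint q x :: k', cl, qu, w⟩).map (E.config k) := by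
      have h1 : ∀ o, advance o .mint = o := by rintro (_ | _ | _) <;> rfl
      have h2 : ∀ o, relabel o .mint = .mint := by rintro (_ | _ | _) <;> rfl
      simp [step, Embedding.config, Embedding.cmd, Cmd.embed, hybrid, hE, adversaryEmbedding,
        Cmd.onCall, oracles, Embedding.world, mint, position_snoc, select_snoc, h1, h2]
    rw [← this]
    exact .step _
  | privVerify =>
    refine Unfolds.mono (n := 1) ?_ (by omega)
    have : step (M.oracles lam sk) (E.config k ⟨.call .privVerify q x :: k', cl, qu, w⟩) =
        (step (M.hybrid lam sk j) ⟨.call .privVerify q x :: k', cl, qu, w⟩).map (E.config k) := by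
      have h1 : ∀ o, advance o .privVerify = o := by rintro (_ | _ | _) <;> rfl
      have h2 : ∀ o, relabel o .privVerify = .privVerify := by rintro (_ | _ | _) <;> rfl
      simp [step, Embedding.config, Embedding.cmd, Cmd.embed, hybrid, hE, adversaryEmbedding,
        Cmd.onCall, oracles, Embedding.world, takeQubits, Instrument.run, Function.comp_def,
        position_snoc, select_snoc, h1, h2]
    rw [← this]
    exact .step _
  | pay =>
    simp only at hN hc
    have hsim := M.big_simulatePayment lam sk hT (τ := τ) q x cl qu w (select (some j) w.log)
    have htime : simulationTime (M.verifier lam) lam (M.coinLen lam) τ (cl x).length ≤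
        simulationTime (M.verifier lam) lam (M.coinLen lam) τ N := by
      have := Nat.mul_le_mul_right (τ + 56 * M.coinLen lam + 43) (hN x)
      simp only [simulationTime]
      omega
    obtain ⟨h1, h2, h3, h4, h5⟩ := M.pay_coins lam (m := (cl x).length) (hc.nodup q) (hc.lt q)
    have hl0 : (takeQubits ((cl x).length * M.coinLen lam) (qu q) w).2.2.log = w.log := rfl
    -- `Big` allows any continuation, so it is enough to treat the payment without the rest of the
    -- simulated program.
    suffices h : Big (M.oracles lam sk)
        (simulationTime (M.verifier lam) lam (M.coinLen lam) τ N + 3)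
        (.payment (M.verifier lam) q x)
        ⟨join cl (fun _ => []) (own (List.replicate lam true)
          (List.replicate (M.coinLen lam) true) (counter (position (some j) w.log))
            [] [] [] [] []), join qu (fun _ => []) (ownQ [] []),
          ⟨w.next, w.ket, select (some j) w.log⟩⟩
        ((M.hybrid lam sk j .pay (qu q) (cl x) w).map fun r =>
          ⟨join (Function.update cl x r.2.1) (fun _ => []) (own (List.replicate lam true)
            (List.replicate (M.coinLen lam) true) (counter (position (some j) r.2.2.log))
              [] [] [] [] []), join (Function.update qu q r.1) (fun _ => []) (ownQ [] []),
            ⟨r.2.2.next, r.2.2.ket, select (some j) r.2.2.log⟩⟩) by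
      have h' := h (k'.map E.cmd ++ k)
      rw [List.map_map] at h'
      have e : step (M.hybrid lam sk j) ⟨.call .pay q x :: k', cl, qu, w⟩ =
        (M.hybrid lam sk j .pay (qu q) (cl x) w).map fun r =>
          ⟨k', Function.update cl x r.2.1, Function.update qu q r.1, r.2.2⟩ := rfl
      rw [e, List.map_map]
      exact h'
    -- The counter is empty exactly when the selected payment is due; a `false` on top marks that it
    -- is over.
    by_cases hp : position (some j) w.log = some 0
    -- The branches are enumerated with an empty log. The log of the hybrid game and that of the
    -- reduction then arise from the same branches by different prefixes.
    · have hcallp : Big (M.oracles lam sk) 1 (.call .pay (Sum.inl q) (Sum.inl x))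
          ⟨join cl (fun _ : (M.verifier lam).C => []) (own (List.replicate lam true)
            (List.replicate (M.coinLen lam) true) [] [] [] [] [] []),
            join qu (fun _ : (M.verifier lam).Q => []) (ownQ [] []),
            ⟨w.next, w.ket, select (some j) w.log⟩⟩
          ((M.receive lam sk (blocks (M.coinLen lam) (cl x).length
            (takeQubits ((cl x).length * M.coinLen lam) (qu q) w).1)
            ⟨(takeQubits ((cl x).length * M.coinLen lam) (qu q) w).2.2.next,
              (takeQubits ((cl x).length * M.coinLen lam) (qu q) w).2.2.ket, []⟩).map fun r =>
          ⟨join (Function.update cl x (List.replicate r.1 true)) (fun _ => [])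
            (own (List.replicate lam true) (List.replicate (M.coinLen lam) true) []
              [] [] [] [] []),
            join (Function.update qu q
              (takeQubits ((cl x).length * M.coinLen lam) (qu q) w).2.1) (fun _ => [])
              (ownQ [] []),
            ⟨r.2.next, r.2.ket, select (some j) w.log ++ r.2.log⟩⟩) := by
        refine .of_step_eq fun k => ?_
        have hr := M.receive_log lam sk (w := (takeQubits ((cl x).length * M.coinLen lam)
          (qu q) w).2.2) h2 (fun u hu => (h4 u (h1 ▸ hu)).1) (select (some j) w.log)
        simp only [step, Store.config, oracles, join_inl]
        have e1 : takeQubits ((cl x).length * M.coinLen lam) (qu q)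
            ⟨w.next, w.ket, select (some j) w.log⟩ =
            ((takeQubits ((cl x).length * M.coinLen lam) (qu q) w).1,
              (takeQubits ((cl x).length * M.coinLen lam) (qu q) w).2.1,
              ⟨(takeQubits ((cl x).length * M.coinLen lam) (qu q) w).2.2.next,
              (takeQubits ((cl x).length * M.coinLen lam) (qu q) w).2.2.ket,
              select (some j) w.log⟩) := rfl
        rw [e1]
        simp only [hr, List.map_map]
        refine List.map_congr_left fun r _ => ?_
        simp
      have hr := M.receive_log lam sk (w := (takeQubits ((cl x).length * M.coinLen lam)
          (qu q) w).2.2) h2 (fun u hu => (h4 u (h1 ▸ hu)).1) w.log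
      have h6 := hcallp.seq (b := .push ctrStk false) (m := 1)
        (fun r _ => Big.push ctrStk false _)
      rw [show counter (position (some j) w.log) = [] by rw [hp]; rfl]
      refine Big.cast (Big.branch_nil (n := 3) (by simp) h6) (by simp only [simulationTime]; omega)
          ?_
      have e2 : (takeQubits ((cl x).length * M.coinLen lam) (qu q) w).2.2 =
          ⟨(takeQubits ((cl x).length * M.coinLen lam) (qu q) w).2.2.next,
            (takeQubits ((cl x).length * M.coinLen lam) (qu q) w).2.2.ket, w.log⟩ := rfl
      simp only [hybrid, if_pos hp, oracles]
      rw [e2, hr, List.map_map, List.map_map, ← List.map_eq_flatMap]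
      refine List.map_congr_left fun r h7 => ?_
      obtain ⟨u, hu⟩ := M.exists_log_of_mem_receive lam sk
        (w := ⟨(takeQubits ((cl x).length * M.coinLen lam) (qu q) w).2.2.next,
          (takeQubits ((cl x).length * M.coinLen lam) (qu q) w).2.2.ket, []⟩) h2
        (fun u hu => (h4 u (h1 ▸ hu)).1) h7
      simp only [Function.comp_apply, hu, List.nil_append, position_snoc, select_snoc, hp]
      simp [relabel, advance, counter]
    -- The count adds no events, so before the payment is recorded the position is still that of
    -- `w.log`, and `hrel` turns the payment into a query to the mint.
    · have hz : ∀ r ∈ (M.verifier lam).count (blocks (M.coinLen lam) (cl x).length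
          (takeQubits ((cl x).length * M.coinLen lam) (qu q) w).1)
          ((M.verifier lam).fresh lam (M.coinLen lam) (M.mint lam sk
            (takeQubits ((cl x).length * M.coinLen lam) (qu q) w).2.2).1)
          (M.mint lam sk (takeQubits ((cl x).length * M.coinLen lam) (qu q) w).2.2).2,
          r.2.2.log = w.log := by
        intro r hr
        have h6 := M.fresh_sep lam sk (S := ∅ ∪ {u | u ∈ (blocks (M.coinLen lam) (cl x).length
          (takeQubits ((cl x).length * M.coinLen lam) (qu q) w).1).flatten}) (M.verifier lam)
          (w := (takeQubits ((cl x).length * M.coinLen lam) (qu q) w).2.2)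
          (fun u hu => (h4 u (h1 ▸ (by simpa using hu))).1) (M.coinLen lam)
        exact PublicVerifier.count_log _ h6 h2 hr
      have hrel : ∀ m a r, relabel (position (some j) w.log) (.payment m a r) = .mint := by
        intro m a r
        rcases hpos : position (some j) w.log with _ | _ | n
        · rfl
        · exact absurd hpos hp
        · rfl
      simp only [hybrid, if_neg hp, List.map_map]
      -- After the selected payment the marker `false` stays in place; before it, the counter loses
      -- one element per payment.
      rcases hpos : position (some j) w.log with _ | _ | n
      · have := hsim [false] [] fun n hn => hτ n (hn.trans_le (hN x))
        refine Big.cast (Big.branch_false (l := []) (by simp [counter]) this) (by omega) ?_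
        refine List.map_congr_left fun r hr => ?_
        simp only [Function.comp_apply, hz r hr, position_snoc, select_snoc, hrel]
        simp [hpos, advance, counter]
      · exact absurd hpos hp
      · have := hsim (List.replicate n true) [] fun n hn => hτ n (hn.trans_le (hN x))
        refine Big.cast (Big.branch_true (l := List.replicate n true)
          (by simp [counter, List.replicate_succ])
          ((Big.pop _ _).seq_single (by
            simpa [counter, List.replicate_succ, -List.map_map] using this))) (by omega) ?_
        refine List.map_congr_left fun r hr => ?_
        simp only [Function.comp_apply, hz r hr, position_snoc, select_snoc, hrel]
        simp [hpos, advance, counter]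

end CoinScheme

/-! ### The events in the reduction -/

theorem length_select (o : Option ℕ) (l : List Event) : (select o l).length = l.length := by
  induction l generalizing o with
  | nil => rfl
  | cons e l ih => simp [select, ih]

theorem numCoins_select_le (o : Option ℕ) (l : List Event) :
    numCoins (select o l) ≤ numCoins l := by
  induction l generalizing o with
  | nil => exact le_rfl
  | cons e l ih =>
    have h1 : (relabel o e).coins ≤ e.coins := by
      cases e <;> rcases o with _ | _ | _ <;> simp [relabel, Event.coins]
    have h2 := ih (advance o e)
    simp only [numCoins, select, List.map_cons, List.sum_cons] at h2 ⊢
    omega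

theorem select_none (l : List Event) :
    totalLoss (select none l) = 0 ∧ numPayments (select none l) = 0 ∧ position none l = none := by
  induction l with
  | nil => simp [select, totalLoss, numPayments, position]
  | cons e l ih =>
    cases e <;>
      simpa [select, relabel, advance, totalLoss, numPayments, Event.loss, position] using ih

/-- The counter tells whether the reduction has already made its only payment, which is what
`Cmd.settle` has to know. -/
theorem position_eq_none_or (n : ℕ) (l : List Event) :
    (position (some n) l = none ∧ numPayments (select (some n) l) = 1) ∨
      (position (some n) l ≠ none ∧ numPayments (select (some n) l) = 0 ∧
        totalLoss (select (some n) l) = 0) := by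
  induction l generalizing n with
  | nil => exact .inr ⟨by simp [position], by simp [select, totalLoss, numPayments]⟩
  | cons e l ih =>
    cases e with
    | mint | privVerify =>
      have := ih n
      rcases n with _ | n <;>
        simpa [select, relabel, advance, totalLoss, numPayments, Event.loss, position] using this
    | payment m a u =>
      rcases n with _ | n
      · refine .inl ⟨(select_none l).2.2, ?_⟩
        have := (select_none l).2.1
        simpa [select, relabel, advance, numPayments] using this
      · have := ih n
        simpa [select, relabel, advance, totalLoss, numPayments, Event.loss, position] using this

/-- The combined loss is the sum of the losses in the payments. -/
theorem sum_selectedLoss {N : ℕ} {l : List Event} (h : numPayments l ≤ N) :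
    ∑ j ∈ Finset.range N, selectedLoss j l = totalLoss l := by
  induction l generalizing N with
  | nil => simp [selectedLoss, select, totalLoss]
  | cons e l ih =>
    cases e with
    | mint | privVerify =>
      have h' : numPayments l ≤ N := by simpa [numPayments] using h
      refine (Finset.sum_congr rfl fun j _ => ?_).trans ((ih h').trans ?_)
      · rcases j with _ | j <;> simp [selectedLoss, select, relabel, advance, totalLoss, Event.loss]
      · simp [totalLoss, Event.loss]
    | payment m a u =>
      obtain ⟨N, rfl⟩ : ∃ N', N = N' + 1 := by
        cases N with
        | zero => simp [numPayments] at h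
        | succ N => exact ⟨N, rfl⟩
      have h' : numPayments l ≤ N := by simpa [numPayments] using h
      have e1 : ∀ j, selectedLoss (j + 1) (.payment m a u :: l) = selectedLoss j l := by
        intro j
        simp [selectedLoss, select, relabel, advance, totalLoss, Event.loss]
      have e2 := (select_none l).1
      -- The first payment is selected by `0`, after which nothing is; the indices `j + 1` select
      -- among the later payments.
      rw [Finset.sum_range_succ', Finset.sum_congr rfl fun j _ => e1 j, ih h']
      simp only [totalLoss, selectedLoss, select, relabel, advance, List.map_cons,
        List.sum_cons] at e2 ⊢
      rw [e2]
      ring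

theorem eraseRefund_facts {l l' : List Event}
    (h : l.map Event.eraseRefund = l'.map Event.eraseRefund) :
    l.length = l'.length ∧ numCoins l = numCoins l' := by
  refine ⟨by simpa using congrArg List.length h, ?_⟩
  have h1 : ∀ l, numCoins (l.map Event.eraseRefund) = numCoins l := by
    intro l
    rw [numCoins, numCoins, List.map_map]
    congr 2
    funext e
    cases e <;> rfl
  rw [← h1, h, h1]

namespace CoinScheme

variable (M : CoinScheme) (lam : ℕ) (sk : M.Key lam) (j : ℕ) {C Q : Type} [DecidableEq C]
  [DecidableEq Q]

/-! ### The simulation of the hybrid game -/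

/-- In one step the classical stacks grow by at most one. -/
theorem step_hybrid_growth {c d : Config GameOracle C Q} (hd : d ∈ step (M.hybrid lam sk j) c)
    {N : ℕ} (hN : ∀ x, (c.cl x).length ≤ N) (x : C) : (d.cl x).length ≤ N + 1 := by
  have hx := hN x
  have hu : ∀ y v, v.length ≤ N + 1 → (Function.update c.cl y v x).length ≤ N + 1 := by
    intro y v hv
    by_cases hxy : x = y
    · subst hxy; simpa using hv
    · simpa [hxy] using hx.trans (Nat.le_succ N)
  obtain ⟨cont, cl, qu, w⟩ := c
  simp only at hN hx hu
  rcases cont with _ | ⟨a, k⟩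
  · simp only [step, List.mem_singleton] at hd
    exact hd ▸ hx.trans (Nat.le_succ N)
  cases a with
  | skip | seq | move | discard =>
    simp only [step, List.mem_singleton] at hd
    exact hd ▸ hx.trans (Nat.le_succ N)
  | push y b =>
    simp only [step, List.mem_singleton] at hd
    exact hd ▸ hu y _ (by simpa using hN y)
  | pop y =>
    simp only [step, List.mem_singleton] at hd
    exact hd ▸ hu y _ (by have := hN y; simp; omega)
  | clear y =>
    simp only [step, List.mem_singleton] at hd
    exact hd ▸ hu y _ (by simp)
  | branch y a b e =>
    rcases h : cl y with _ | ⟨_ | _, _⟩ <;> simp only [step, h, List.mem_singleton] at hd <;>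
      exact hd ▸ hx.trans (Nat.le_succ N)
  | loop y a =>
    rcases h : cl y with _ | ⟨_, _⟩ <;> simp only [step, h, List.mem_singleton] at hd <;>
      exact hd ▸ hx.trans (Nat.le_succ N)
  | gate g y q z =>
    simp only [step, List.mem_map] at hd
    obtain ⟨r, -, rfl⟩ := hd
    exact hu z _ (by simpa using hN z)
  | call o q y =>
    simp only [step, List.mem_map] at hd
    obtain ⟨r, hr, rfl⟩ := hd
    refine hu y _ ?_
    have hy := hN y
    -- A payment replaces the number of submitted coins by the number of accepted ones, which is not
    -- larger.
    have hcount : ∀ {coins s w'} {r : ℕ × (M.verifier lam).Memory × World},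
        r ∈ (M.verifier lam).count coins s w' → coins.length = (cl y).length → r.1 ≤ N + 1 :=
      fun h h' => ((M.verifier lam).count_frame h).2.trans (by omega)
    cases o with
    | mint =>
      simp only [hybrid, oracles, List.mem_singleton] at hr
      subst hr
      exact hy.trans (Nat.le_succ N)
    | privVerify =>
      simp only [hybrid, oracles, List.mem_map] at hr
      obtain ⟨r, -, rfl⟩ := hr
      simpa using hy
    | pay =>
      simp only [hybrid] at hr
      split_ifs at hr
      · simp only [oracles, receive, List.mem_map, List.mem_flatMap] at hr
        obtain ⟨_, ⟨r, hr, _, -, rfl⟩, rfl⟩ := hr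
        simpa using hcount hr (length_blocks _ _ _)
      · obtain ⟨u, hu, rfl⟩ := List.mem_map.1 hr
        simpa using hcount hu (length_blocks _ _ _)

/-- The reduction simulates the hybrid game. -/
theorem unfolds_run_hybrid {T : ℕ → ℕ}
    (hT : (M.verifier lam).RunsIn lam (M.coinLen lam) T) {τ N : ℕ} (hτ : ∀ n < N, T n ≤ τ)
    (k : List (Cmd GameOracle (C ⊕ (M.verifier lam).C ⊕ ℕ) (Q ⊕ (M.verifier lam).Q ⊕ ℕ)))
    (t : ℕ) {c : Config GameOracle C Q} (hc : Sep ∅ c.world.next c.qu)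
    (hN : ∀ x, (c.cl x).length + t ≤ N) :
    Unfolds (M.oracles lam sk)
      ((simulationTime (M.verifier lam) lam (M.coinLen lam) τ N + 3) * t)
      ((adversaryEmbedding (M.verifier lam) C Q lam (M.coinLen lam) j).config k c)
      ((run (M.hybrid lam sk j) t c).map
        ((adversaryEmbedding (M.verifier lam) C Q lam (M.coinLen lam) j).config k)) := by
  induction t generalizing c with
  | zero => exact Unfolds.refl _ _
  | succ t ih =>
    by_cases hne : c.cont = []
    · rw [run_of_halted hne]
      exact Unfolds.refl _ _
    · rw [run, List.map_flatMap, Nat.mul_succ, Nat.add_comm]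
      refine Unfolds.trans (M.unfolds_step_hybrid lam sk j hT hτ hc
        (fun x => (Nat.le_add_right _ _).trans (hN x)) hne k) fun d hd =>
          ih (step_sep (M.respectsNames_hybrid lam sk j) hc hd).1 fun x => ?_
      -- The quantity "stack length plus remaining steps" does not increase. Thus no payment in the
      -- run exceeds `N` coins.
      have := M.step_hybrid_growth lam sk j hd (N := N - (t + 1)) (fun y => by
        have := hN y
        omega) x
      have := hN x
      omega

end CoinScheme

/-- Pays no coins if nothing has been paid yet. -/
def Cmd.settle {A B C Q : Type} : Cmd GameOracle (A ⊕ B ⊕ ℕ) (C ⊕ Q ⊕ ℕ) :=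
  .branch ctrStk (.call .pay (stk 0) tmpStk) .skip (.call .pay (stk 0) tmpStk)

namespace CoinScheme

variable (M : CoinScheme) (lam : ℕ) (sk : M.Key lam) (j : ℕ) {C Q : Type} [DecidableEq C]
  [DecidableEq Q]

/-- Without submitted coins the wallet is the minted coin, so at most one coin is refunded. -/
theorem mem_receive_nil {w : World} {r : ℕ × World} (hr : r ∈ M.receive lam sk [] w) :
    ∃ u ≤ 1, r.2.log = w.log ++ [.payment 0 0 u] := by
  simp only [receive, PublicVerifier.count, List.flatMap_singleton, List.mem_map] at hr
  obtain ⟨u, hu, rfl⟩ := hr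
  obtain ⟨-, h1, h2⟩ := M.privCount_world lam sk hu
  refine ⟨u.1, h2.trans ?_, by simp only [h1]; rfl⟩
  -- The wallet has `coinLen` qubits; as this number is positive, the division yields one block.
  rw [length_blocks]
  simp [PublicVerifier.fresh, mint_length, M.coinLen_pos]

/-- The end of the reduction: exactly one payment has been made, and the loss is at least that
in the selected payment of the hybrid game. -/
theorem unfolds_settle {d : Config GameOracle C Q} (hd : d.cont = []) :
    ∃ L, Unfolds (M.oracles lam sk) 2
        ((adversaryEmbedding (M.verifier lam) C Q lam (M.coinLen lam) j).config [.settle] d) L ∧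
      (∀ e ∈ L, e.cont = [] ∧ numPayments e.world.log = 1 ∧
        e.world.log.length ≤ d.world.log.length + 1 ∧
        numCoins e.world.log ≤ numCoins d.world.log) ∧
      normSq d.world.ket * selectedLoss j d.world.log ≤
        (L.map fun e => normSq e.world.ket * totalLoss e.world.log).sum := by
  set E := adversaryEmbedding (M.verifier lam) C Q lam (M.coinLen lam) j
  have hE : E.config [.settle] d = (⟨E.cl d.world.log d.cl, E.qu d.qu, E.world d.world⟩ :
      Store _ _).config [.settle] := by simp [Embedding.config, Store.config, hd]
  have hlen := length_select (some j) d.world.log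
  have hcoins := numCoins_select_le (some j) d.world.log
  have hctr : E.cl d.world.log d.cl ctrStk = counter (position (some j) d.world.log) := rfl
  rcases position_eq_none_or j d.world.log with ⟨h1, h2⟩ | ⟨h1, h2, h3⟩
  · refine ⟨_, (hE ▸ Big.branch_false (l := []) (by simp [hctr, h1, counter]) (.skip _) [] :), ?_,
      ?_⟩
    · simp only [List.map_cons, List.map_nil, List.mem_singleton, forall_eq]
      exact ⟨rfl, h2, hlen.le.trans (Nat.le_succ _), hcoins⟩
    · simp only [List.map_cons, List.map_nil, List.sum_singleton]
      exact le_rfl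
  · have hcall : ∃ L, Big (M.oracles lam sk) 1 (.call .pay (stk 0) tmpStk)
        ⟨E.cl d.world.log d.cl, E.qu d.qu, E.world d.world⟩ L ∧ ∀ r ∈ L, ∃ u ≤ 1, r.world.log =
          select (some j) d.world.log ++ [.payment 0 0 u] := by
      refine ⟨(M.oracles lam sk .pay [] [] (E.world d.world)).map fun r =>
        ⟨Function.update (E.cl d.world.log d.cl) tmpStk r.2.1, Function.update (E.qu d.qu) (stk 0)
            r.1,
          r.2.2⟩, .of_step_eq fun k => ?_, fun r hr => ?_⟩
      · rw [List.map_map]; rfl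
      · simp only [oracles, List.map_map, List.mem_map] at hr
        obtain ⟨r, hr, rfl⟩ := hr
        have := M.mem_receive_nil lam sk (r := r) (by simpa [blocks] using hr)
        exact this
    obtain ⟨L, hL, hlog⟩ := hcall
    have hset : Big (M.oracles lam sk) 2 .settle
        ⟨E.cl d.world.log d.cl, E.qu d.qu, E.world d.world⟩ L := by
      rcases hp : position (some j) d.world.log with _ | _ | n
      · exact absurd hp h1
      · exact Big.branch_nil (by simp [hctr, hp, counter]) hL
      · exact Big.branch_true (l := List.replicate n true)
          (by simp [hctr, hp, counter, List.replicate_succ]) hL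
    refine ⟨_, (hE ▸ hset [] :), ?_, ?_⟩
    · simp only [List.forall_mem_map]
      intro r hr
      obtain ⟨u, -, hu⟩ := hlog r hr
      refine ⟨rfl, ?_, ?_, ?_⟩
      · change numPayments r.world.log = 1
        rw [hu]
        simpa [numPayments] using h2
      · change r.world.log.length ≤ _
        simp [hu, hlen]
      · change numCoins r.world.log ≤ _
        rw [hu]
        simpa [numCoins, Event.coins] using hcoins
    -- The selected payment has not happened and contributes zero to the hybrid game. The payment of
    -- no coins loses `1 - u`, which is nonnegative since `u ≤ 1`.
    · rw [selectedLoss, h3, mul_zero]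
      refine List.sum_nonneg ?_
      simp only [List.forall_mem_map]
      intro r hr
      obtain ⟨u, hu1, hu⟩ := hlog r hr
      refine mul_nonneg (normSq_nonneg _) ?_
      change 0 ≤ totalLoss r.world.log
      have hu1 : (u : ℝ) ≤ 1 := by exact_mod_cast hu1
      rw [totalLoss] at h3
      rw [hu, totalLoss, List.map_append, List.sum_append, h3]
      simp [Event.loss, verifierLoss, hu1]

/-- The simulated game with selected payment `j`. -/
theorem unfolds_game {T : ℕ → ℕ}
    (hT : (M.verifier lam).RunsIn lam (M.coinLen lam) T) {τ N : ℕ} (hτ : ∀ n < N, T n ≤ τ)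
    {t : ℕ} {c : Config GameOracle C Q} (hc : Sep ∅ c.world.next c.qu)
    (hN : ∀ x, (c.cl x).length + t ≤ N) (ht : HaltsIn (M.oracles lam sk) t c) :
    ∃ L, Unfolds (M.oracles lam sk)
        ((simulationTime (M.verifier lam) lam (M.coinLen lam) τ N + 3) * t + 2)
        ((adversaryEmbedding (M.verifier lam) C Q lam (M.coinLen lam) j).config [.settle] c) L ∧
      (∀ e ∈ L, e.cont = [] ∧ numPayments e.world.log = 1 ∧
        ∃ d ∈ run (M.oracles lam sk) t c, e.world.log.length ≤ d.world.log.length + 1 ∧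
          numCoins e.world.log ≤ numCoins d.world.log) ∧
      partialLoss j (M.oracles lam sk) t c ≤
        (L.map fun e => normSq e.world.ket * totalLoss e.world.log).sum := by
  obtain ⟨h1, h2, h3⟩ := M.run_hybrid lam sk j t hc ht
  choose! L hL using fun d (hd : d ∈ run (M.hybrid lam sk j) t c) =>
    M.unfolds_settle lam sk j (h1 d hd)
  refine ⟨_, (M.unfolds_run_hybrid lam sk j hT hτ [.settle] t hc hN).trans
    fun d hd => (hL d hd).1, fun e he => ?_, ?_⟩
  · obtain ⟨d, hd, he⟩ := List.mem_flatMap.1 he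
    obtain ⟨h4, h5, h6, h7⟩ := (hL d hd).2.1 e he
    obtain ⟨d', hd', h8⟩ := h3 d hd
    obtain ⟨h9, h10⟩ := eraseRefund_facts h8
    exact ⟨h4, h5, d', hd', h9 ▸ h6, h10 ▸ h7⟩
  -- The real game is traded for the hybrid game, whose final configurations are then settled one by
  -- one.
  · rw [← h2, partialLoss, sum_map_flatMap]
    exact List.sum_le_sum fun d hd => (hL d hd).2.2

end CoinScheme

/-! ### Sampling a counter -/

section Sampling

variable {A B Q : Type}

/-- Halves the length of the auxiliary stack. -/
def Cmd.halve : Cmd GameOracle (A ⊕ B ⊕ ℕ) Q :=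
  .seq (.loop auxStk (.seq (.pop auxStk) (.branch auxStk
    (.seq (.pop auxStk) (.push keepStk true)) .skip .skip))) (.transfer keepStk auxStk)

/-- Pushes as many elements as the length of the auxiliary stack has binary digits. -/
def Cmd.digits : Cmd GameOracle (A ⊕ B ⊕ ℕ) Q := .loop auxStk (.seq (.push todoStk true) .halve)

/-- Puts the number of coin tosses on a stack. -/
def Cmd.numTosses : ℕ → Cmd GameOracle (A ⊕ B ⊕ ℕ) Q
  | 0 => .skip
  | d + 1 => .seq (.copy lamStk tmpStk auxStk) (.seq (.push auxStk true) (.seq .digits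
      (numTosses d)))

/-- Doubles the counter and adds a random bit. -/
def Cmd.toss : Cmd GameOracle (A ⊕ B ⊕ ℕ) (C ⊕ Q ⊕ ℕ) :=
  .seq (.loop ctrStk (.seq (.pop ctrStk) (.seq (.push keepStk true) (.push keepStk true))))
    (.seq (.transfer keepStk ctrStk) (.seq (.gate (Gate.const coinToss) bitStk (stk 0) bitStk)
      (.seq (.branch bitStk (.push ctrStk true) .skip .skip) (.pop bitStk))))

/-- Puts a random number on the counter. -/
def Cmd.sample (d : ℕ) : Cmd GameOracle (A ⊕ B ⊕ ℕ) (C ⊕ Q ⊕ ℕ) :=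
  .seq (.numTosses d) (.loop todoStk (.seq (.pop todoStk) .toss))

variable [DecidableEq A] [DecidableEq B] [DecidableEq Q] {orc : Oracles GameOracle}
  (f : A → List Bool) (g : B → List Bool) (p l c : List Bool)

theorem Big.halve_loop (td : List Bool) (kp : ℕ) (b : List Bool) (qu : Q → List ℕ)
    (w : World) (n : ℕ) :
    Big orc (7 * n + 1) (.loop auxStk (.seq (.pop auxStk) (.branch auxStk
        (.seq (.pop auxStk) (.push keepStk true)) .skip .skip)))
      ⟨join f g (own p l c [] (List.replicate n true) td (List.replicate kp true) b), qu, w⟩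
      [⟨join f g (own p l c [] [] td (List.replicate (n / 2 + kp) true) b), qu, w⟩] := by
  induction n using Nat.twoStepInduction generalizing kp with
  | zero => exact (Big.loop_nil (by simp)).cast le_rfl (by simp)
  | one =>
    have h1 : Big orc 4 (.seq (.pop auxStk) (.branch auxStk
        (.seq (.pop auxStk) (.push keepStk true)) .skip .skip))
        ⟨join f g (own p l c [] (List.replicate 1 true) td (List.replicate kp true) b), qu, w⟩
        [⟨join f g (own p l c [] [] td (List.replicate kp true) b), qu, w⟩] :=
      ((Big.pop _ _).seq_single (Big.branch_nil (by simp) (.skip _))).cast le_rfl (by simp)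
    exact (Big.loop_cons_single (by simp) h1 (Big.loop_nil (by simp))).cast (by omega) (by simp)
  | more n ih _ =>
    have h1 : Big orc 6 (.seq (.pop auxStk) (.branch auxStk
        (.seq (.pop auxStk) (.push keepStk true)) .skip .skip))
        ⟨join f g (own p l c [] (List.replicate (n + 2) true) td (List.replicate kp true) b), qu, w⟩
        [⟨join f g (own p l c [] (List.replicate n true) td (List.replicate (kp + 1) true) b),
          qu, w⟩] :=
      ((Big.pop _ _).seq_single (Big.branch_true (l := List.replicate n true)
        (by simp [List.replicate_succ]) ((Big.pop _ _).seq_single (.push _ _ _)))).cast le_rfl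
        (by simp [List.replicate_succ])
    refine (Big.loop_cons_single (by simp [List.replicate_succ]) h1 (ih (kp + 1))).cast
      (by omega) ?_
    rw [show n / 2 + (kp + 1) = (n + 2) / 2 + kp by omega]

theorem Big.halve (td b : List Bool) (qu : Q → List ℕ) (w : World) (n : ℕ) :
    Big orc (11 * n + 3) .halve
      ⟨join f g (own p l c [] (List.replicate n true) td [] b), qu, w⟩
      [⟨join f g (own p l c [] (List.replicate (n / 2) true) td [] b), qu, w⟩] := by
  have h1 := Big.halve_loop (orc := orc) f g p l c td 0 b qu w n
  have h2 := Big.transfer (orc := orc) (s := keepStk) (y := auxStk) (by simp) (n := n / 2)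
    (cl := join f g (own p l c [] [] td (List.replicate (n / 2) true) b)) (qu := qu) (w := w)
    (by simp)
  exact (h1.seq_single h2).cast (by omega) (by simp)

theorem size_div_two {n : ℕ} (hn : n ≠ 0) : Nat.size n = Nat.size (n / 2) + 1 := by
  refine le_antisymm (Nat.size_le.2 ?_) (Nat.lt_size.2 ?_)
  · have := Nat.lt_size_self (n / 2)
    rw [pow_succ]
    omega
  · rcases Nat.eq_zero_or_pos (n / 2) with h | h
    · simp only [h, Nat.size_zero, pow_zero]
      omega
    · have h1 : 2 ^ ((n / 2).size - 1) ≤ n / 2 := Nat.lt_size.1 (by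
        have := Nat.size_pos.2 h
        omega)
      have h2 : (n / 2).size = (n / 2).size - 1 + 1 := by
        have := Nat.size_pos.2 h
        omega
      rw [h2, pow_succ]
      omega

theorem Big.digits (td : ℕ) (b : List Bool) (qu : Q → List ℕ) (w : World) (n : ℕ) :
    Big orc (n * (11 * n + 6) + 1) .digits
      ⟨join f g (own p l c [] (List.replicate n true) (List.replicate td true) [] b), qu, w⟩
      [⟨join f g (own p l c [] [] (List.replicate (Nat.size n + td) true) [] b), qu, w⟩] := by
  induction n using Nat.strong_induction_on generalizing td with
  | h n ih =>
    rcases Nat.eq_zero_or_pos n with rfl | hn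
    · exact (Big.loop_nil (by simp)).cast (by omega) (by simp)
    have h1 := (Big.push (orc := orc) todoStk true
      ⟨join f g (own p l c [] (List.replicate n true) (List.replicate td true) [] b), qu,
        w⟩).seq_single (b := .halve) (by
          simpa [← List.replicate_succ] using
            Big.halve (orc := orc) f g p l c (List.replicate (td + 1) true) b qu w n)
    refine (Big.loop_cons_single (by simp; omega) h1
      (ih (n / 2) (Nat.div_lt_self hn one_lt_two) (td + 1))).cast ?_ ?_
    -- A crude quadratic bound is enough: halving `k + 1` gives at most `k`.
    · obtain ⟨k, rfl⟩ : ∃ k, n = k + 1 := ⟨n - 1, by omega⟩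
      have h2 : (k + 1) / 2 * (11 * ((k + 1) / 2) + 6) ≤ k * (11 * (k + 1) + 6) :=
        Nat.mul_le_mul (by omega) (by omega)
      rw [Nat.add_one_mul k]
      omega
    · rw [size_div_two hn.ne', Nat.add_assoc, Nat.add_comm 1 td]

/-- The number of coin tosses. -/
theorem Big.numTosses (td : ℕ) (b : List Bool) (qu : Q → List ℕ) (w : World) (lam d : ℕ) :
    Big orc (d * ((lam + 1) * (11 * (lam + 1) + 6) + 10 * lam + 8) + 1) (.numTosses d)
      ⟨join f g (own (List.replicate lam true) l c [] [] (List.replicate td true) [] b), qu, w⟩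
      [⟨join f g (own (List.replicate lam true) l c [] []
        (List.replicate (d * Nat.size (lam + 1) + td) true) [] b), qu, w⟩] := by
  induction d generalizing td with
  | zero => exact (Big.skip _).cast (by omega) (by simp)
  | succ d ih =>
    have h1 := Big.copy (orc := orc) (s := lamStk) (z := tmpStk) (y := auxStk) (by simp)
      (by simp) (by simp) (n := lam) (cl := join f g (own (List.replicate lam true) l c [] []
        (List.replicate td true) [] b)) (qu := qu) (w := w) (by simp) (by simp)
    have h2 := Big.push (orc := orc) auxStk true ⟨join f g (own (List.replicate lam true) l c []
      (List.replicate lam true) (List.replicate td true) [] b), qu, w⟩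
    have h3 := Big.digits (orc := orc) f g (List.replicate lam true) l c td b qu w (lam + 1)
    simp only [join_inr_inr, own_4, List.append_nil, update_join_inr_inr, update_own_4,
      ← List.replicate_succ] at h1 h2
    refine (h1.seq_single (h2.seq_single (h3.seq_single (ih _)))).cast ?_ ?_
    · rw [Nat.add_one_mul d]
      omega
    · rw [Nat.add_one_mul d, Nat.add_assoc]

theorem Big.double (b td : List Bool) (qu : Q → List ℕ) (w : World) (n kp : ℕ) :
    Big orc (6 * n + 1)
      (.loop ctrStk (.seq (.pop ctrStk) (.seq (.push keepStk true) (.push keepStk true))))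
      ⟨join f g (own p l (List.replicate n true) [] [] td (List.replicate kp true) b), qu, w⟩
      [⟨join f g (own p l [] [] [] td (List.replicate (2 * n + kp) true) b), qu, w⟩] := by
  induction n generalizing kp with
  | zero => exact (Big.loop_nil (by simp)).cast le_rfl (by simp)
  | succ n ih =>
    have h1 : Big orc 5 (.seq (.pop ctrStk) (.seq (.push keepStk true) (.push keepStk true)))
        ⟨join f g (own p l (List.replicate (n + 1) true) [] [] td (List.replicate kp true) b), qu,
          w⟩
        [⟨join f g (own p l (List.replicate n true) [] [] td (List.replicate (kp + 2) true) b), qu,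
          w⟩] :=
      ((Big.pop _ _).seq_single ((Big.push _ _ _).seq_single (.push _ _ _))).cast le_rfl
        (by simp [List.replicate_succ])
    refine (Big.loop_cons_single (by simp [List.replicate_succ]) h1 (ih (kp + 2))).cast
      (by omega) ?_
    rw [show 2 * n + (kp + 2) = 2 * (n + 1) + kp by omega]

variable {C : Type} [DecidableEq C]

/-- The gate acts on zero qubits, so the stacks of qubits are unchanged. Both outcomes have
amplitude `1 / √2`, and the index `i` is the new lowest binary digit. -/
theorem Big.toss (td : List Bool) (qu : C ⊕ Q ⊕ ℕ → List ℕ) (w : World) (n : ℕ) :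
    Big orc (14 * n + 12) .toss
      ⟨join f g (own p l (List.replicate n true) [] [] td [] []), qu, w⟩
      ([0, 1].map fun i => ⟨join f g (own p l (List.replicate (2 * n + i) true) [] [] td [] []),
        qu, ⟨w.next, ((√2 : ℝ) : ℂ)⁻¹ • w.ket, w.log⟩⟩) := by
  have h1 := Big.double (orc := orc) f g p l [] td qu w n 0
  have h2 := Big.transfer (orc := orc) (s := keepStk) (y := ctrStk) (by simp) (n := 2 * n)
    (cl := join f g (own p l [] [] [] td (List.replicate (2 * n) true) [])) (qu := qu) (w := w)
    (by simp)
  have h3 : Big orc 1 (.gate (Gate.const coinToss) bitStk (stk 0) bitStk)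
      ⟨join f g (own p l (List.replicate (2 * n) true) [] [] td [] []), qu, w⟩
      ([false, true].map fun i => ⟨join f g (own p l (List.replicate (2 * n) true) [] [] td []
        [i]), qu, ⟨w.next, ((√2 : ℝ) : ℂ)⁻¹ • w.ket, w.log⟩⟩) := by
    refine .of_step_eq fun k => ?_
    simp [step, Store.config, Gate.const, coinToss, Instrument.run, takeQubits_zero,
      List.finRange_succ, applyOp_scalar]
  simp only [join_inr_inr, own_2, List.append_nil, update_join_inr_inr, update_own_2,
    update_own_6] at h2
  refine (h1.seq_single (h2.seq_single (h3.seq (m := 4) (L := fun i => [⟨join f g (own p l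
    (List.replicate (2 * n + if i then 1 else 0) true) [] [] td [] []), qu,
      ⟨w.next, ((√2 : ℝ) : ℂ)⁻¹ • w.ket, w.log⟩⟩]) ?_))).cast (by omega) (by simp)
  rintro (_ | _) -
  · exact ((Big.branch_false (l := []) (by simp) (.skip _)).seq_single (.pop _ _)).cast (by omega)
      (by simp)
  · exact ((Big.branch_true (l := []) (by simp) (.push _ _ _)).seq_single (.pop _ _)).cast
      (by omega) (by simp [List.replicate_succ])

/-- Further digits are appended to `n`, so each number whose leading part is `n` arises once. The
bound `N` on the final value controls the time for doubling. -/
theorem Big.toss_loop (qu : C ⊕ Q ⊕ ℕ → List ℕ) {N : ℕ} (m : ℕ) (w : World) (n : ℕ)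
    (h : (n + 1) * 2 ^ m ≤ N) :
    Big orc (m * (14 * N + 15) + 1) (.loop todoStk (.seq (.pop todoStk) .toss))
      ⟨join f g (own p l (List.replicate n true) [] [] (List.replicate m true) [] []), qu, w⟩
      ((List.range' (n * 2 ^ m) (2 ^ m)).map fun j =>
        ⟨join f g (own p l (List.replicate j true) [] [] [] [] []), qu,
          ⟨w.next, (((√2 : ℝ) : ℂ)⁻¹ ^ m) • w.ket, w.log⟩⟩) := by
  induction m generalizing w n with
  | zero => exact (Big.loop_nil (by simp)).cast (by omega) (by simp)
  | succ m ih =>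
    have h1 := (Big.pop (orc := orc) todoStk ⟨join f g (own p l (List.replicate n true) [] []
      (List.replicate (m + 1) true) [] []), qu, w⟩).seq_single (b := .toss) (by
        simpa using Big.toss (orc := orc) f g p l (List.replicate m true) qu w n)
    have hN : (n + 1) * 2 ^ m * 2 ≤ N := by rwa [pow_succ, ← Nat.mul_assoc] at h
    have hn : n + 1 ≤ (n + 1) * 2 ^ m := Nat.le_mul_of_pos_right _ (by positivity)
    refine (Big.loop_cons (I := [0, 1]) (by simp [List.replicate_succ]) (by simpa using h1)
      fun i hi => ih _ (2 * n + i) ?_).cast ?_ ?_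
    · have : i ≤ 1 := by simp at hi; omega
      calc (2 * n + i + 1) * 2 ^ m ≤ (2 * (n + 1)) * 2 ^ m := Nat.mul_le_mul_right _ (by omega)
        _ = (n + 1) * 2 ^ m * 2 := by ring
        _ ≤ N := hN
    · rw [Nat.add_one_mul m]
      omega
    -- The interval splits into two halves according to the digit tossed first.
    · have e1 : n * 2 ^ (m + 1) = (2 * n + 0) * 2 ^ m := by ring
      have e2 : (2 * n + 1) * 2 ^ m = (2 * n + 0) * 2 ^ m + 1 * 2 ^ m := by ring
      have e3 : 2 ^ (m + 1) = 2 ^ m + 2 ^ m := by ring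
      rw [e1, e3, ← List.range'_append, List.flatMap_cons, List.flatMap_singleton, e2,
        List.map_append]
      simp [smul_smul, pow_succ]

/-- The counter is uniformly distributed. -/
theorem Big.sample (qu : C ⊕ Q ⊕ ℕ → List ℕ) (w : World) (lam d : ℕ) :
    Big orc (d * ((lam + 1) * (11 * (lam + 1) + 6) + 10 * lam + 8) +
        (d * Nat.size (lam + 1)) * (14 * 2 ^ (d * Nat.size (lam + 1)) + 15) + 3) (.sample d)
      ⟨join f g (own (List.replicate lam true) l [] [] [] [] [] []), qu, w⟩
      ((List.range (2 ^ (d * Nat.size (lam + 1)))).map fun j =>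
        ⟨join f g (own (List.replicate lam true) l (List.replicate j true) [] [] [] [] []), qu,
          ⟨w.next, (((√2 : ℝ) : ℂ)⁻¹ ^ (d * Nat.size (lam + 1))) • w.ket, w.log⟩⟩) := by
  have h1 := Big.numTosses (orc := orc) f g l [] 0 [] qu w lam d
  have h2 := Big.toss_loop (orc := orc) f g (List.replicate lam true) l qu
    (d * Nat.size (lam + 1)) w 0 (N := 2 ^ (d * Nat.size (lam + 1))) (by simp)
  exact (h1.seq_single h2).cast (by omega) (by simp [List.range_eq_range'])

end Sampling

/-! ### The reduction -/

/-- Used where the second command is understood only with a particular continuation, so that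
`Big.seq` does not apply. -/
theorem Unfolds.seq {O C Q ι : Type} [DecidableEq C] [DecidableEq Q] {orc : Oracles O} {n m : ℕ}
    {a b : Cmd O C Q} {s : Store C Q} {I : List ι} {φ : ι → Store C Q}
    {L : ι → List (Config O C Q)} {k : List (Cmd O C Q)} (ha : Big orc n a s (I.map φ))
    (hb : ∀ i ∈ I, Unfolds orc m ((φ i).config (b :: k)) (L i)) :
    Unfolds orc (n + m + 1) (s.config (.seq a b :: k)) (I.flatMap L) := by
  have h := ha (b :: k)
  rw [List.map_map] at h
  simpa using Unfolds.head (I := [s.config (a :: b :: k)]) (φ := id)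
    (L := fun _ => I.flatMap L) rfl (by simpa using h.trans hb)

/-- The adversary against one verifier, obtained from the adversary `P` against several
verifiers. -/
def reduction (V : PublicVerifier) (P : Program GameOracle) (d : ℕ) : Program GameOracle where
  C := P.C ⊕ V.C ⊕ ℕ
  Q := P.Q ⊕ V.Q ⊕ ℕ
  secParam := stk 0
  coinSize := stk 1
  code := .seq (.seq (.sample d) (.setInput V (Sum.inl P.secParam) (Sum.inl P.coinSize)))
    (.seq (P.code.embed Sum.inl Sum.inl (Cmd.onCall V)) .settle)

/-! ### The gates of the reduction -/

section Over

variable {G : GateSet}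

theorem Cmd.over_clearAll {O C Q : Type} (xs : List C) : (Cmd.clearAll (O := O) (Q := Q) xs).Over G
    := by
  induction xs with
  | nil => trivial
  | cons x xs ih => exact ⟨trivial, ih⟩

theorem Cmd.over_discardAll {O C Q : Type} (qs : List Q) :
    (Cmd.discardAll (O := O) (C := C) qs).Over G := by
  induction qs with
  | nil => trivial
  | cons x xs ih => exact ⟨trivial, ih⟩

theorem over_simulatePayment {V : PublicVerifier} (hV : V.code.Over G) {C Q : Type} (q : Q)
    (x : C) : (Cmd.simulatePayment V q x).Over G := by
  have h1 : V.embeddedCode (C := C) (Q := Q) |>.Over G := Cmd.over_embed (fun o => o.elim) _ hV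
  have h2 := Cmd.over_clearAll (O := GameOracle) (Q := Q ⊕ V.Q ⊕ ℕ) (G := G)
    (V.clUsed.map (ver (A := C)))
  have h3 := Cmd.over_discardAll (O := GameOracle) (C := C ⊕ V.C ⊕ ℕ) (G := G)
    (V.quUsed.map (ver (A := Q)))
  simp [Cmd.simulatePayment, Cmd.Over, Cmd.shift, Cmd.copy, Cmd.moveQubits, Cmd.transfer,
    Cmd.setInput, PublicVerifier.verifyNext, h1, h2, h3]

/-- Besides the gates of the adversary and the verifier, the reduction uses only the coin toss. -/
theorem over_reduction (hG : cliffordT ⊆ G) {V : PublicVerifier} (hV : V.code.Over G)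
    {P : Program GameOracle} (hP : P.code.Over G) (d : ℕ) : (reduction V P d).code.Over G := by
  have hcoin : Gate.const coinToss ∈ G := hG (by simp [cliffordT])
  have h1 : (Cmd.numTosses (A := P.C) (B := V.C) (Q := P.Q ⊕ V.Q ⊕ ℕ) d).Over G := by
    induction d with
    | zero => trivial
    | succ d ih =>
      simp [Cmd.numTosses, Cmd.Over, Cmd.copy, Cmd.transfer, Cmd.digits, Cmd.halve, ih]
  have h2 : (P.code.embed Sum.inl Sum.inl (Cmd.onCall V)).Over G := by
    refine Cmd.over_embed (fun o q x => ?_) _ hP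
    cases o with
    | pay =>
      have := over_simulatePayment hV q x
      simp [Cmd.onCall, Cmd.payment, Cmd.Over, this]
    | mint | privVerify => trivial
  simp [reduction, Cmd.Over, Cmd.sample, Cmd.toss, Cmd.transfer, Cmd.setInput, Cmd.copy,
    Cmd.settle, h1, h2, hcoin]

end Over

/-- A bound for the number of steps of the reduction. -/
def reductionTime (V : PublicVerifier) (lam l τ t d : ℕ) : ℕ :=
  d * ((lam + 1) * (11 * (lam + 1) + 6) + 10 * lam + 8) +
    (d * Nat.size (lam + 1)) * (14 * 2 ^ (d * Nat.size (lam + 1)) + 15) + 10 * lam + 10 * l +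
    (simulationTime V lam l τ (lam + l + t) + 3) * t + 20

namespace CoinScheme

variable (M : CoinScheme)

/-- Each sequence of `m` tosses has probability `2 ^ (-m)`. -/
theorem normSq_smul_coin (m : ℕ) (ψ : Ket) :
    normSq ((((√2 : ℝ) : ℂ)⁻¹ ^ m) • ψ) = ((2 : ℝ) ^ m)⁻¹ * normSq ψ := by
  rw [normSq_smul]
  congr 1
  rw [norm_pow, norm_inv, Complex.norm_real, Real.norm_eq_abs, abs_of_nonneg (Real.sqrt_nonneg 2),
    ← pow_mul, Nat.mul_comm, pow_mul, inv_pow, Real.sq_sqrt (by norm_num), inv_pow]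

/-- The runs of the reduction. -/
theorem run_reduction {lam : ℕ} (sk : M.Key lam) {T : ℕ → ℕ}
    (hT : (M.verifier lam).RunsIn lam (M.coinLen lam) T) {τ t : ℕ}
    (hτ : ∀ n < lam + M.coinLen lam + t, T n ≤ τ) {P : Program GameOracle}
    (ht : HaltsIn (M.oracles lam sk) t (P.start lam (M.coinLen lam) World.init)) (d : ℕ) :
    let S := reductionTime (M.verifier lam) lam (M.coinLen lam) τ t d
    let R := run (M.oracles lam sk) S
      ((reduction (M.verifier lam) P d).start lam (M.coinLen lam) World.init)
    HaltsIn (M.oracles lam sk) S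
        ((reduction (M.verifier lam) P d).start lam (M.coinLen lam) World.init) ∧
      (∀ e ∈ R, numPayments e.world.log = 1 ∧
        ∃ e' ∈ run (M.oracles lam sk) t (P.start lam (M.coinLen lam) World.init),
          e.world.log.length ≤ e'.world.log.length + 1 ∧
          numCoins e.world.log ≤ numCoins e'.world.log) ∧
      ∑ j ∈ Finset.range (2 ^ (d * Nat.size (lam + 1))),
          partialLoss j (M.oracles lam sk) t (P.start lam (M.coinLen lam) World.init) ≤
        2 ^ (d * Nat.size (lam + 1)) *
          (R.map fun e => normSq e.world.ket * totalLoss e.world.log).sum := by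
  intro S R
  set m := d * Nat.size (lam + 1) with hm
  set κ : ℂ := ((√2 : ℝ) : ℂ)⁻¹ ^ m with hκ
  set c := P.start lam (M.coinLen lam) World.init with hc
  -- After sampling, the simulated game starts from a memory scaled by `κ`. Scaling commutes with
  -- all operators, so its runs are the scaled runs of the game.
  set c' := c.map (κ • LinearMap.id) id with hc'
  have hsep : Sep ∅ c.world.next c.qu := Sep.empty (by simp)
  have hmap := fun t => run_map (CommutesOff.smul_id ∅ κ)
    (M.equivariant_oracles lam sk (CommutesOff.smul_id ∅ κ) (g := id) fun _ _ => rfl)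
    (M.respectsNames_oracles lam sk) t hsep
  have ht' : HaltsIn (M.oracles lam sk) t c' := (haltsIn_map (CommutesOff.smul_id ∅ κ)
    (M.equivariant_oracles lam sk (CommutesOff.smul_id ∅ κ) (g := id) fun _ _ => rfl)
    (M.respectsNames_oracles lam sk) hsep).2 ht
  have hloss : ∀ j, partialLoss j (M.oracles lam sk) t c' =
      ((2 : ℝ) ^ m)⁻¹ * partialLoss j (M.oracles lam sk) t c := by
    intro j
    rw [partialLoss, hc', hmap t, partialLoss, ← List.sum_map_mul_left, List.map_map]
    refine congrArg _ (List.map_congr_left fun e _ => ?_)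
    simp only [Function.comp_apply, Config.map, World.map, LinearMap.smul_apply,
      LinearMap.id_apply, id, hκ, normSq_smul_coin]
    ring
  have hN : ∀ x, (c'.cl x).length + t ≤ lam + M.coinLen lam + t := by
    intro x
    have : (P.input lam (M.coinLen lam) x).length ≤ lam + M.coinLen lam := by
      simp only [Program.input, Function.update_apply]
      split_ifs <;> simp
    exact Nat.add_le_add_right this t
  -- `L j` are the final configurations of the reduction when the counter starts at `j`.
  choose L hL using fun j => M.unfolds_game lam sk j hT hτ (c := c') hsep hN ht'
  have hsample := (Big.sample (orc := M.oracles lam sk) (fun _ : P.C => [])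
    (fun _ : (M.verifier lam).C => []) (List.replicate (M.coinLen lam) true)
    (join (fun _ : P.Q => []) (fun _ : (M.verifier lam).Q => []) (ownQ [] [])) World.init lam
    d).seq (b := .setInput (M.verifier lam) (Sum.inl P.secParam) (Sum.inl P.coinSize))
      (fun j _ => Big.setInput_outer P.secParam P.coinSize lam (M.coinLen lam)
        (List.replicate j true) [] [] [] _ _)
  rw [← List.map_eq_flatMap] at hsample
  have hall := Unfolds.seq (k := []) hsample
    (b := .seq (P.code.embed Sum.inl Sum.inl (Cmd.onCall (M.verifier lam))) .settle)
    (L := L) (m := (simulationTime (M.verifier lam) lam (M.coinLen lam) τ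
      (lam + M.coinLen lam + t) + 3) * t + 2 + 1) (fun j _ => by
      -- At the empty log the position is `some j`, whose counter is `j` in unary; hence the sampled
      -- store is definitionally the embedded start of the game.
      have h := Unfolds.head (orc := M.oracles lam sk)
        (c := Store.config ⟨join (P.input lam (M.coinLen lam)) (fun _ => [])
          (own (List.replicate lam true) (List.replicate (M.coinLen lam) true)
            (List.replicate j true) [] [] [] [] []),
          join (fun _ : P.Q => []) (fun _ : (M.verifier lam).Q => []) (ownQ [] []),
          ⟨0, κ • World.init.ket, []⟩⟩
          [.seq (P.code.embed Sum.inl Sum.inl (Cmd.onCall (M.verifier lam))) .settle])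
        (I := [()]) (φ := fun _ => (adversaryEmbedding (M.verifier lam) P.C P.Q lam
          (M.coinLen lam) j).config [.settle] c') rfl (L := fun _ => L j)
        (fun _ _ => (hL j).1)
      rw [List.flatMap_singleton] at h
      exact h)
  have hstart : (reduction (M.verifier lam) P d).start lam (M.coinLen lam) World.init =
      Store.config ⟨join (fun _ : P.C => []) (fun _ : (M.verifier lam).C => [])
        (own (List.replicate lam true) (List.replicate (M.coinLen lam) true) [] [] [] [] [] []),
        join (fun _ : P.Q => []) (fun _ : (M.verifier lam).Q => []) (ownQ [] []), World.init⟩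
        [(reduction (M.verifier lam) P d).code] := by
    have h1 : (reduction (M.verifier lam) P d).input lam (M.coinLen lam) =
        join (fun _ : P.C => []) (fun _ : (M.verifier lam).C => [])
          (own (List.replicate lam true) (List.replicate (M.coinLen lam) true)
            [] [] [] [] [] []) := by
      have h0 : (fun _ : P.C ⊕ (M.verifier lam).C ⊕ ℕ => ([] : List Bool)) =
          join (fun _ => []) (fun _ => []) (own [] [] [] [] [] [] [] []) := by
        funext x
        rcases x with x | x | _ | _ | _ | _ | _ | _ | _ | _ | x <;> rfl
      change Function.update (Function.update (fun _ : P.C ⊕ (M.verifier lam).C ⊕ ℕ => []) (stk 0)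
        (List.replicate lam true)) (stk 1) (List.replicate (M.coinLen lam) true) = _
      rw [h0]
      simp
    have h2 : (fun _ : P.Q ⊕ (M.verifier lam).Q ⊕ ℕ => ([] : List ℕ)) =
        join (fun _ => []) (fun _ => []) (ownQ [] []) := by
      funext x
      rcases x with x | x | _ | _ | _ | _ | _ | _ | _ | _ | x <;> rfl
    simp only [Program.start, Store.config, h1]
    rw [← h2]
    rfl
  have hS : Unfolds (M.oracles lam sk) S
      ((reduction (M.verifier lam) P d).start lam (M.coinLen lam) World.init)
      ((List.range (2 ^ m)).flatMap L) := by
    rw [hstart]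
    refine Unfolds.mono hall ?_
    simp only [S, reductionTime]
    omega
  -- All the listed configurations have halted, so `hS` can be used with no time left and identifies
  -- them with the final configurations.
  have hhalt : ∀ e ∈ (List.range (2 ^ m)).flatMap L, HaltsIn (M.oracles lam sk) 0 e := by
    intro e he
    obtain ⟨j, -, he⟩ := List.mem_flatMap.1 he
    have := ((hL j).2.1 e he).1
    simpa [HaltsIn, run] using this
  obtain ⟨h1, h2⟩ := hS 0 hhalt
  have hR : R = (List.range (2 ^ m)).flatMap L := by
    have : run (M.oracles lam sk) 0 = fun c : Config GameOracle (reduction (M.verifier lam) P d).C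
      (reduction (M.verifier lam) P d).Q => [c] := rfl
    rw [this, List.flatMap_singleton'] at h2
    exact h2
  refine ⟨h1, fun e he => ?_, ?_⟩
  · rw [hR] at he
    obtain ⟨j, -, he⟩ := List.mem_flatMap.1 he
    obtain ⟨-, h3, e', he', h4⟩ := (hL j).2.1 e he
    rw [hc', hmap t] at he'
    obtain ⟨e'', he'', rfl⟩ := List.mem_map.1 he'
    exact ⟨h3, e'', he'', h4⟩
  · have h3 : ((List.range (2 ^ m)).map fun j => partialLoss j (M.oracles lam sk) t c').sum ≤
        (R.map fun e => normSq e.world.ket * totalLoss e.world.log).sum := by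
      rw [hR]
      exact (List.sum_le_sum fun j _ => (hL j).2.2).trans_eq (sum_map_flatMap _ _ _).symm
    have h4 : ((List.range (2 ^ m)).map fun j => partialLoss j (M.oracles lam sk) t c').sum =
        ((2 : ℝ) ^ m)⁻¹ * ∑ j ∈ Finset.range (2 ^ m), partialLoss j (M.oracles lam sk) t c := by
      simp only [hloss, List.sum_map_mul_left]
      rfl
    rw [h4, inv_mul_le_iff₀ (by positivity)] at h3
    exact h3

end CoinScheme

/-! ### Polynomial bounds -/

namespace PolyBounded

variable {f g : ℕ → ℕ}

theorem mono (hg : PolyBounded g) (h : ∀ n, f n ≤ g n) : PolyBounded f := by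
  obtain ⟨p, hp⟩ := hg
  exact ⟨p, fun n => (h n).trans (hp n)⟩

theorem eval (p : Polynomial ℕ) : PolyBounded fun n => p.eval n := ⟨p, fun _ => le_rfl⟩

theorem const (c : ℕ) : PolyBounded fun _ => c := ⟨.C c, by simp⟩

theorem id : PolyBounded fun n => n := ⟨.X, by simp⟩

theorem add (hf : PolyBounded f) (hg : PolyBounded g) : PolyBounded fun n => f n + g n := by
  obtain ⟨p, hp⟩ := hf
  obtain ⟨q, hq⟩ := hg
  exact ⟨p + q, fun n => by simpa using Nat.add_le_add (hp n) (hq n)⟩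

theorem mul (hf : PolyBounded f) (hg : PolyBounded g) : PolyBounded fun n => f n * g n := by
  obtain ⟨p, hp⟩ := hf
  obtain ⟨q, hq⟩ := hg
  exact ⟨p * q, fun n => by simpa using Nat.mul_le_mul (hp n) (hq n)⟩

theorem pow (hf : PolyBounded f) (d : ℕ) : PolyBounded fun n => f n ^ d := by
  obtain ⟨p, hp⟩ := hf
  exact ⟨p ^ d, fun n => by simpa using Nat.pow_le_pow_left (hp n) d⟩

end PolyBounded

theorem eval_mono (p : Polynomial ℕ) : Monotone fun n => p.eval n := by
  intro a b h
  simp only [Polynomial.eval_eq_sum, Polynomial.sum]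
  gcongr

theorem PolyBounded.comp {f : ℕ → ℕ} (hf : PolyBounded f) (p : Polynomial ℕ) :
    PolyBounded fun n => p.eval (f n) := by
  obtain ⟨q, hq⟩ := hf
  exact ⟨p.comp q, fun n => by simpa using eval_mono p (hq n)⟩

/-- The base is at least two, so coefficients and sums can be absorbed into the exponent. -/
theorem exists_eval_le_pow (p : Polynomial ℕ) : ∃ d, ∀ n, p.eval n ≤ (n + 2) ^ d := by
  induction p using Polynomial.induction_on' with
  | add p q hp hq =>
    obtain ⟨a, ha⟩ := hp
    obtain ⟨b, hb⟩ := hq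
    refine ⟨a + b + 1, fun n => ?_⟩
    have h1 := (ha n).trans (Nat.pow_le_pow_right (by omega) (Nat.le_add_right a b))
    have h2 := (hb n).trans (Nat.pow_le_pow_right (by omega) (Nat.le_add_left b a))
    calc (p + q).eval n = p.eval n + q.eval n := by simp
      _ ≤ (n + 2) ^ (a + b) * 2 := by omega
      _ ≤ (n + 2) ^ (a + b) * (n + 2) := Nat.mul_le_mul_left _ (by omega)
      _ = _ := (pow_succ _ _).symm
  | monomial k a =>
    refine ⟨a + k, fun n => ?_⟩
    rw [Polynomial.eval_monomial, pow_add]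
    exact Nat.mul_le_mul ((Nat.lt_two_pow_self).le.trans (Nat.pow_le_pow_left (by omega) a))
      (Nat.pow_le_pow_left (by omega) k)

theorem add_two_le_two_pow_size (n : ℕ) : n + 2 ≤ 2 ^ Nat.size (n + 1) :=
  Nat.lt_size_self (n + 1)

theorem two_pow_size_le (n : ℕ) : 2 ^ Nat.size (n + 1) ≤ 2 * (n + 1) := by
  have h0 : 0 < Nat.size (n + 1) := Nat.size_pos.2 n.succ_pos
  have h1 : 2 ^ (Nat.size (n + 1) - 1) ≤ n + 1 := Nat.lt_size.1 (by omega)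
  obtain ⟨s, hs⟩ : ∃ s, Nat.size (n + 1) = s + 1 := ⟨_, (Nat.succ_pred_eq_of_pos h0).symm⟩
  rw [hs, Nat.add_sub_cancel] at h1
  rw [hs, pow_succ]
  omega

theorem size_le (n : ℕ) : Nat.size (n + 1) ≤ n + 1 := Nat.size_le.2 Nat.lt_two_pow_self

/-- The number of possible values of the counter is polynomially bounded. -/
theorem two_pow_mul_size_le (d n : ℕ) : 2 ^ (d * Nat.size (n + 1)) ≤ (2 * (n + 1)) ^ d := by
  rw [Nat.mul_comm, pow_mul]
  exact Nat.pow_le_pow_left (two_pow_size_le n) d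

/-- The right-hand side is a power of two whose exponent a program can compute from the security
parameter in unary; only the constant `d` depends on `k`. -/
theorem exists_le_two_pow_mul_size {k : ℕ → ℕ} (hk : PolyBounded k) :
    ∃ d, ∀ n, k n ≤ 2 ^ (d * Nat.size (n + 1)) := by
  obtain ⟨p, hp⟩ := hk
  obtain ⟨d, hd⟩ := exists_eval_le_pow p
  refine ⟨d, fun n => (hp n).trans ((hd n).trans ?_)⟩
  rw [Nat.mul_comm, pow_mul]
  exact Nat.pow_le_pow_left (add_two_le_two_pow_size n) d

/-- The factor is at most the polynomial `(2 * (n + 1)) ^ d`, and superpolynomial decay survives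
multiplication by polynomials. -/
theorem Negligible.two_pow_mul {ε : ℕ → ℝ} (h : Negligible ε) (d : ℕ) :
    Negligible fun n => 2 ^ (d * Nat.size (n + 1)) * ε n := by
  refine (Asymptotics.SuperpolynomialDecay.polynomial_mul h
    ((2 * (.X + 1)) ^ d)).trans_abs_le fun n => ?_
  rw [abs_mul, abs_mul]
  refine mul_le_mul_of_nonneg_right ?_ (abs_nonneg _)
  rw [abs_of_nonneg (by positivity)]
  refine le_trans ?_ (le_abs_self _)
  simp only [Polynomial.eval_pow, Polynomial.eval_mul, Polynomial.eval_add, Polynomial.eval_X,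
    Polynomial.eval_one, Polynomial.eval_ofNat]
  exact_mod_cast two_pow_mul_size_le d n

/-- The number of steps of the reduction is polynomially bounded. -/
theorem polyBounded_reductionTime (V : PublicVerifier) {l τ t : ℕ → ℕ} (hl : PolyBounded l)
    (hτ : PolyBounded τ) (ht : PolyBounded t) (d : ℕ) :
    PolyBounded fun n => reductionTime V n (l n) (τ n) (t n) d := by
  have hs : PolyBounded fun n => Nat.size (n + 1) :=
    (PolyBounded.id.add (.const 1)).mono size_le
  have h2 : PolyBounded fun n => 2 ^ (d * Nat.size (n + 1)) :=
    (((PolyBounded.const 2).mul (PolyBounded.id.add (.const 1))).pow d).mono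
      (two_pow_mul_size_le d)
  have h10 : ∀ {f : ℕ → ℕ} (c : ℕ), PolyBounded f → PolyBounded fun n => c * f n :=
    fun c hf => (PolyBounded.const c).mul hf
  have h1 : PolyBounded fun n => n + 1 := PolyBounded.id.add (.const 1)
  have h3 : PolyBounded fun n => n + l n + t n := (PolyBounded.id.add hl).add ht
  have h4 : PolyBounded fun n => simulationTime V n (l n) (τ n) (n + l n + t n) :=
    (((((h3.mul ((hτ.add (h10 56 hl)).add (.const 43))).add (h10 10 .id)).add (h10 10 hl)).add
      (.const _)).add (.const _)).add (.const 30)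
  exact ((((((h10 d (((h1.mul ((h10 11 h1).add (.const 6))).add (h10 10 .id)).add (.const 8))).add
    ((h10 d hs).mul ((h10 14 h2).add (.const 15)))).add (h10 10 .id)).add (h10 10 hl)).add
      ((h4.add (.const 3)).mul ht)).add (.const 20))

/-! ### Security against several verifiers -/

namespace CoinScheme

variable (M : CoinScheme)

/-- The reduction, for each security parameter. -/
def singleAdversary (A : Adversary) (d : ℕ) : Adversary :=
  fun lam => reduction (M.verifier lam) (A lam) d

variable {M} {A : Adversary}

section Run

variable {lam : ℕ} {T : ℕ → ℕ} (hT : (M.verifier lam).RunsIn lam (M.coinLen lam) T) {τ t : ℕ}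
  (hτ : ∀ n < lam + M.coinLen lam + t, T n ≤ τ)
  (ht : ∀ sk, HaltsIn (M.oracles lam sk) t (M.gameStart A lam)) (d : ℕ)

include hT hτ ht

theorem haltsIn_singleAdversary (sk : M.Key lam) :
    HaltsIn (M.oracles lam sk) (reductionTime (M.verifier lam) lam (M.coinLen lam) τ t d)
      (M.gameStart (M.singleAdversary A d) lam) :=
  (M.run_reduction sk hT hτ (ht sk) d).1

theorem mem_outcomes_singleAdversary {sk : M.Key lam} {e}
    (he : e ∈ M.outcomes (M.singleAdversary A d) lam sk) :
    numPayments e.world.log = 1 ∧ ∃ e' ∈ M.outcomes A lam sk,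
      e.world.log.length ≤ e'.world.log.length + 1 ∧
      numCoins e.world.log ≤ numCoins e'.world.log := by
  rw [outcomes, (haltsIn_singleAdversary hT hτ ht d sk).exec_eq] at he
  rw [outcomes, (ht sk).exec_eq]
  exact (M.run_reduction sk hT hτ (ht sk) d).2.1 e he

/-- Every run makes at most `2 ^ (d * Nat.size (lam + 1))` payments, so the total loss is the sum of
the selected losses over the whole range of the counter. `run_reduction` bounds this sum for each
key, and integration over the key concludes. -/
theorem expectedLoss_le {k : ℕ → ℕ} (hA : Attacks M k A)
    (hk : k lam ≤ 2 ^ (d * Nat.size (lam + 1))) :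
    M.expectedLoss A lam ≤
      2 ^ (d * Nat.size (lam + 1)) * M.expectedLoss (M.singleAdversary A d) lam := by
  rw [expectedLoss, expectedLoss, ← MeasureTheory.integral_const_mul]
  simp only [outcomes, (ht _).exec_eq, (haltsIn_singleAdversary hT hτ ht d _).exec_eq]
  -- Monotonicity requires both integrals to exist, which `integrable_run` provides.
  refine MeasureTheory.integral_mono (M.integrable_run lam t _ totalLoss)
    ((M.integrable_run lam _ _ totalLoss).const_mul _) fun sk => ?_
  refine le_trans (le_of_eq ?_) (M.run_reduction sk hT hτ (ht sk) d).2.2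
  have h1 : ∀ e ∈ run (M.oracles lam sk) t (M.gameStart A lam),
      normSq e.world.ket * totalLoss e.world.log =
        ((List.range (2 ^ (d * Nat.size (lam + 1)))).map fun j =>
          normSq e.world.ket * selectedLoss j e.world.log).sum := by
    intro e he
    have h2 := hA lam sk e (by rwa [outcomes, (ht sk).exec_eq])
    rw [← sum_selectedLoss (h2.trans_le hk), List.sum_map_mul_left]
    rfl
  rw [List.map_congr_left h1, sum_sum_comm]
  rfl

end Run

end CoinScheme

/-- If the losses caused by the reductions are negligible, so is the loss of several verifiers. -/
theorem LossNegligible.of_reduction {M : CoinScheme} {cls cls' : AdversaryClass} {k : ℕ → ℕ}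
    (hk : PolyBounded k) (hM : LossNegligible M cls fun _ => 1)
    (h : ∀ A d, cls' M k A → cls M (fun _ => 1) (M.singleAdversary A d))
    (h' : ∀ A, cls' M k A → Attacks M k A ∧
      ∀ lam, ∃ t, ∀ sk, HaltsIn (M.oracles lam sk) t (M.gameStart A lam)) :
    LossNegligible M cls' k := by
  intro A hA
  obtain ⟨d, hd⟩ := exists_le_two_pow_mul_size hk
  obtain ⟨ε, hε, hle⟩ := hM _ (h A d hA)
  obtain ⟨h1, h2⟩ := h' A hA
  refine ⟨_, hε.two_pow_mul d, fun lam => ?_⟩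
  obtain ⟨T, hT⟩ := M.verifier_halts lam
  obtain ⟨t, ht⟩ := h2 lam
  -- Here `τ` only has to exist: a maximum over finitely many numbers of coins, without any
  -- polynomial bound.
  exact (CoinScheme.expectedLoss_le hT (τ := (Finset.range (lam + M.coinLen lam + t)).sup T)
    (fun n hn => Finset.le_sup (Finset.mem_range.2 hn)) ht d h1 (hd lam)).trans
    (mul_le_mul_of_nonneg_left (hle lam) (by positivity))

/-- A simulated payment costs one query to the mint in place of one payment, and settling adds at
most one query, hence `p + 1`. Settling submits no coins, so the number of coins does not grow. -/
theorem unbounded_singleAdversary {M : CoinScheme} {k : ℕ → ℕ} {A : Adversary}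
    (hA : unbounded M k A) (d : ℕ) : unbounded M (fun _ => 1) (M.singleAdversary A d) ∧
      ∀ lam sk, ∀ e ∈ M.outcomes (M.singleAdversary A d) lam sk,
        ∃ e' ∈ M.outcomes A lam sk, numCoins e.world.log ≤ numCoins e'.world.log := by
  obtain ⟨h1, h2, p, hp⟩ := hA
  have key : ∀ lam, ∃ T, (M.verifier lam).RunsIn lam (M.coinLen lam) T ∧ ∃ t τ,
      (∀ n < lam + M.coinLen lam + t, T n ≤ τ) ∧
        ∀ sk, HaltsIn (M.oracles lam sk) t (M.gameStart A lam) := by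
    intro lam
    obtain ⟨T, hT⟩ := M.verifier_halts lam
    obtain ⟨t, ht⟩ := h2 lam
    exact ⟨T, hT, t, (Finset.range (lam + M.coinLen lam + t)).sup T,
      fun n hn => Finset.le_sup (Finset.mem_range.2 hn), ht⟩
  choose T hT t τ hτ ht using key
  refine ⟨⟨fun lam sk e he => ?_, fun lam => ⟨_, fun sk =>
    CoinScheme.haltsIn_singleAdversary (hT lam) (hτ lam) (ht lam) d sk⟩, p + 1,
    fun lam sk e he => ?_⟩, fun lam sk e he => ?_⟩
  · exact (CoinScheme.mem_outcomes_singleAdversary (hT lam) (hτ lam) (ht lam) d he).1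
  · obtain ⟨-, e', he', h3, -⟩ :=
      CoinScheme.mem_outcomes_singleAdversary (hT lam) (hτ lam) (ht lam) d he
    simpa using h3.trans (Nat.add_le_add_right (hp lam sk e' he') 1)
  · obtain ⟨-, e', he', -, h4⟩ :=
      CoinScheme.mem_outcomes_singleAdversary (hT lam) (hτ lam) (ht lam) d he
    exact ⟨e', he', h4⟩

theorem qpa_singleAdversary {G : GateSet} (hG : cliffordT ⊆ G) {M : CoinScheme}
    (hM : PublicVerificationQPT M G) {k : ℕ → ℕ} {A : Adversary} (hA : qpa G M k A) (d : ℕ) :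
    qpa G M (fun _ => 1) (M.singleAdversary A d) := by
  obtain ⟨hl, ⟨V, hVG, hV⟩, q, hq⟩ := hM
  obtain ⟨-, ⟨P, hPG, hP⟩, p, hp⟩ := hA
  -- A stack initially holds at most `lam + M.coinLen lam` elements and grows by at most one per
  -- step, which limits the coins of any payment. Monotonicity of `q` turns this into a uniform
  -- polynomial time for each verification.
  have hτ : ∀ lam, ∀ n < lam + M.coinLen lam + p.eval lam, q.eval (lam + n) ≤
      q.eval (lam + (lam + M.coinLen lam + p.eval lam)) :=
    fun lam n hn => eval_mono q (by omega)
  refine ⟨fun lam sk e he => ?_, ⟨reduction V P d, over_reduction hG hVG hPG d, fun lam => ?_⟩, ?_⟩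
  · exact (CoinScheme.mem_outcomes_singleAdversary (hq lam) (hτ lam) (hp lam) d he).1
  · rw [CoinScheme.singleAdversary, hV, hP]
  · obtain ⟨r, hr⟩ := polyBounded_reductionTime V hl (PolyBounded.comp
      (PolyBounded.id.add ((PolyBounded.id.add hl).add (.eval p))) q) (.eval p) d
    refine ⟨r, fun lam sk => (CoinScheme.haltsIn_singleAdversary (hq lam) (hτ lam) (hp lam) d
      sk).mono ?_⟩
    rw [hV lam]
    exact hr lam

end QCoin

end

theorem mainTheorem8 (G : QCoin.GateSet) (hG : QCoin.cliffordT ⊆ G) (M : QCoin.CoinScheme) :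
    (QCoin.PublicVerificationQPT M G → QCoin.RationallySecure M (QCoin.qpa G) →
      QCoin.MultiverifierRationallySecure M (QCoin.qpa G)) ∧
    (QCoin.RationallySecure M QCoin.unbounded →
      QCoin.MultiverifierRationallySecure M QCoin.unbounded) ∧
    (QCoin.RationallySecure M QCoin.unboundedPolyCoins →
      QCoin.MultiverifierRationallySecure M QCoin.unboundedPolyCoins) := by
  refine ⟨fun hV hM k hk => ?_, fun hM k hk => ?_, fun hM k hk => ?_⟩
  · refine QCoin.LossNegligible.of_reduction hk hM
      (fun A d hA => QCoin.qpa_singleAdversary hG hV hA d) fun A hA => ⟨hA.1, fun lam => ?_⟩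
    obtain ⟨-, -, p, hp⟩ := hA
    exact ⟨_, hp lam⟩
  · exact QCoin.LossNegligible.of_reduction hk hM
      (fun A d hA => (QCoin.unbounded_singleAdversary hA d).1) fun A hA => ⟨hA.1, hA.2.1⟩
  · refine QCoin.LossNegligible.of_reduction hk hM
      (fun A d hA => ?_) fun A hA => ⟨hA.1.1, hA.1.2.1⟩
    obtain ⟨h1, h2⟩ := QCoin.unbounded_singleAdversary hA.1 d
    obtain ⟨-, p, hp⟩ := hA
    refine ⟨h1, p, fun lam sk e he => ?_⟩
    obtain ⟨e', he', h3⟩ := h2 lam sk e he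
    exact h3.trans (hp lam sk e' he')
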